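/- Let $W,V\colon(0,\infty)^2\to[0,\infty)$ be measurable and symmetric with $0\le W(x,y)\le 1$ and $0\le V(x,y)\le \frac1{x+y}$, and for $\varepsilon\in[0,1]$ put $K_\varepsilon=2+\varepsilon W$, $F_\varepsilon=2+\varepsilon V$. For $\alpha\ge 1$ let $L^1_\alpha$ be the space of $f\in L^1(0,\infty)$ with $\|f\|_{L^1_\alpha}=\int_0^\infty(1+x)^\alpha|f(x)|\,dx<\infty$. For a kernel pair $(K,F)$ and a non-negative $f_0\in L^1_\alpha$, a (mild) solution of the coagulation-fragmentation equation in $L^1_\alpha$ with initial datum $f_0$ is a non-negative $f\in C([0,\infty),L^1_\alpha)$ such that for all $t\ge 0$ $$f_t=f_0+\int_0^t\bigl(\mathcal C_K(f_s,f_s)+\mathcal F_F(f_s)\bigr)\,ds ,$$ where $$\mathcal C_K(f,g)(x)=\tfrac12\int_0^xK(x-y,y)f(x-y)g(y)\,dy-\tfrac12 f(x)\int_0^\infty K(x,y)g(y)\,dy-\tfrac12 g(x)\int_0^\infty K(x,y)f(y)\,dy,$$ $$\mathcal F_F(f)(x)=-\tfrac12 f(x)\int_0^xF(y,x-y)\,dy+\int_0^\infty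 F(x,y)f(x+y)\,dy .$$ If $1\le\alpha<2$, solutions are moreover required to conserve mass, $\int_0^\infty xf_t(x)\,dx=\int_0^\infty xf_0(x)\,dx$ for all $t\ge0$ (no such requirement is made for $\alpha\ge2$). Then for every $\alpha\ge1$ and every non-negative $f_0\in L^1_\alpha$ there are constants $C,A>0$, depending only on $\alpha$ and $f_0$ (in particular not on $\varepsilon$), such that for all $W,V$ as above and all $\varepsilon\in[0,1]$, if $f^\varepsilon$ and $f^0$ are solutions in $L^1_\alpha$ with the initial datum $f_0$ for the kernels $(K_\varepsilon,F_\varepsilon)$ and $(K_0,F_0)=(2,2)$ respectively, then $$\|f^\varepsilon_t-f^0_t\|_{L^1_\alpha}\le\varepsilon\,C\,\bigl(e^{At}-1\bigr)\qquad\text{for all }t\ge0 .$$ -/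

import Mathlib

open MeasureTheory Set Filter Topology

noncomputable section

/-- The weighted norm `∫₀^∞ (1 + x)^α |g(x)| dx` of `L¹_α`. -/
def normL1 (α : ℝ) (g : ℝ → ℝ) : ℝ :=
  ∫ x in Ioi (0 : ℝ), (1 + x) ^ α * |g x|

/-- `g`, as a function on `(0,∞)`, belongs to `L¹_α`. -/
def MemL1 (α : ℝ) (g : ℝ → ℝ) : Prop :=
  IntegrableOn g (Ioi (0 : ℝ)) ∧
    IntegrableOn (fun x => (1 + x) ^ α * |g x|) (Ioi (0 : ℝ))

/-- The moment `M_β(g) = ∫₀^∞ x^β g(x) dx`. -/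
def moment (β : ℝ) (g : ℝ → ℝ) : ℝ :=
  ∫ x in Ioi (0 : ℝ), x ^ β * g x

/-- The (bilinear) coagulation operator `𝒞_K(f,g)`. -/
def coag (K : ℝ → ℝ → ℝ) (f g : ℝ → ℝ) (x : ℝ) : ℝ :=
  (1 / 2) * (∫ y in (0 : ℝ)..x, K (x - y) y * f (x - y) * g y)
    - (1 / 2) * f x * (∫ y in Ioi (0 : ℝ), K x y * g y)
    - (1 / 2) * g x * (∫ y in Ioi (0 : ℝ), K x y * f y)

/-- The fragmentation operator `ℱ_F(f)`. -/
def frag (F : ℝ → ℝ → ℝ) (f : ℝ → ℝ) (x : ℝ) : ℝ :=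
  -(1 / 2) * (∫ y in (0 : ℝ)..x, F y (x - y)) * f x
    + ∫ y in Ioi (0 : ℝ), F x y * f (x + y)

/-- `f` is a (mild) solution in `C([0,∞), L¹_α)` of the coagulation-fragmentation equation with
kernels `K`, `F` and initial datum `f₀`. Elements of `C([0,∞), L¹_α)` are given through jointly
measurable representatives `(t, x) ↦ f t x`, of which only the values for `t ≥ 0`, `x > 0` matter;
for these, the Bochner integral over `[0,t]` is computed pointwise for almost every `x`. -/
structure IsMildSolution (K F : ℝ → ℝ → ℝ) (α : ℝ) (f₀ : ℝ → ℝ) (f : ℝ → ℝ → ℝ) : Prop where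
  measurable : Measurable (Function.uncurry f)
  memL1 : ∀ t, 0 ≤ t → MemL1 α (f t)
  continuous : ∀ t, 0 ≤ t →
    Tendsto (fun s => normL1 α (fun x => f s x - f t x)) (𝓝[Ici 0] t) (𝓝 0)
  nonneg : ∀ t, 0 ≤ t → ∀ᵐ x ∂(volume.restrict (Ioi (0 : ℝ))), 0 ≤ f t x
  mild : ∀ t, 0 ≤ t → ∀ᵐ x ∂(volume.restrict (Ioi (0 : ℝ))),
    IntervalIntegrable (fun s => coag K (f s) (f s) x + frag F (f s) x) volume 0 t ∧
      f t x = f₀ x + ∫ s in (0 : ℝ)..t, (coag K (f s) (f s) x + frag F (f s) x)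

/-- The total mass is conserved: `M₁(f_t) = M₁(f₀)` for all `t ≥ 0`. -/
def ConservesMass (f₀ : ℝ → ℝ) (f : ℝ → ℝ → ℝ) : Prop :=
  ∀ t, 0 ≤ t → moment 1 (f t) = moment 1 f₀

/-- The kernel `2 + ε W`. -/
def pertKernel (ε : ℝ) (W : ℝ → ℝ → ℝ) : ℝ → ℝ → ℝ := fun x y => 2 + ε * W x y

/-- `W` and `V` are admissible perturbations of the coagulation and of the fragmentation kernel:
measurable and, on `(0,∞)²`, symmetric with `0 ≤ W ≤ 1` and `0 ≤ V(x,y) ≤ 1/(x+y)`. -/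
structure IsAdmissible (W V : ℝ → ℝ → ℝ) : Prop where
  measurable_W : Measurable (Function.uncurry W)
  measurable_V : Measurable (Function.uncurry V)
  symm_W : ∀ x y, 0 < x → 0 < y → W x y = W y x
  symm_V : ∀ x y, 0 < x → 0 < y → V x y = V y x
  bound_W : ∀ x y, 0 < x → 0 < y → 0 ≤ W x y ∧ W x y ≤ 1
  bound_V : ∀ x y, 0 < x → 0 < y → 0 ≤ V x y ∧ V x y ≤ 1 / (x + y)

end

/-! Let g be the difference of the two solutions and consider the evolution of ∫ (1+x)^α |g|.
Fragmentation with the constant kernel 2 has the unbounded loss rate x. Tested against a weight φ it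
acts as 2∫₀^z φ − zφ(z), and for φ(z) = (1+z)^α with α ≥ 1 this is at most φ(z): the unbounded parts
cancel, provided the loss keeps its sign, and multiplication by sign g ensures this. Coagulation
with a bounded kernel is a bounded bilinear map on L¹_α, because 1+x+y ≤ (1+x)(1+y). The
perturbations cost O(ε): W is bounded, and ∫₀^z V(y,z−y) dy ≤ 1. If Λ bounds both norms, then ‖g‖
grows at rate at most (2+6Λ)‖g‖ + ε(2Λ+2Λ²), and Gronwall's inequality concludes
(`integral_sign_mul_rhs_sub_le`, `normL1_sub_le_exp`).

Two inputs are needed. The first is a bound Λ independent of time and of the kernels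
(`exists_normL1_bound`). Coagulation damps the zeroth moment quadratically because K ≥ 2, and mass
does not increase, so M₀ + M₁ stays bounded. For α > 1, fragmentation contributes a negative moment
of order α+1, while the coagulation gain is bounded by M₁-type times M_{α−1}-type moments; the
former absorbs the latter.

The second concerns infinity. The weight x(1+x)^α need not be integrable against f, so only
compactly supported test functions are available, and a cut-off at R leaves a boundary term of order
∫_{x>R} (1+x+R²) f. It need not vanish in the limit: e^{λt}(λ+x)^{-3} solves pure fragmentation with
kernel 2, lies in L¹_α for α < 2 and gains mass. `NoFlux` asks that the time integral of this term
tends to 0. For α ≥ 2 it follows from integrability (`noFlux_of_two_le`); for α < 2 it is extracted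
from mass conservation (`noFlux_of_conservesMass`). -/

/-! ### Real-variable tools: chain rule for |G|, a barrier argument, Gronwall -/

theorem measurable_sign_real : Measurable Real.sign := by
  unfold Real.sign
  exact Measurable.ite measurableSet_Iio measurable_const
    (Measurable.ite measurableSet_Ioi measurable_const measurable_const)

theorem abs_sign_le_one (r : ℝ) : |Real.sign r| ≤ 1 := by
  rcases Real.sign_apply_eq r with h | h | h <;> simp [h]

/-- The chain rule for `|G|`, where `G` is the primitive of an integrable function. -/
theorem abs_integral_eq_integral_sign_mul {h : ℝ → ℝ} {t : ℝ}
    (hh : IntervalIntegrable h volume 0 t) :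
    |∫ s in (0 : ℝ)..t, h s| = ∫ s in (0 : ℝ)..t, Real.sign (∫ r in (0 : ℝ)..s, h r) * h s := by
  set G : ℝ → ℝ := fun s => ∫ r in (0 : ℝ)..s, h r with hG
  have hac : AbsolutelyContinuousOnInterval G 0 t :=
    hh.absolutelyContinuousOnInterval_intervalIntegral (by simp)
  have hacA : AbsolutelyContinuousOnInterval (fun s => |G s|) 0 t := by
    have h0 : Tendsto (fun E : ℕ × (ℕ → ℝ × ℝ) =>
        ∑ i ∈ Finset.range E.1, dist (|G (E.2 i).1|) (|G (E.2 i).2|))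
        (AbsolutelyContinuousOnInterval.totalLengthFilter ⊓
          𝓟 (AbsolutelyContinuousOnInterval.disjWithin 0 t)) (𝓝 0) := by
      refine squeeze_zero (fun E => Finset.sum_nonneg fun _ _ => dist_nonneg) (fun E => ?_) hac
      refine Finset.sum_le_sum fun i _ => ?_
      simp only [Real.dist_eq]
      exact abs_abs_sub_abs_le _ _
    exact h0
  have hFTC := hacA.integral_deriv_eq_sub
  have hG0 : G 0 = 0 := by simp [hG]
  simp only [hG0, abs_zero, sub_zero] at hFTC
  rw [← hFTC]
  refine intervalIntegral.integral_congr_ae ?_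
  filter_upwards [hacA.ae_differentiableAt, hh.ae_hasDerivAt_integral] with s hs1 hs2 hs
  have hs' : s ∈ uIcc 0 t := uIoc_subset_uIcc hs
  have hd : HasDerivAt G (h s) s := hs2 hs' 0 (by simp)
  have hdA := (hs1 hs').hasDerivAt
  rcases lt_trichotomy (G s) 0 with hlt | heq | hgt
  · rw [Real.sign_of_neg hlt, neg_one_mul]
    have h1 := (hasDerivAt_abs_neg hlt).comp s hd
    rw [neg_one_mul] at h1
    exact hdA.unique h1
  -- Where G vanishes, |G| has a minimum, so its derivative is 0; the right-hand side agrees because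
  -- `Real.sign 0 = 0`.
  · change deriv (fun s => |G s|) s = Real.sign (G s) * h s
    rw [heq, Real.sign_zero, zero_mul]
    refine IsLocalMin.deriv_eq_zero (Eventually.of_forall fun r => ?_)
    simp [heq]
  · rw [Real.sign_of_pos hgt, one_mul]
    have h1 := (hasDerivAt_abs_pos hgt).comp s hd
    rw [one_mul] at h1
    exact hdA.unique h1

/-- Integral form of Y' + Y ≤ C. After the last time r at which Y is below the barrier, Y exceeds C,
so the inequality started at r gives Y t ≤ Y r. This is why it is assumed for every starting time r.
-/
theorem le_max_of_add_integral_le {Y : ℝ → ℝ} {C : ℝ} (hY : ContinuousOn Y (Ici 0))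
    (h : ∀ r t, 0 ≤ r → r ≤ t → Y t + ∫ s in r..t, Y s ≤ Y r + C * (t - r)) {t : ℝ}
    (ht : 0 ≤ t) : Y t ≤ max (Y 0) C := by
  by_contra! hlt
  set B := max (Y 0) C with hB
  have hcont : ContinuousOn Y (Icc 0 t) := hY.mono Icc_subset_Ici_self
  have hcl : IsCompact (Icc 0 t ∩ Y ⁻¹' Iic B) :=
    isCompact_Icc.of_isClosed_subset (hcont.preimage_isClosed_of_isClosed isClosed_Icc isClosed_Iic)
      inter_subset_left
  obtain ⟨r, ⟨hr, hrB⟩, hmax⟩ := hcl.exists_isGreatest ⟨0, ⟨le_rfl, ht⟩, le_max_left (Y 0) C⟩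
  have hgt : ∀ s ∈ Ioc r t, B < Y s := by
    intro s hs
    by_contra! hle
    exact absurd (hmax ⟨⟨hr.1.trans hs.1.le, hs.2⟩, hle⟩) (not_le.2 hs.1)
  have hint : B * (t - r) ≤ ∫ s in r..t, Y s := by
    have : ∫ s in r..t, B ≤ ∫ s in r..t, Y s := by
      refine intervalIntegral.integral_mono_on_of_le_Ioo hr.2 (by simp) ?_
        fun s hs => (hgt s ⟨hs.1, hs.2.le⟩).le
      exact (hcont.mono (Icc_subset_Icc_left hr.1)).intervalIntegrable_of_Icc hr.2
    simpa [mul_comm] using this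
  have h1 := h r t hr.1 hr.2
  have h2 : C * (t - r) ≤ B * (t - r) :=
    mul_le_mul_of_nonneg_right (le_max_right _ _) (sub_nonneg.2 hr.2)
  have h3 : Y r ≤ B := hrB
  linarith

/-- Gronwall's inequality in integral form. -/
theorem le_exp_of_le_integral {Y : ℝ → ℝ} {A B : ℝ} (hA : 0 < A)
    (hY : ContinuousOn Y (Ici 0))
    (h : ∀ t, 0 ≤ t → Y t ≤ A * (∫ s in (0 : ℝ)..t, Y s) + B * t) {t : ℝ} (ht : 0 ≤ t) :
    Y t ≤ B / A * (Real.exp (A * t) - 1) := by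
  -- Extending Y to the left by its value at 0 makes its primitive differentiable everywhere.
  set Z : ℝ → ℝ := fun s => Y (max s 0) with hZ
  have hZc : Continuous Z := hY.comp_continuous (by fun_prop) fun s => le_max_right s 0
  have hZY : ∀ s, 0 ≤ s → ∫ r in (0 : ℝ)..s, Y r = ∫ r in (0 : ℝ)..s, Z r := by
    intro s hs
    refine intervalIntegral.integral_congr fun r hr => ?_
    rw [uIcc_of_le hs] at hr
    simp [hZ, hr.1]
  -- The summand B/A makes the derivative A Y + B of the bracket at most A times the bracket, so u
  -- decreases from u 0 = B/A.
  set u : ℝ → ℝ := fun s => Real.exp (-(A * s)) * (A * (∫ r in (0 : ℝ)..s, Z r) + B * s + B / A)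
  have hder : ∀ s, HasDerivAt u (Real.exp (-(A * s)) * (-A) *
      (A * (∫ r in (0 : ℝ)..s, Z r) + B * s + B / A) +
      Real.exp (-(A * s)) * (A * Z s + B)) s := by
    intro s
    have h1 : HasDerivAt (fun s => ∫ r in (0 : ℝ)..s, Z r) (Z s) s :=
      hZc.integral_hasStrictDerivAt 0 s |>.hasDerivAt
    have h2 : HasDerivAt (fun s => Real.exp (-(A * s))) (Real.exp (-(A * s)) * (-A)) s := by
      have := ((hasDerivAt_id s).const_mul A).neg.exp
      simpa using this
    have h3 : HasDerivAt (fun s => A * (∫ r in (0 : ℝ)..s, Z r) + B * s + B / A)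
        (A * Z s + B) s := by
      have := ((h1.const_mul A).add ((hasDerivAt_id s).const_mul B)).add_const (B / A)
      simpa using this
    exact h2.mul h3
  have hanti : AntitoneOn u (Icc 0 t) := by
    refine antitoneOn_of_deriv_nonpos (convex_Icc 0 t)
      (fun s _ => (hder s).continuousAt.continuousWithinAt)
      (fun s _ => (hder s).differentiableAt.differentiableWithinAt) fun s hs => ?_
    rw [interior_Icc] at hs
    rw [(hder s).deriv]
    have h1 := h s hs.1.le
    rw [hZY s hs.1.le] at h1
    have h2 : Z s = Y s := by simp [hZ, hs.1.le]
    rw [h2]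
    have h3 : A * (B / A) = B := by field_simp
    have h4 : -A * (A * (∫ r in (0 : ℝ)..s, Z r) + B * s + B / A) + (A * Y s + B) ≤ 0 := by
      have := mul_le_mul_of_nonneg_left h1 hA.le
      nlinarith
    have := mul_nonpos_of_nonneg_of_nonpos (Real.exp_pos (-(A * s))).le h4
    linarith
  have h1 := hanti (left_mem_Icc.2 ht) (right_mem_Icc.2 ht) ht
  have h2 := h t ht
  rw [hZY t ht] at h2
  simp only [u, mul_zero, Real.exp_zero, intervalIntegral.integral_same, zero_add,
    Real.exp_neg] at h1
  rw [inv_mul_le_iff₀ (Real.exp_pos _)] at h1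
  linarith

/-! ### Integrating a pointwise mild equation against a weight -/

theorem measurable_intervalIntegral_param {γ : Type*} [MeasurableSpace γ] {F : γ → ℝ → ℝ}
    (hF : Measurable (Function.uncurry F)) {a b : γ → ℝ} (ha : Measurable a) (hb : Measurable b) :
    Measurable fun p => ∫ y in a p..b p, F p y := by
  have key : ∀ a b : γ → ℝ, Measurable a → Measurable b →
      Measurable fun p => ∫ y in Ioc (a p) (b p), F p y := by
    intro a b ha hb
    have hS : MeasurableSet {q : γ × ℝ | a q.1 < q.2 ∧ q.2 ≤ b q.1} :=
      (measurableSet_lt (ha.comp measurable_fst) measurable_snd).inter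
        (measurableSet_le measurable_snd (hb.comp measurable_fst))
    have h1 : Measurable (indicator {q : γ × ℝ | a q.1 < q.2 ∧ q.2 ≤ b q.1}
        (Function.uncurry F)) := hF.indicator hS
    have h2 := h1.stronglyMeasurable.integral_prod_right' (ν := volume)
    convert h2.measurable using 2 with p
    rw [← integral_indicator measurableSet_Ioc]
    rfl
  exact (key a b ha hb).sub (key b a hb ha)

theorem integral_mul_eq_add_of_mild {μ : Measure ℝ} [SFinite μ] {u u₀ ψ : ℝ → ℝ} {h : ℝ → ℝ → ℝ}
    {t : ℝ} (ht : 0 ≤ t) (hu : ∀ᵐ x ∂μ, u x = u₀ x + ∫ s in (0 : ℝ)..t, h s x)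
    (hi : Integrable (fun p : ℝ × ℝ => ψ p.2 * h p.1 p.2) ((volume.restrict (Ioc 0 t)).prod μ))
    (hu₀ : Integrable (fun x => ψ x * u₀ x) μ) :
    ∫ x, ψ x * u x ∂μ = (∫ x, ψ x * u₀ x ∂μ) + ∫ s in (0 : ℝ)..t, ∫ x, ψ x * h s x ∂μ := by
  rw [intervalIntegral.integral_of_le ht, integral_integral_swap hi,
    ← integral_add hu₀ hi.integral_prod_right]
  refine integral_congr_ae ?_
  filter_upwards [hu] with x hx
  simp only [hx, intervalIntegral.integral_of_le ht, mul_add, integral_const_mul]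

/-- The chain rule for the absolute value is applied in time at almost every fixed x, and Fubini
then exchanges the integrals. No differentiability of the norm is needed. -/
theorem integral_mul_abs_eq_of_mild {μ : Measure ℝ} [SFinite μ] {ψ : ℝ → ℝ} {g h : ℝ → ℝ → ℝ}
    {t : ℝ} (ht : 0 ≤ t) (hgm : Measurable (Function.uncurry g))
    (hhm : Measurable (Function.uncurry h))
    (hg : ∀ s, 0 ≤ s → s ≤ t → ∀ᵐ x ∂μ, IntervalIntegrable (fun r => h r x) volume 0 s ∧
      g s x = ∫ r in (0 : ℝ)..s, h r x)
    (hi : Integrable (fun p : ℝ × ℝ => ψ p.2 * h p.1 p.2) ((volume.restrict (Ioc 0 t)).prod μ)) :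
    IntervalIntegrable (fun s => ∫ x, ψ x * (Real.sign (g s x) * h s x) ∂μ) volume 0 t ∧
      ∫ x, ψ x * |g t x| ∂μ =
        ∫ s in (0 : ℝ)..t, ∫ x, ψ x * (Real.sign (g s x) * h s x) ∂μ := by
  have hi' : Integrable (fun p : ℝ × ℝ => ψ p.2 * (Real.sign (g p.1 p.2) * h p.1 p.2))
      ((volume.restrict (Ioc 0 t)).prod μ) := by
    have hs : Measurable fun p : ℝ × ℝ => Real.sign (g p.1 p.2) := measurable_sign_real.comp hgm
    refine (hi.bdd_mul (c := 1) hs.aestronglyMeasurable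
      (Eventually.of_forall fun p => abs_sign_le_one _)).congr (Eventually.of_forall fun p => ?_)
    simp only
    ring
  -- The mild identity holds for every s at almost every x, whereas the chain rule at fixed x needs
  -- it for almost every s. Exchanging the quantifiers requires the set to be jointly measurable.
  have hae : ∀ᵐ x ∂μ, ∀ᵐ s ∂(volume.restrict (Ioc 0 t)), g s x = ∫ r in (0 : ℝ)..s, h r x := by
    have hm : MeasurableSet {p : ℝ × ℝ | g p.1 p.2 = ∫ r in (0 : ℝ)..p.1, h r p.2} := by
      refine measurableSet_eq_fun hgm ?_
      refine measurable_intervalIntegral_param (F := fun (p : ℝ × ℝ) r => h r p.2) ?_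
        measurable_const measurable_fst
      exact hhm.comp (measurable_snd.prodMk (measurable_snd.comp measurable_fst))
    rw [← Measure.ae_ae_comm hm]
    rw [ae_restrict_iff' measurableSet_Ioc]
    filter_upwards with s hs
    filter_upwards [hg s hs.1.le hs.2] with x hx using hx.2
  refine ⟨(intervalIntegrable_iff_integrableOn_Ioc_of_le ht).2 hi'.integral_prod_left, ?_⟩
  rw [intervalIntegral.integral_of_le ht, integral_integral_swap hi']
  refine integral_congr_ae ?_
  filter_upwards [hae, hg t ht le_rfl] with x hx1 hx2
  rw [integral_const_mul, hx2.2, abs_integral_eq_integral_sign_mul hx2.1,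
    intervalIntegral.integral_of_le ht]
  congr 1
  refine integral_congr_ae ?_
  filter_upwards [hx1] with s hs
  simp only [hs]

theorem integral_lincomb_four {β : Type*} [MeasurableSpace β] {μ : Measure β} {f₁ f₂ f₃ f₄ : β → ℝ}
    (c₁ c₂ c₃ c₄ : ℝ)
    (h₁ : Integrable f₁ μ) (h₂ : Integrable f₂ μ) (h₃ : Integrable f₃ μ) (h₄ : Integrable f₄ μ) :
    Integrable (fun x => c₁ * f₁ x + c₂ * f₂ x + c₃ * f₃ x + c₄ * f₄ x) μ ∧
      ∫ x, (c₁ * f₁ x + c₂ * f₂ x + c₃ * f₃ x + c₄ * f₄ x) ∂μ =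
        c₁ * (∫ x, f₁ x ∂μ) + c₂ * (∫ x, f₂ x ∂μ) + c₃ * (∫ x, f₃ x ∂μ) + c₄ * ∫ x, f₄ x ∂μ := by
  have i₁ := h₁.const_mul c₁
  have i₂ := h₂.const_mul c₂
  have i₃ := h₃.const_mul c₃
  have i₄ := h₄.const_mul c₄
  have i₁₂ : Integrable (fun x => c₁ * f₁ x + c₂ * f₂ x) μ := i₁.add i₂
  have i₁₂₃ : Integrable (fun x => c₁ * f₁ x + c₂ * f₂ x + c₃ * f₃ x) μ := i₁₂.add i₃
  refine ⟨i₁₂₃.add i₄, ?_⟩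
  rw [integral_add i₁₂₃ i₄, integral_add i₁₂ i₃, integral_add i₁ i₂]
  simp only [integral_const_mul]

-- The shear (z, y) ↦ (z − y, y) and convolution-type integrals

local notation "ν₊" => (volume.restrict (Ioi (0 : ℝ)) : Measure ℝ)

/-- The pullback of `H`, living on the quadrant, under `(z, y) ↦ (z - y, y)`. -/
noncomputable def shear (H : ℝ → ℝ → ℝ) (p : ℝ × ℝ) : ℝ :=
  indicator (Ioi (0 : ℝ) ×ˢ Ioi (0 : ℝ)) (Function.uncurry H) (p.1 - p.2, p.2)

theorem measurePreserving_shear :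
    MeasurePreserving (fun p : ℝ × ℝ => (p.1 - p.2, p.2)) ((volume : Measure ℝ).prod volume)
      ((volume : Measure ℝ).prod volume) :=
  measurePreserving_sub_prod volume volume

theorem integrable_shear_iff {H : ℝ → ℝ → ℝ} (hH : Measurable (Function.uncurry H)) :
    Integrable (shear H) ((volume : Measure ℝ).prod volume) ↔
      Integrable (Function.uncurry H) (ν₊.prod ν₊) := by
  have hm : Measurable (indicator (Ioi (0 : ℝ) ×ˢ Ioi (0 : ℝ)) (Function.uncurry H)) :=
    hH.indicator (measurableSet_Ioi.prod measurableSet_Ioi)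
  rw [Measure.prod_restrict, ← IntegrableOn,
    ← integrable_indicator_iff (measurableSet_Ioi.prod measurableSet_Ioi)]
  exact measurePreserving_shear.integrable_comp hm.aestronglyMeasurable

theorem integral_shear {H : ℝ → ℝ → ℝ} (hH : Measurable (Function.uncurry H)) :
    ∫ p, shear H p ∂((volume : Measure ℝ).prod volume) =
      ∫ p, Function.uncurry H p ∂(ν₊.prod ν₊) := by
  have hm : Measurable (indicator (Ioi (0 : ℝ) ×ˢ Ioi (0 : ℝ)) (Function.uncurry H)) :=
    hH.indicator (measurableSet_Ioi.prod measurableSet_Ioi)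
  rw [Measure.prod_restrict, ← integral_indicator (measurableSet_Ioi.prod measurableSet_Ioi)]
  have := integral_map (μ := (volume : Measure ℝ).prod volume)
    measurePreserving_shear.measurable.aemeasurable
    (f := indicator (Ioi (0 : ℝ) ×ˢ Ioi (0 : ℝ)) (Function.uncurry H)) hm.aestronglyMeasurable
  rw [measurePreserving_shear.map_eq] at this
  exact this.symm

theorem shear_slice (H : ℝ → ℝ → ℝ) (z : ℝ) :
    (fun y => shear H (z, y)) = indicator (Ioo 0 z) (fun y => H (z - y) y) := by
  funext y
  by_cases h : y ∈ Ioo 0 z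
  · rw [indicator_of_mem h]
    simp only [shear]
    rw [indicator_of_mem (by exact ⟨sub_pos.2 h.2, h.1⟩)]
    rfl
  · rw [indicator_of_notMem h]
    simp only [shear]
    rw [indicator_of_notMem]
    rintro ⟨h1, h2⟩
    exact h ⟨h2, sub_pos.1 h1⟩

theorem integral_shear_slice (H : ℝ → ℝ → ℝ) {z : ℝ} (hz : 0 < z) :
    ∫ y, shear H (z, y) = ∫ y in (0 : ℝ)..z, H (z - y) y := by
  rw [shear_slice, integral_indicator measurableSet_Ioo, ← integral_Ioc_eq_integral_Ioo,
    intervalIntegral.integral_of_le hz.le]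

theorem integral_shear_slice_of_nonpos (H : ℝ → ℝ → ℝ) {z : ℝ} (hz : z ≤ 0) :
    ∫ y, shear H (z, y) = 0 := by
  rw [shear_slice, Ioo_eq_empty (not_lt.2 hz)]
  simp

theorem intervalIntegrable_shear_slice_iff (H : ℝ → ℝ → ℝ) {z : ℝ} (hz : 0 < z) :
    Integrable (fun y => shear H (z, y)) ↔
      IntervalIntegrable (fun y => H (z - y) y) volume 0 z := by
  rw [shear_slice, integrable_indicator_iff measurableSet_Ioo,
    intervalIntegrable_iff_integrableOn_Ioo_of_le hz.le]

section
variable {H : ℝ → ℝ → ℝ}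

theorem ae_intervalIntegrable_conv (hH : Measurable (Function.uncurry H))
    (hi : Integrable (Function.uncurry H) (ν₊.prod ν₊)) :
    ∀ᵐ z ∂ν₊, IntervalIntegrable (fun y => H (z - y) y) volume 0 z := by
  have h1 := ((integrable_shear_iff hH).2 hi).prod_right_ae
  rw [ae_restrict_iff' measurableSet_Ioi]
  filter_upwards [h1] with z hz hz0
  exact (intervalIntegrable_shear_slice_iff H hz0).1 hz

theorem integrable_conv (hH : Measurable (Function.uncurry H))
    (hi : Integrable (Function.uncurry H) (ν₊.prod ν₊)) :
    Integrable (fun z => ∫ y in (0 : ℝ)..z, H (z - y) y) ν₊ := by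
  have h1 := ((integrable_shear_iff hH).2 hi).integral_prod_left.restrict (s := Ioi (0 : ℝ))
  refine h1.congr ?_
  rw [EventuallyEq, ae_restrict_iff' measurableSet_Ioi]
  exact Eventually.of_forall fun z hz => integral_shear_slice H hz

theorem integral_conv (hH : Measurable (Function.uncurry H))
    (hi : Integrable (Function.uncurry H) (ν₊.prod ν₊)) :
    ∫ z, (∫ y in (0 : ℝ)..z, H (z - y) y) ∂ν₊ = ∫ p, H p.1 p.2 ∂(ν₊.prod ν₊) := by
  have h1 := integral_shear hH
  rw [integral_prod _ ((integrable_shear_iff hH).2 hi)] at h1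
  have h2 : ∫ p, H p.1 p.2 ∂(ν₊.prod ν₊) = ∫ p, Function.uncurry H p ∂(ν₊.prod ν₊) := rfl
  have h3 : ∫ z in Ioi (0 : ℝ), (∫ y, shear H (z, y)) = ∫ z, (∫ y, shear H (z, y)) :=
    setIntegral_eq_integral_of_forall_compl_eq_zero fun z hz =>
      integral_shear_slice_of_nonpos H (not_lt.1 hz)
  rw [h2, ← h1, ← h3]
  exact setIntegral_congr_fun measurableSet_Ioi fun z hz => (integral_shear_slice H hz).symm

theorem integral_abs_conv_le (hH : Measurable (Function.uncurry H))
    (hi : Integrable (Function.uncurry H) (ν₊.prod ν₊)) :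
    ∫ z, |∫ y in (0 : ℝ)..z, H (z - y) y| ∂ν₊ ≤ ∫ p, |H p.1 p.2| ∂(ν₊.prod ν₊) := by
  have hH' : Measurable (Function.uncurry fun x y => |H x y|) := hH.abs
  have hi' : Integrable (Function.uncurry fun x y => |H x y|) (ν₊.prod ν₊) := hi.abs
  rw [← integral_conv hH' hi']
  refine integral_mono_ae (integrable_conv hH hi).abs (integrable_conv hH' hi') ?_
  rw [EventuallyLE, ae_restrict_iff' measurableSet_Ioi]
  refine Eventually.of_forall fun z hz => ?_
  exact intervalIntegral.abs_integral_le_integral_abs (le_of_lt hz)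

/-- The Tonelli direction: integrability on the quadrant is read off from the slices x + y = z.
Fragmentation needs it, since there the slices are what can be estimated. -/
theorem integrable_of_conv (hH : Measurable (Function.uncurry H))
    (h1 : ∀ z, 0 < z → IntervalIntegrable (fun y => H (z - y) y) volume 0 z)
    (h2 : Integrable (fun z => ∫ y in (0 : ℝ)..z, |H (z - y) y|) ν₊) :
    Integrable (Function.uncurry H) (ν₊.prod ν₊) := by
  have hm : Measurable (shear H) :=
    (hH.indicator (measurableSet_Ioi.prod measurableSet_Ioi)).comp
      measurePreserving_shear.measurable
  rw [← integrable_shear_iff hH, integrable_prod_iff hm.aestronglyMeasurable]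
  refine ⟨Eventually.of_forall fun z => ?_, ?_⟩
  · rcases lt_or_ge 0 z with hz | hz
    · exact (intervalIntegrable_shear_slice_iff H hz).2 (h1 z hz)
    · rw [shear_slice, Ioo_eq_empty (not_lt.2 hz)]
      simp
  · have habs : ∀ z, ∫ y, ‖shear H (z, y)‖ = ∫ y, shear (fun x y => |H x y|) (z, y) := by
      intro z
      congr 1
      funext y
      simp only [shear, Real.norm_eq_abs]
      by_cases h : ((z, y).1 - (z, y).2, (z, y).2) ∈ Ioi (0 : ℝ) ×ˢ Ioi (0 : ℝ)
      · rw [indicator_of_mem h, indicator_of_mem h]; rfl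
      · rw [indicator_of_notMem h, indicator_of_notMem h, abs_zero]
    simp only [habs]
    rw [← integrableOn_iff_integrable_of_support_subset (s := Ioi (0 : ℝ))]
    · refine h2.congr ?_
      rw [EventuallyEq, ae_restrict_iff' measurableSet_Ioi]
      exact Eventually.of_forall fun z hz =>
        (integral_shear_slice (fun x y => |H x y|) hz).symm
    · intro z hz
      by_contra hcon
      exact hz (integral_shear_slice_of_nonpos _ (not_lt.1 hcon))

end

/-! ### Weighted bounds for the gain and loss operators -/

/-- The gain part of the coagulation operator. -/
noncomputable def coagGain (K : ℝ → ℝ → ℝ) (f g : ℝ → ℝ) (x : ℝ) : ℝ :=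
  ∫ y in (0 : ℝ)..x, K (x - y) y * f (x - y) * g y

/-- The gain part of the fragmentation operator. -/
noncomputable def fragGain (F : ℝ → ℝ → ℝ) (f : ℝ → ℝ) (x : ℝ) : ℝ :=
  ∫ y in Ioi (0 : ℝ), F x y * f (x + y)

/-- The product majorant φ(x)φ(y) factorises the double integral. It is used with φ = 1 for bounded
test functions and with φ = (1+x)^α, which is submultiplicative along x + y. -/
theorem integrable_prod_weight {K : ℝ → ℝ → ℝ} {κ B : ℝ} {f g φ : ℝ → ℝ} {w : ℝ × ℝ → ℝ}
    (hK : Measurable (Function.uncurry K)) (hKb : ∀ x y, 0 < x → 0 < y → |K x y| ≤ κ)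
    (hf : Measurable f) (hg : Measurable g) (hw : Measurable w)
    (hB : 0 ≤ B)
    (hwb : ∀ x y, 0 < x → 0 < y → |w (x, y)| ≤ B * (φ x * φ y))
    (hφf : Integrable (fun x => φ x * f x) ν₊) (hφg : Integrable (fun x => φ x * g x) ν₊) :
    Integrable (fun p : ℝ × ℝ => w p * (K p.1 p.2 * f p.1 * g p.2)) (ν₊.prod ν₊) ∧
      ∫ p : ℝ × ℝ, |w p * (K p.1 p.2 * f p.1 * g p.2)| ∂(ν₊.prod ν₊) ≤
        B * κ * (∫ x, |φ x * f x| ∂ν₊) * ∫ x, |φ x * g x| ∂ν₊ := by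
  have hdom : Integrable (fun p : ℝ × ℝ => B * κ * (|φ p.1 * f p.1| * |φ p.2 * g p.2|))
      (ν₊.prod ν₊) := (hφf.abs.mul_prod hφg.abs).const_mul (B * κ)
  have hle : ∀ᵐ p ∂(ν₊.prod ν₊), |w p * (K p.1 p.2 * f p.1 * g p.2)| ≤
      B * κ * (|φ p.1 * f p.1| * |φ p.2 * g p.2|) := by
    rw [Measure.prod_restrict, ae_restrict_iff' (measurableSet_Ioi.prod measurableSet_Ioi)]
    refine Eventually.of_forall fun ⟨x, y⟩ ⟨hx, hy⟩ => ?_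
    have h1 := hwb x y hx hy
    have h2 := hKb x y hx hy
    have h3 : φ x * φ y ≤ |φ x| * |φ y| := by rw [← abs_mul]; exact le_abs_self _
    simp only [abs_mul]
    calc |w (x, y)| * (|K x y| * |f x| * |g y|) = |w (x, y)| * |K x y| * (|f x| * |g y|) := by ring
      _ ≤ B * (|φ x| * |φ y|) * κ * (|f x| * |g y|) := by
          gcongr
          exact h1.trans (mul_le_mul_of_nonneg_left h3 hB)
      _ = _ := by ring
  have hm : Measurable fun p : ℝ × ℝ => w p * (K p.1 p.2 * f p.1 * g p.2) :=
    hw.mul ((hK.mul (hf.comp measurable_fst)).mul (hg.comp measurable_snd))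
  have hi : Integrable (fun p : ℝ × ℝ => w p * (K p.1 p.2 * f p.1 * g p.2)) (ν₊.prod ν₊) :=
    hdom.mono' hm.aestronglyMeasurable hle
  refine ⟨hi, (integral_mono_ae hi.abs hdom hle).trans_eq ?_⟩
  rw [integral_const_mul, integral_prod_mul (fun x => |φ x * f x|) (fun x => |φ x * g x|)]
  ring

theorem integrable_mul_coagGain {K : ℝ → ℝ → ℝ} {κ B : ℝ} {f g φ w : ℝ → ℝ}
    (hK : Measurable (Function.uncurry K)) (hKb : ∀ x y, 0 < x → 0 < y → |K x y| ≤ κ)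
    (hf : Measurable f) (hg : Measurable g) (hw : Measurable w)
    (hB : 0 ≤ B)
    (hwb : ∀ x y, 0 < x → 0 < y → |w (x + y)| ≤ B * (φ x * φ y))
    (hφf : Integrable (fun x => φ x * f x) ν₊) (hφg : Integrable (fun x => φ x * g x) ν₊) :
    Integrable (fun x => w x * coagGain K f g x) ν₊ ∧
      ∫ x, w x * coagGain K f g x ∂ν₊ =
        ∫ p : ℝ × ℝ, w (p.1 + p.2) * (K p.1 p.2 * f p.1 * g p.2) ∂(ν₊.prod ν₊) ∧
      ∫ x, |w x * coagGain K f g x| ∂ν₊ ≤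
        B * κ * (∫ x, |φ x * f x| ∂ν₊) * ∫ x, |φ x * g x| ∂ν₊ := by
  have hwm : Measurable fun p : ℝ × ℝ => w (p.1 + p.2) :=
    hw.comp (measurable_fst.add measurable_snd)
  obtain ⟨hi, hle⟩ := integrable_prod_weight hK hKb hf hg hwm hB hwb hφf hφg
  set H : ℝ → ℝ → ℝ := fun x y => w (x + y) * (K x y * f x * g y) with hH
  have hHm : Measurable (Function.uncurry H) :=
    hwm.mul ((hK.mul (hf.comp measurable_fst)).mul (hg.comp measurable_snd))
  have heq : (fun x => w x * coagGain K f g x) = fun x => ∫ y in (0 : ℝ)..x, H (x - y) y := by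
    funext x
    rw [coagGain, ← intervalIntegral.integral_const_mul]
    simp only [hH, sub_add_cancel]
  have habs : (fun x => |w x * coagGain K f g x|) =
      fun x => |∫ y in (0 : ℝ)..x, H (x - y) y| := by
    funext x; exact congrArg abs (congrFun heq x)
  rw [heq, habs]
  exact ⟨integrable_conv hHm hi, integral_conv hHm hi, (integral_abs_conv_le hHm hi).trans hle⟩

theorem integrable_mul_coagLoss {K : ℝ → ℝ → ℝ} {κ B : ℝ} {f g φ w : ℝ → ℝ}
    (hK : Measurable (Function.uncurry K)) (hKb : ∀ x y, 0 < x → 0 < y → |K x y| ≤ κ)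
    (hf : Measurable f) (hg : Measurable g) (hw : Measurable w) (hB : 0 ≤ B)
    (hwb : ∀ x y, 0 < x → 0 < y → |w x| ≤ B * (φ x * φ y))
    (hφf : Integrable (fun x => φ x * f x) ν₊) (hφg : Integrable (fun x => φ x * g x) ν₊) :
    Integrable (fun x => w x * (f x * ∫ y in Ioi (0 : ℝ), K x y * g y)) ν₊ ∧
      ∫ x, w x * (f x * ∫ y in Ioi (0 : ℝ), K x y * g y) ∂ν₊ =
        ∫ p : ℝ × ℝ, w p.1 * (K p.1 p.2 * f p.1 * g p.2) ∂(ν₊.prod ν₊) ∧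
      ∫ x, |w x * (f x * ∫ y in Ioi (0 : ℝ), K x y * g y)| ∂ν₊ ≤
        B * κ * (∫ x, |φ x * f x| ∂ν₊) * ∫ x, |φ x * g x| ∂ν₊ := by
  obtain ⟨hi, hle⟩ := integrable_prod_weight hK hKb hf hg (hw.comp measurable_fst) hB hwb hφf hφg
  have heq : ∀ x, w x * (f x * ∫ y in Ioi (0 : ℝ), K x y * g y) =
      ∫ y in Ioi (0 : ℝ), w x * (K x y * f x * g y) := by
    intro x
    rw [← mul_assoc, ← integral_const_mul]
    congr 1
    funext y
    ring
  simp only [heq]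
  refine ⟨hi.integral_prod_left, (integral_prod _ hi).symm, ?_⟩
  refine le_trans ?_ hle
  have h1 := integral_prod _ hi.abs
  refine le_trans ?_ h1.symm.le
  refine integral_mono_ae hi.integral_prod_left.abs hi.abs.integral_prod_left ?_
  exact Eventually.of_forall fun x => abs_integral_le_integral_abs

/-- Duality through w(y) F(y,x) f(x+y): integration over x at fixed y gives w times the gain, while
integration along x + y = z gives f(z) times the weight collected by the fragments of z. Convergence
rests on the slice bound m alone. -/
theorem integrable_mul_fragGain {F : ℝ → ℝ → ℝ} {f w m : ℝ → ℝ}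
    (hF : Measurable (Function.uncurry F)) (hf : Measurable f) (hw : Measurable w)
    (h1 : ∀ z, 0 < z → IntervalIntegrable (fun y => w y * F y (z - y)) volume 0 z)
    (h2 : ∀ z, 0 < z → ∫ y in (0 : ℝ)..z, |w y * F y (z - y)| ≤ m z)
    (hmf : Integrable (fun x => m x * |f x|) ν₊) :
    Integrable (fun x => w x * fragGain F f x) ν₊ ∧
      ∫ x, w x * fragGain F f x ∂ν₊ =
        ∫ z, f z * (∫ y in (0 : ℝ)..z, w y * F y (z - y)) ∂ν₊ ∧
      ∫ x, |w x * fragGain F f x| ∂ν₊ ≤ ∫ x, m x * |f x| ∂ν₊ ∧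
      Integrable (fun z => f z * (∫ y in (0 : ℝ)..z, w y * F y (z - y))) ν₊ ∧
      ∀ᵐ x ∂ν₊, Integrable (fun y => w x * F x y * f (y + x)) ν₊ := by
  set H : ℝ → ℝ → ℝ := fun x y => w y * F y x * f (x + y) with hH
  have hHm : Measurable (Function.uncurry H) :=
    ((hw.comp measurable_snd).mul (hF.comp measurable_swap)).mul
      (hf.comp (measurable_fst.add measurable_snd))
  have hsl : ∀ z y, H (z - y) y = f z * (w y * F y (z - y)) := by
    intro z y
    simp only [hH, sub_add_cancel]
    ring
  have hdI : ∀ z, ∫ y in (0 : ℝ)..z, |H (z - y) y| =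
      |f z| * ∫ y in (0 : ℝ)..z, |w y * F y (z - y)| := by
    intro z
    simp only [hsl, abs_mul (f z), intervalIntegral.integral_const_mul]
  have hdle : ∀ᵐ z ∂ν₊, ∫ y in (0 : ℝ)..z, |H (z - y) y| ≤ m z * |f z| := by
    rw [ae_restrict_iff' measurableSet_Ioi]
    refine Eventually.of_forall fun z hz => ?_
    rw [hdI, mul_comm]
    exact mul_le_mul_of_nonneg_right (h2 z hz) (abs_nonneg _)
  have hmeas : Measurable fun z => ∫ y in (0 : ℝ)..z, |H (z - y) y| := by
    refine measurable_intervalIntegral_param (F := fun z y => |H (z - y) y|) ?_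
      measurable_const measurable_id
    exact (hHm.comp ((measurable_fst.sub measurable_snd).prodMk measurable_snd)).abs
  have hI : Integrable (Function.uncurry H) (ν₊.prod ν₊) := by
    refine integrable_of_conv hHm (fun z hz => ?_) ?_
    · simp only [hsl]
      exact (h1 z hz).const_mul _
    · refine hmf.mono' hmeas.aestronglyMeasurable ?_
      filter_upwards [hdle, ae_restrict_mem measurableSet_Ioi] with z hz hz0
      rw [Real.norm_eq_abs, abs_of_nonneg]
      · exact hz
      · exact intervalIntegral.integral_nonneg (le_of_lt hz0) fun _ _ => abs_nonneg _
  have hsw : Integrable (fun p : ℝ × ℝ => H p.2 p.1) (ν₊.prod ν₊) := hI.swap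
  have heq : (fun x => w x * fragGain F f x) = fun x => ∫ y in Ioi (0 : ℝ), H y x := by
    funext x
    rw [fragGain, ← integral_const_mul]
    simp only [hH]
    congr 1
    funext y
    rw [add_comm y x]
    ring
  have habs : (fun x => |w x * fragGain F f x|) = fun x => |∫ y in Ioi (0 : ℝ), H y x| := by
    funext x; exact congrArg abs (congrFun heq x)
  have hHm' : Measurable (Function.uncurry fun x y => |H x y|) := hHm.abs
  have hI' : Integrable (Function.uncurry fun x y => |H x y|) (ν₊.prod ν₊) := hI.abs
  rw [heq, habs]
  refine ⟨hsw.integral_prod_left, ?_, ?_, ?_, hsw.prod_right_ae⟩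
  · rw [← integral_prod (fun p : ℝ × ℝ => H p.2 p.1) hsw]
    have h3 := integral_prod_swap (μ := ν₊) (ν := ν₊) (Function.uncurry H)
    have h4 := integral_conv hHm hI
    simp only [hsl, intervalIntegral.integral_const_mul] at h4
    rw [h4]
    exact h3
  · have h5 : ∫ x, |∫ y in Ioi (0 : ℝ), H y x| ∂ν₊ ≤ ∫ x, (∫ y, |H y x| ∂ν₊) ∂ν₊ := by
      refine integral_mono_ae hsw.integral_prod_left.abs hsw.abs.integral_prod_left ?_
      exact Eventually.of_forall fun x => abs_integral_le_integral_abs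
    refine h5.trans ?_
    rw [← integral_prod (fun p : ℝ × ℝ => |H p.2 p.1|) hsw.abs]
    have h3 := integral_prod_swap (μ := ν₊) (ν := ν₊) (Function.uncurry fun x y => |H x y|)
    have h4 := integral_conv hHm' hI'
    refine (h3.trans h4.symm).le.trans ?_
    exact integral_mono_ae (integrable_conv hHm' hI') hmf hdle
  · have h6 := integrable_conv hHm hI
    simpa only [hsl, intervalIntegral.integral_const_mul] using h6

/-- Along the slice x + y = z the kernel bound is the constant a + b/z. -/
theorem integral_abs_fragSlice_le {F : ℝ → ℝ → ℝ} {a b : ℝ} {w : ℝ → ℝ}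
    (hF : Measurable (Function.uncurry F))
    (hFb : ∀ x y, 0 < x → 0 < y → |F x y| ≤ a + b / (x + y)) (hw : Measurable w) {z : ℝ}
    (hz : 0 < z) (hwi : IntervalIntegrable w volume 0 z) :
    IntervalIntegrable (fun y => w y * F y (z - y)) volume 0 z ∧
      ∫ y in (0 : ℝ)..z, |w y * F y (z - y)| ≤ (a + b / z) * ∫ y in (0 : ℝ)..z, |w y| := by
  have hle : ∀ y ∈ Ioo 0 z, |w y * F y (z - y)| ≤ (a + b / z) * |w y| := by
    intro y hy
    have := hFb y (z - y) hy.1 (sub_pos.2 hy.2)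
    rw [add_sub_cancel] at this
    rw [abs_mul, mul_comm]
    exact mul_le_mul_of_nonneg_right this (abs_nonneg _)
  have hm : Measurable fun y => w y * F y (z - y) :=
    hw.mul (hF.comp (measurable_id.prodMk (measurable_const.sub measurable_id)))
  have hi : IntervalIntegrable (fun y => w y * F y (z - y)) volume 0 z := by
    rw [intervalIntegrable_iff_integrableOn_Ioo_of_le hz.le] at hwi ⊢
    refine (hwi.abs.const_mul (a + b / z)).mono' hm.aestronglyMeasurable ?_
    rw [ae_restrict_iff' measurableSet_Ioo]
    exact Eventually.of_forall hle
  refine ⟨hi, ?_⟩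
  rw [← intervalIntegral.integral_const_mul]
  exact intervalIntegral.integral_mono_on_of_le_Ioo hz.le hi.abs (hwi.abs.const_mul _) hle

theorem integral_abs_fragKernel_le {F : ℝ → ℝ → ℝ} {a b : ℝ}
    (hF : Measurable (Function.uncurry F))
    (hFb : ∀ x y, 0 < x → 0 < y → |F x y| ≤ a + b / (x + y)) {z : ℝ} (hz : 0 < z) :
    IntervalIntegrable (fun y => F y (z - y)) volume 0 z ∧
      ∫ y in (0 : ℝ)..z, |F y (z - y)| ≤ a * z + b := by
  have h := integral_abs_fragSlice_le hF hFb (w := fun _ => 1) measurable_const hz (by simp)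
  simp only [one_mul, abs_one, intervalIntegral.integral_const, smul_eq_mul, mul_one,
    sub_zero] at h
  refine ⟨h.1, h.2.trans_eq ?_⟩
  field_simp

/-! ### The class of kernels and the weak form of the equation -/

/-- Kernels of the form `2 + ε W`, `2 + ε V`. -/
structure IsKernelPair (K F : ℝ → ℝ → ℝ) : Prop where
  measurable_K : Measurable (Function.uncurry K)
  measurable_F : Measurable (Function.uncurry F)
  symm_K : ∀ x y, 0 < x → 0 < y → K x y = K y x
  symm_F : ∀ x y, 0 < x → 0 < y → F x y = F y x
  bound_K : ∀ x y, 0 < x → 0 < y → 2 ≤ K x y ∧ K x y ≤ 3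
  bound_F : ∀ x y, 0 < x → 0 < y → 2 ≤ F x y ∧ F x y ≤ 2 + 1 / (x + y)

theorem IsAdmissible.isKernelPair {W V : ℝ → ℝ → ℝ} (h : IsAdmissible W V) {ε : ℝ} (h0 : 0 ≤ ε)
    (h1 : ε ≤ 1) : IsKernelPair (pertKernel ε W) (pertKernel ε V) where
  measurable_K := measurable_const.add (measurable_const.mul h.measurable_W)
  measurable_F := measurable_const.add (measurable_const.mul h.measurable_V)
  symm_K x y hx hy := by simp only [pertKernel, h.symm_W x y hx hy]
  symm_F x y hx hy := by simp only [pertKernel, h.symm_V x y hx hy]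
  bound_K x y hx hy := by
    obtain ⟨h2, h3⟩ := h.bound_W x y hx hy
    simp only [pertKernel]
    constructor <;> nlinarith
  bound_F x y hx hy := by
    obtain ⟨h2, h3⟩ := h.bound_V x y hx hy
    simp only [pertKernel]
    constructor
    · nlinarith
    · have : ε * V x y ≤ 1 * (1 / (x + y)) := mul_le_mul h1 h3 h2 zero_le_one
      linarith

namespace IsKernelPair

variable {K F : ℝ → ℝ → ℝ} (h : IsKernelPair K F)
include h

theorem abs_K_le (x y : ℝ) (hx : 0 < x) (hy : 0 < y) : |K x y| ≤ 3 := by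
  obtain ⟨h1, h2⟩ := h.bound_K x y hx hy
  rw [abs_of_nonneg (by linarith)]
  exact h2

theorem abs_F_le (x y : ℝ) (hx : 0 < x) (hy : 0 < y) : |F x y| ≤ 2 + 1 / (x + y) := by
  obtain ⟨h1, h2⟩ := h.bound_F x y hx hy
  rw [abs_of_nonneg (by linarith)]
  exact h2

end IsKernelPair

theorem coag_add_frag_eq (K F : ℝ → ℝ → ℝ) (f : ℝ → ℝ) (x : ℝ) :
    coag K f f x + frag F f x = (1 / 2) * coagGain K f f x
      - f x * (∫ y in Ioi (0 : ℝ), K x y * f y)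
      - (1 / 2) * ((∫ y in (0 : ℝ)..x, F y (x - y)) * f x) + fragGain F f x := by
  simp only [coag, frag, coagGain, fragGain]
  ring

/-- Both entries of the minimum matter: against the fragmentation bound 2 + 1/z, the entry z tames
1/z near zero and the entry R tames the constant 2 at infinity. -/
theorem integral_abs_le_of_bounded_support {ψ : ℝ → ℝ} {B R z : ℝ} (hψ : Measurable ψ)
    (hR : 0 ≤ R)
    (hψB : ∀ x, 0 < x → |ψ x| ≤ B) (hψR : ∀ x, R < x → ψ x = 0) (hz : 0 < z) :
    IntervalIntegrable ψ volume 0 z ∧ ∫ y in (0 : ℝ)..z, |ψ y| ≤ B * min z R := by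
  have hi : ∀ z, 0 ≤ z → IntervalIntegrable ψ volume 0 z := by
    intro z hz
    rw [intervalIntegrable_iff_integrableOn_Ioc_of_le hz]
    refine (integrable_const B).mono' hψ.aestronglyMeasurable ?_
    filter_upwards [ae_restrict_mem measurableSet_Ioc] with y hy using hψB y hy.1
  have hle : ∀ z, 0 ≤ z → ∫ y in (0 : ℝ)..z, |ψ y| ≤ B * z := by
    intro z hz
    have h1 : ∫ y in (0 : ℝ)..z, |ψ y| ≤ ∫ y in (0 : ℝ)..z, B :=
      intervalIntegral.integral_mono_on_of_le_Ioo hz (hi z hz).abs (by simp)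
        fun y hy => hψB y hy.1
    simpa [mul_comm] using h1
  refine ⟨hi z hz.le, ?_⟩
  rcases le_total z R with h | h
  · rw [min_eq_left h]; exact hle z hz.le
  · rw [min_eq_right h]
    have h2 : ∫ y in (0 : ℝ)..z, |ψ y| = (∫ y in (0 : ℝ)..R, |ψ y|) + ∫ y in R..z, |ψ y| := by
      rw [intervalIntegral.integral_add_adjacent_intervals (hi R hR).abs]
      exact ((hi R hR).symm.trans (hi z hz.le)).abs
    have h3 : ∫ y in R..z, |ψ y| = 0 := by
      refine intervalIntegral.integral_zero_ae (Eventually.of_forall fun y hy => ?_)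
      rw [uIoc_of_le h] at hy
      simp [hψR y hy.1]
    rw [h2, h3, add_zero]
    exact hle R hR

/-- The weak form of the right-hand side of the coagulation-fragmentation equation. -/
theorem IsKernelPair.weak_form {K F : ℝ → ℝ → ℝ} (h : IsKernelPair K F) {f ψ : ℝ → ℝ} {B R : ℝ}
    (hf : Measurable f) (hfi : Integrable f ν₊) (hψ : Measurable ψ) (hB : 0 ≤ B) (hR : 0 ≤ R)
    (hψB : ∀ x, 0 < x → |ψ x| ≤ B) (hψR : ∀ x, R < x → ψ x = 0) :
    Integrable (fun x => ψ x * (coag K f f x + frag F f x)) ν₊ ∧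
      ∫ x, |ψ x * (coag K f f x + frag F f x)| ∂ν₊ ≤
        B * (5 * (∫ x, |f x| ∂ν₊) * (∫ x, |f x| ∂ν₊) + (3 * R + 2) * ∫ x, |f x| ∂ν₊) ∧
      Integrable (fun p : ℝ × ℝ => (ψ (p.1 + p.2) - ψ p.1 - ψ p.2) *
        (K p.1 p.2 * f p.1 * f p.2)) (ν₊.prod ν₊) ∧
      Integrable (fun z => f z * ((∫ y in (0 : ℝ)..z, ψ y * F y (z - y)) -
        (1 / 2) * (ψ z * ∫ y in (0 : ℝ)..z, F y (z - y)))) ν₊ ∧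
      ∫ x, ψ x * (coag K f f x + frag F f x) ∂ν₊ =
        (1 / 2) * (∫ p : ℝ × ℝ, (ψ (p.1 + p.2) - ψ p.1 - ψ p.2) *
          (K p.1 p.2 * f p.1 * f p.2) ∂(ν₊.prod ν₊)) +
        ∫ z, f z * ((∫ y in (0 : ℝ)..z, ψ y * F y (z - y)) -
          (1 / 2) * (ψ z * ∫ y in (0 : ℝ)..z, F y (z - y))) ∂ν₊ := by
  have hf1 : Integrable (fun x => 1 * f x) ν₊ := by simpa using hfi
  obtain ⟨g1, g2, g3⟩ := integrable_mul_coagGain h.measurable_K h.abs_K_le hf hf hψ hB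
    (φ := fun _ => 1) (fun x y hx hy => by simpa using hψB (x + y) (add_pos hx hy)) hf1 hf1
  obtain ⟨l1, l2, l3⟩ := integrable_mul_coagLoss h.measurable_K h.abs_K_le hf hf hψ hB
    (φ := fun _ => 1) (fun x y hx hy => by simpa using hψB x hx) hf1 hf1
  have hslice := fun z (hz : 0 < z) =>
    integral_abs_le_of_bounded_support hψ hR hψB hψR hz
  obtain ⟨q1, q2, q3, q4, -⟩ := integrable_mul_fragGain (f := f) (m := fun _ => B * (2 * R + 1))
    h.measurable_F hf hψ
    (fun z hz => (integral_abs_fragSlice_le h.measurable_F h.abs_F_le hψ hz (hslice z hz).1).1)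
    (fun z hz => by
      refine (integral_abs_fragSlice_le h.measurable_F h.abs_F_le hψ hz (hslice z hz).1).2.trans ?_
      calc (2 + 1 / z) * ∫ y in (0 : ℝ)..z, |ψ y| ≤ (2 + 1 / z) * (B * min z R) :=
            mul_le_mul_of_nonneg_left (hslice z hz).2 (by positivity)
        _ = B * (2 * min z R + min z R / z) := by ring
        _ ≤ B * (2 * R + 1) := by
            have := min_le_right z R
            have : min z R / z ≤ 1 := by rw [div_le_one hz]; exact min_le_left _ _
            gcongr) (hfi.abs.const_mul _)
  have hFm : Measurable fun x => ∫ y in (0 : ℝ)..x, F y (x - y) :=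
    measurable_intervalIntegral_param (F := fun x y => F y (x - y))
      (h.measurable_F.comp (measurable_snd.prodMk (measurable_fst.sub measurable_snd)))
      measurable_const measurable_id
  have hdom : ∀ᵐ x ∂ν₊, |ψ x * ((∫ y in (0 : ℝ)..x, F y (x - y)) * f x)| ≤
      B * (2 * R + 1) * |f x| := by
    filter_upwards [ae_restrict_mem measurableSet_Ioi] with x hx
    rcases lt_or_ge R x with hxR | hxR
    · rw [hψR x hxR, zero_mul, abs_zero]
      positivity
    · rw [abs_mul, abs_mul, ← mul_assoc]
      refine mul_le_mul_of_nonneg_right ?_ (abs_nonneg _)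
      refine mul_le_mul (hψB x hx) ?_ (abs_nonneg _) hB
      refine (intervalIntegral.abs_integral_le_integral_abs (le_of_lt hx)).trans ?_
      refine (integral_abs_fragKernel_le h.measurable_F h.abs_F_le hx).2.trans ?_
      linarith
  have d1 : Integrable (fun x => ψ x * ((∫ y in (0 : ℝ)..x, F y (x - y)) * f x)) ν₊ :=
    (hfi.abs.const_mul _).mono' (hψ.mul (hFm.mul hf)).aestronglyMeasurable hdom
  have d3 : ∫ x, |ψ x * ((∫ y in (0 : ℝ)..x, F y (x - y)) * f x)| ∂ν₊ ≤
      B * (2 * R + 1) * ∫ x, |f x| ∂ν₊ := by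
    rw [← integral_const_mul]
    exact integral_mono_ae d1.abs (hfi.abs.const_mul _) hdom
  have heq : (fun x => ψ x * (coag K f f x + frag F f x)) = fun x =>
      (1 / 2) * (ψ x * coagGain K f f x)
        + (-1) * (ψ x * (f x * ∫ y in Ioi (0 : ℝ), K x y * f y))
        + (-(1 / 2)) * (ψ x * ((∫ y in (0 : ℝ)..x, F y (x - y)) * f x))
        + 1 * (ψ x * fragGain F f x) := by
    funext x
    rw [coag_add_frag_eq]
    ring
  obtain ⟨hI, hIe⟩ := integral_lincomb_four (1 / 2) (-1) (-(1 / 2)) 1 g1 l1 d1 q1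
  rw [← heq] at hI
  simp only [← congrFun heq] at hIe
  have hGp := (integrable_prod_weight h.measurable_K h.abs_K_le hf hf
    (hψ.comp (measurable_fst.add measurable_snd)) hB (φ := fun _ => 1)
    (fun x y hx hy => by simpa using hψB (x + y) (add_pos hx hy)) hf1 hf1).1
  have hLp := (integrable_prod_weight h.measurable_K h.abs_K_le hf hf
    (hψ.comp measurable_fst) hB (φ := fun _ => 1)
    (fun x y hx hy => by simpa using hψB x hx) hf1 hf1).1
  have hLs := (integrable_prod_weight h.measurable_K h.abs_K_le hf hf
    (hψ.comp measurable_snd) hB (φ := fun _ => 1)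
    (fun x y hx hy => by simpa using hψB y hy) hf1 hf1).1
  simp only [Function.comp_apply, Pi.add_apply] at hGp hLp hLs
  -- Symmetry of K splits the loss evenly between ψ(x) and ψ(y), which produces the defect ψ(x+y) −
  -- ψ(x) − ψ(y).
  have hLe : ∫ p : ℝ × ℝ, ψ p.1 * (K p.1 p.2 * f p.1 * f p.2) ∂(ν₊.prod ν₊) =
      ∫ p : ℝ × ℝ, ψ p.2 * (K p.1 p.2 * f p.1 * f p.2) ∂(ν₊.prod ν₊) := by
    rw [← integral_prod_swap]
    refine integral_congr_ae ?_
    rw [EventuallyEq, Measure.prod_restrict,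
      ae_restrict_iff' (measurableSet_Ioi.prod measurableSet_Ioi)]
    refine Eventually.of_forall fun ⟨x, y⟩ ⟨hx, hy⟩ => ?_
    simp only [Prod.swap]
    rw [h.symm_K y x hy hx]
    ring
  have hS : Integrable (fun p : ℝ × ℝ => (ψ (p.1 + p.2) - ψ p.1 - ψ p.2) *
      (K p.1 p.2 * f p.1 * f p.2)) (ν₊.prod ν₊) := by
    refine ((hGp.sub hLp).sub hLs).congr (Eventually.of_forall fun p => ?_)
    simp only [Pi.sub_apply]
    ring
  have hQ : Integrable (fun z => f z * ((∫ y in (0 : ℝ)..z, ψ y * F y (z - y)) -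
      (1 / 2) * (ψ z * ∫ y in (0 : ℝ)..z, F y (z - y)))) ν₊ := by
    refine (q4.sub (d1.const_mul (1 / 2))).congr (Eventually.of_forall fun p => ?_)
    simp only [Pi.sub_apply]
    ring
  refine ⟨hI, ?_, ?_, ?_, ?_⟩
  · obtain ⟨hJ, hJe⟩ :=
      integral_lincomb_four (1 / 2) 1 (1 / 2) 1 g1.abs l1.abs d1.abs q1.abs
    refine (integral_mono hI.abs hJ fun x => ?_).trans ?_
    · simp only [congrFun heq x]
      refine (abs_add_le _ _).trans (add_le_add ((abs_add_le _ _).trans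
        (add_le_add ((abs_add_le _ _).trans (add_le_add ?_ ?_)) ?_)) ?_) <;>
      · rw [abs_mul]; norm_num
    rw [hJe]
    simp only [one_mul] at g3 l3
    rw [integral_const_mul] at q3
    have hM : 0 ≤ ∫ x, |f x| ∂ν₊ := integral_nonneg fun _ => abs_nonneg _
    nlinarith [mul_nonneg hB (mul_nonneg hM hM), mul_nonneg hB hM]
  · exact hS
  · exact hQ
  · rw [hIe, g2, l2, q2]
    have e1 : ∫ z, f z * ((∫ y in (0 : ℝ)..z, ψ y * F y (z - y)) -
        (1 / 2) * (ψ z * ∫ y in (0 : ℝ)..z, F y (z - y))) ∂ν₊ =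
        (∫ z, f z * (∫ y in (0 : ℝ)..z, ψ y * F y (z - y)) ∂ν₊) -
        (1 / 2) * ∫ x, ψ x * ((∫ y in (0 : ℝ)..x, F y (x - y)) * f x) ∂ν₊ := by
      rw [← integral_const_mul, ← integral_sub q4 (d1.const_mul _)]
      congr 1
      funext z
      ring
    obtain ⟨-, e2⟩ := integral_lincomb_four 1 (-1) (-1) 0 hGp hLp hLs hLs
    rw [← hLe] at e2
    have e3 : ∀ p : ℝ × ℝ, (ψ (p.1 + p.2) - ψ p.1 - ψ p.2) * (K p.1 p.2 * f p.1 * f p.2) =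
        1 * (ψ (p.1 + p.2) * (K p.1 p.2 * f p.1 * f p.2)) +
        (-1) * (ψ p.1 * (K p.1 p.2 * f p.1 * f p.2)) +
        (-1) * (ψ p.2 * (K p.1 p.2 * f p.1 * f p.2)) +
        0 * (ψ p.2 * (K p.1 p.2 * f p.1 * f p.2)) := fun p => by ring
    simp only [e3]
    rw [e1, e2]
    ring

/-! ### The space L¹_α and continuity in time of moments of solutions -/

theorem one_le_weight {α : ℝ} (hα : 1 ≤ α) {x : ℝ} (hx : 0 < x) : 1 + x ≤ (1 + x) ^ α := by
  nth_rewrite 1 [← Real.rpow_one (1 + x)]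
  exact Real.rpow_le_rpow_of_exponent_le (by linarith) hα

theorem measurable_weight (α : ℝ) : Measurable fun x : ℝ => (1 + x) ^ α := by fun_prop

theorem normL1_nonneg (α : ℝ) (g : ℝ → ℝ) : 0 ≤ normL1 α g := by
  refine setIntegral_nonneg measurableSet_Ioi fun x hx => ?_
  have : (0 : ℝ) < x := hx
  positivity

namespace MemL1

variable {α : ℝ} {g k : ℝ → ℝ}

theorem integrable_mul (hg : MemL1 α g) {w : ℝ → ℝ} {C : ℝ} (hw : Measurable w)
    (hwb : ∀ x, 0 < x → |w x| ≤ C * (1 + x) ^ α) :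
    Integrable (fun x => w x * g x) ν₊ ∧ ∫ x, |w x * g x| ∂ν₊ ≤ C * normL1 α g := by
  have hle : ∀ᵐ x ∂ν₊, |w x * g x| ≤ C * ((1 + x) ^ α * |g x|) := by
    filter_upwards [ae_restrict_mem measurableSet_Ioi] with x hx
    rw [abs_mul, ← mul_assoc]
    exact mul_le_mul_of_nonneg_right (hwb x hx) (abs_nonneg _)
  have hi : Integrable (fun x => w x * g x) ν₊ :=
    (hg.2.const_mul C).mono' (hw.aestronglyMeasurable.mul hg.1.aestronglyMeasurable) hle
  refine ⟨hi, ?_⟩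
  rw [normL1, ← integral_const_mul]
  exact integral_mono_ae hi.abs (hg.2.const_mul C) hle

theorem sub (hg : MemL1 α g) (hk : MemL1 α k) : MemL1 α (fun x => g x - k x) := by
  refine ⟨hg.1.sub hk.1, ?_⟩
  refine Integrable.mono' (hg.2.add hk.2) ((measurable_weight α).aestronglyMeasurable.mul
    (hg.1.sub hk.1).aestronglyMeasurable.norm) ?_
  filter_upwards [ae_restrict_mem measurableSet_Ioi] with x hx
  have hx' : (0 : ℝ) < x := hx
  have h0 : (0 : ℝ) ≤ (1 + x) ^ α := by positivity
  rw [Real.norm_eq_abs, abs_mul, abs_of_nonneg h0, Pi.add_apply, ← mul_add]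
  simp only [abs_abs]
  exact mul_le_mul_of_nonneg_left (abs_sub _ _) h0

theorem normL1_le_add (hg : MemL1 α g) (hk : MemL1 α k) :
    normL1 α g ≤ normL1 α (fun x => g x - k x) + normL1 α k := by
  simp only [normL1]
  rw [← integral_add (hg.sub hk).2 hk.2]
  refine setIntegral_mono_on hg.2 ((hg.sub hk).2.add hk.2) measurableSet_Ioi fun x hx => ?_
  have hx' : (0 : ℝ) < x := hx
  have h0 : (0 : ℝ) ≤ (1 + x) ^ α := by positivity
  rw [← mul_add]
  refine mul_le_mul_of_nonneg_left ?_ h0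
  have := abs_add_le (g x - k x) (k x)
  simpa using this

theorem abs_normL1_sub_le (hg : MemL1 α g) (hk : MemL1 α k) :
    |normL1 α g - normL1 α k| ≤ normL1 α (fun x => g x - k x) := by
  have h1 := hg.normL1_le_add hk
  have h2 := hk.normL1_le_add hg
  have h3 : normL1 α (fun x => k x - g x) = normL1 α (fun x => g x - k x) := by
    simp only [normL1, abs_sub_comm]
  rw [abs_le]
  constructor <;> linarith

theorem normL1_sub_le (hg : MemL1 α g) (hk : MemL1 α k) :
    normL1 α (fun x => g x - k x) ≤ normL1 α g + normL1 α k := by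
  simp only [normL1]
  rw [← integral_add hg.2 hk.2]
  refine setIntegral_mono_on (hg.sub hk).2 (hg.2.add hk.2) measurableSet_Ioi fun x hx => ?_
  have hx' : (0 : ℝ) < x := hx
  have h0 : (0 : ℝ) ≤ (1 + x) ^ α := by positivity
  rw [← mul_add]
  exact mul_le_mul_of_nonneg_left (abs_sub _ _) h0

end MemL1

theorem continuousOn_of_tendsto_dist {Y : ℝ → ℝ} {d : ℝ → ℝ → ℝ}
    (h : ∀ t, 0 ≤ t → Tendsto (fun s => d s t) (𝓝[Ici 0] t) (𝓝 0))
    (hd : ∀ s t, 0 ≤ s → 0 ≤ t → |Y s - Y t| ≤ d s t) : ContinuousOn Y (Ici 0) := by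
  intro t ht
  rw [ContinuousWithinAt, tendsto_iff_dist_tendsto_zero]
  refine squeeze_zero' (Eventually.of_forall fun _ => dist_nonneg) ?_ (h t ht)
  filter_upwards [self_mem_nhdsWithin] with s hs
  exact hd s t hs ht

namespace IsMildSolution

variable {K F : ℝ → ℝ → ℝ} {α : ℝ} {f₀ : ℝ → ℝ} {f : ℝ → ℝ → ℝ}

theorem continuousOn_integral (h : IsMildSolution K F α f₀ f) {w : ℝ → ℝ} {C : ℝ}
    (hw : Measurable w) (hwb : ∀ x, 0 < x → |w x| ≤ C * (1 + x) ^ α) :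
    ContinuousOn (fun t => ∫ x, w x * f t x ∂ν₊) (Ici 0) := by
  refine continuousOn_of_tendsto_dist
    (d := fun s t => C * normL1 α (fun x => f s x - f t x)) (fun t ht => ?_) fun s t hs ht => ?_
  · simpa using (h.continuous t ht).const_mul C
  · obtain ⟨h1, h2⟩ := ((h.memL1 s hs).sub (h.memL1 t ht)).integrable_mul hw hwb
    have h3 : (∫ x, w x * f s x ∂ν₊) - ∫ x, w x * f t x ∂ν₊ =
        ∫ x, w x * (f s x - f t x) ∂ν₊ := by
      rw [← integral_sub ((h.memL1 s hs).integrable_mul hw hwb).1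
        ((h.memL1 t ht).integrable_mul hw hwb).1]
      simp only [mul_sub]
    simp only [h3]
    exact abs_integral_le_integral_abs.trans h2

theorem continuousOn_normL1 (h : IsMildSolution K F α f₀ f) :
    ContinuousOn (fun t => normL1 α (f t)) (Ici 0) :=
  continuousOn_of_tendsto_dist h.continuous fun s t hs ht =>
    (h.memL1 s hs).abs_normL1_sub_le (h.memL1 t ht)

theorem measurable_slice (h : IsMildSolution K F α f₀ f) (t : ℝ) : Measurable (f t) :=
  h.measurable.comp measurable_prodMk_left

theorem exists_bound (h : IsMildSolution K F α f₀ f) (t : ℝ) :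
    ∃ N, 0 ≤ N ∧ ∀ s ∈ Icc 0 t, normL1 α (f s) ≤ N := by
  obtain ⟨N, hN⟩ := isCompact_Icc.exists_bound_of_continuousOn
    (h.continuousOn_normL1.mono (Icc_subset_Ici_self : Icc 0 t ⊆ Ici 0))
  exact ⟨max N 0, le_max_right _ _, fun s hs =>
    (le_abs_self _).trans ((hN s hs).trans (le_max_left _ _))⟩

theorem ae_eq_zero_time (h : IsMildSolution K F α f₀ f) : ∀ᵐ x ∂ν₊, f 0 x = f₀ x := by
  filter_upwards [h.mild 0 le_rfl] with x hx
  simpa using hx.2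

theorem normL1_zero (h : IsMildSolution K F α f₀ f) : normL1 α (f 0) = normL1 α f₀ := by
  refine integral_congr_ae ?_
  filter_upwards [h.ae_eq_zero_time] with x hx
  rw [hx]

end IsMildSolution

theorem measurable_coag_add_frag {K F : ℝ → ℝ → ℝ} {f : ℝ → ℝ → ℝ}
    (hK : Measurable (Function.uncurry K)) (hF : Measurable (Function.uncurry F))
    (hf : Measurable (Function.uncurry f)) :
    Measurable (Function.uncurry fun s x => coag K (f s) (f s) x + frag F (f s) x) := by
  have hfst : Measurable fun q : (ℝ × ℝ) × ℝ => q.1.1 := measurable_fst.comp measurable_fst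
  have hsnd : Measurable fun q : (ℝ × ℝ) × ℝ => q.1.2 := measurable_snd.comp measurable_fst
  have h1 : Measurable fun p : ℝ × ℝ => coagGain K (f p.1) (f p.1) p.2 := by
    refine measurable_intervalIntegral_param
      (F := fun (p : ℝ × ℝ) y => K (p.2 - y) y * f p.1 (p.2 - y) * f p.1 y) ?_
      measurable_const measurable_snd
    exact ((hK.comp ((hsnd.sub measurable_snd).prodMk measurable_snd)).mul
      (hf.comp (hfst.prodMk (hsnd.sub measurable_snd)))).mul
      (hf.comp (hfst.prodMk measurable_snd))
  have h2 : Measurable fun p : ℝ × ℝ => ∫ y in Ioi (0 : ℝ), K p.2 y * f p.1 y := by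
    have : Measurable fun q : (ℝ × ℝ) × ℝ => K q.1.2 q.2 * f q.1.1 q.2 :=
      (hK.comp (hsnd.prodMk measurable_snd)).mul (hf.comp (hfst.prodMk measurable_snd))
    exact (this.stronglyMeasurable.integral_prod_right' (ν := ν₊)).measurable
  have h3 : Measurable fun p : ℝ × ℝ => ∫ y in (0 : ℝ)..p.2, F y (p.2 - y) :=
    measurable_intervalIntegral_param (F := fun (p : ℝ × ℝ) y => F y (p.2 - y))
      (hF.comp (measurable_snd.prodMk (hsnd.sub measurable_snd))) measurable_const measurable_snd
  have h4 : Measurable fun p : ℝ × ℝ => fragGain F (f p.1) p.2 := by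
    have : Measurable fun q : (ℝ × ℝ) × ℝ => F q.1.2 q.2 * f q.1.1 (q.1.2 + q.2) :=
      (hF.comp (hsnd.prodMk measurable_snd)).mul
        (hf.comp (hfst.prodMk (hsnd.add measurable_snd)))
    exact (this.stronglyMeasurable.integral_prod_right' (ν := ν₊)).measurable
  have h5 : Measurable fun p : ℝ × ℝ => f p.1 p.2 := hf
  have h6 := (((h1.const_mul (1 / 2)).sub (h5.mul h2)).sub ((h3.mul h5).const_mul (1 / 2))).add h4
  convert h6 using 1
  funext p
  exact coag_add_frag_eq K F (f p.1) p.2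

/-! ### Solutions tested against bounded functions of bounded support -/

/-- Bounded measurable test functions supported in `(0, R]`. -/
structure IsTest (ψ : ℝ → ℝ) (B R : ℝ) : Prop where
  measurable : Measurable ψ
  B_nonneg : 0 ≤ B
  R_nonneg : 0 ≤ R
  bound : ∀ x, 0 < x → |ψ x| ≤ B
  support : ∀ x, R < x → ψ x = 0

theorem IsTest.bound_weight {ψ : ℝ → ℝ} {B R α : ℝ} (hψ : IsTest ψ B R) (hα : 1 ≤ α) :
    ∀ x, 0 < x → |ψ x| ≤ B * (1 + x) ^ α := by
  intro x hx
  refine (hψ.bound x hx).trans (le_mul_of_one_le_right hψ.B_nonneg ?_)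
  linarith [one_le_weight hα hx]

namespace IsMildSolution

variable {K F : ℝ → ℝ → ℝ} {α : ℝ} {f₀ ψ : ℝ → ℝ} {f : ℝ → ℝ → ℝ} {B R : ℝ}

theorem integral_abs_le_normL1 (h : IsMildSolution K F α f₀ f) (hα : 1 ≤ α) {s : ℝ} (hs : 0 ≤ s) :
    ∫ x, |f s x| ∂ν₊ ≤ normL1 α (f s) := by
  have := ((h.memL1 s hs).integrable_mul (w := fun _ => 1) (C := 1) measurable_const
    (fun x hx => by rw [abs_one, one_mul]; linarith [one_le_weight hα hx])).2
  simpa using this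

theorem integrable_test_mul (h : IsMildSolution K F α f₀ f) (hk : IsKernelPair K F) (hα : 1 ≤ α)
    (hψ : IsTest ψ B R) (t : ℝ) :
    Integrable (fun p : ℝ × ℝ => ψ p.2 * (coag K (f p.1) (f p.1) p.2 + frag F (f p.1) p.2))
      ((volume.restrict (Ioc 0 t)).prod ν₊) := by
  obtain ⟨N, hN0, hN⟩ := h.exists_bound t
  have hm : Measurable fun p : ℝ × ℝ =>
      ψ p.2 * (coag K (f p.1) (f p.1) p.2 + frag F (f p.1) p.2) :=
    (hψ.measurable.comp measurable_snd).mul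
      (measurable_coag_add_frag hk.measurable_K hk.measurable_F h.measurable)
  have hw := fun s (hs : 0 ≤ s) => hk.weak_form (h.measurable_slice s) (h.memL1 s hs).1
    hψ.measurable hψ.B_nonneg hψ.R_nonneg hψ.bound hψ.support
  rw [integrable_prod_iff hm.aestronglyMeasurable]
  constructor
  · filter_upwards [ae_restrict_mem measurableSet_Ioc] with s hs using (hw s hs.1.le).1
  · refine (integrable_const (B * (5 * N * N + (3 * R + 2) * N))).mono'
      hm.norm.stronglyMeasurable.integral_prod_right'.aestronglyMeasurable ?_
    filter_upwards [ae_restrict_mem measurableSet_Ioc] with s hs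
    rw [Real.norm_eq_abs, abs_of_nonneg (integral_nonneg fun _ => norm_nonneg _)]
    refine (hw s hs.1.le).2.1.trans ?_
    have h1 := (h.integral_abs_le_normL1 hα hs.1.le).trans (hN s ⟨hs.1.le, hs.2⟩)
    have h2 : 0 ≤ ∫ x, |f s x| ∂ν₊ := integral_nonneg fun _ => abs_nonneg _
    have hB := hψ.B_nonneg
    have hR := hψ.R_nonneg
    gcongr

theorem intervalIntegrable_test (h : IsMildSolution K F α f₀ f) (hk : IsKernelPair K F)
    (hα : 1 ≤ α) (hψ : IsTest ψ B R) {r t : ℝ} (hr : 0 ≤ r) (ht : r ≤ t) :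
    IntervalIntegrable
      (fun s => ∫ x, ψ x * (coag K (f s) (f s) x + frag F (f s) x) ∂ν₊) volume r t := by
  have h1 := (h.integrable_test_mul hk hα hψ t).integral_prod_left
  have h2 : IntervalIntegrable
      (fun s => ∫ x, ψ x * (coag K (f s) (f s) x + frag F (f s) x) ∂ν₊) volume 0 t :=
    (intervalIntegrable_iff_integrableOn_Ioc_of_le (hr.trans ht)).2 h1
  refine h2.mono_set ?_
  rw [uIcc_of_le ht, uIcc_of_le (hr.trans ht)]
  exact Icc_subset_Icc_left hr

theorem integral_test_eq (h : IsMildSolution K F α f₀ f) (hk : IsKernelPair K F) (hα : 1 ≤ α)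
    (hψ : IsTest ψ B R) {r t : ℝ} (hr : 0 ≤ r) (ht : r ≤ t) :
    ∫ x, ψ x * f t x ∂ν₊ = (∫ x, ψ x * f r x ∂ν₊) +
      ∫ s in r..t, ∫ x, ψ x * (coag K (f s) (f s) x + frag F (f s) x) ∂ν₊ := by
  have key : ∀ t, 0 ≤ t → ∫ x, ψ x * f t x ∂ν₊ = (∫ x, ψ x * f 0 x ∂ν₊) +
      ∫ s in (0 : ℝ)..t, ∫ x, ψ x * (coag K (f s) (f s) x + frag F (f s) x) ∂ν₊ := by
    intro t ht
    refine integral_mul_eq_add_of_mild ht ?_ (h.integrable_test_mul hk hα hψ t)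
      ((h.memL1 0 le_rfl).integrable_mul hψ.measurable (hψ.bound_weight hα)).1
    filter_upwards [h.mild t ht, h.ae_eq_zero_time] with x hx hx0
    rw [hx.2, hx0]
  rw [key t (hr.trans ht), key r hr, add_assoc, intervalIntegral.integral_add_adjacent_intervals
    (h.intervalIntegrable_test hk hα hψ le_rfl hr) (h.intervalIntegrable_test hk hα hψ hr ht)]

end IsMildSolution

/-! ### Tails and the flux weight -/

theorem abs_indicator_Ioi_le {w : ℝ → ℝ} {α C : ℝ}
    (hwb : ∀ x, 0 < x → |w x| ≤ C * (1 + x) ^ α) (R x : ℝ) (hx : 0 < x) :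
    |indicator (Ioi R) w x| ≤ C * (1 + x) ^ α := by
  by_cases h : x ∈ Ioi R
  · rw [indicator_of_mem h]; exact hwb x hx
  · rw [indicator_of_notMem h, abs_zero]; exact (abs_nonneg _).trans (hwb x hx)

theorem MemL1.tendsto_integral_weight {α : ℝ} {g w : ℝ → ℝ} {v : ℝ → ℝ → ℝ} {C : ℝ}
    (hg : MemL1 α g) (hv : ∀ R, Measurable (v R))
    (hvb : ∀ R x, 0 < x → |v R x| ≤ C * (1 + x) ^ α)
    (hvw : ∀ x, 0 < x → ∀ᶠ R in atTop, v R x = w x) :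
    Tendsto (fun R => ∫ x, v R x * g x ∂ν₊) atTop (𝓝 (∫ x, w x * g x ∂ν₊)) := by
  refine tendsto_integral_filter_of_dominated_convergence (fun x => C * ((1 + x) ^ α * |g x|))
    (Eventually.of_forall fun R => ((hv R).aestronglyMeasurable.mul
      hg.1.aestronglyMeasurable)) (Eventually.of_forall fun R => ?_) (hg.2.const_mul C) ?_
  · filter_upwards [ae_restrict_mem measurableSet_Ioi] with x hx
    rw [Real.norm_eq_abs, abs_mul, ← mul_assoc]
    exact mul_le_mul_of_nonneg_right (hvb R x hx) (abs_nonneg _)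
  · filter_upwards [ae_restrict_mem measurableSet_Ioi] with x hx
    refine tendsto_const_nhds.congr' ?_
    filter_upwards [hvw x hx] with R hR
    rw [hR]

theorem eventually_indicator_Ioi_eq_zero (w : ℝ → ℝ) (x : ℝ) :
    ∀ᶠ R in atTop, indicator (Ioi R) w x = (fun _ : ℝ => (0 : ℝ)) x := by
  filter_upwards [eventually_ge_atTop x] with R hR
  exact indicator_of_notMem (by simpa using hR) _

/-- A weight measuring the flux of mass to infinity. -/
noncomputable def fluxWeight (R : ℝ) : ℝ → ℝ := indicator (Ioi R) (fun x => 1 + x + R ^ 2)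

theorem measurable_fluxWeight (R : ℝ) : Measurable (fluxWeight R) :=
  ((measurable_const.add measurable_id).add measurable_const).indicator measurableSet_Ioi

theorem fluxWeight_nonneg {R x : ℝ} (hx : 0 < x) : 0 ≤ fluxWeight R x :=
  indicator_apply_nonneg fun _ => by positivity

/-- The constant depends on R, so this only serves integrability and continuity in time; smallness
as R grows comes from `NoFlux`. -/
theorem fluxWeight_bound {α : ℝ} (hα : 1 ≤ α) (R x : ℝ) (hx : 0 < x) :
    |fluxWeight R x| ≤ (1 + R ^ 2) * (1 + x) ^ α := by
  refine abs_indicator_Ioi_le (w := fun x => 1 + x + R ^ 2) (fun x hx => ?_) R x hx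
  rw [abs_of_nonneg (by positivity)]
  nlinarith [one_le_weight hα hx, sq_nonneg R]

/-- No mass is lost to infinity. -/
def NoFlux (f : ℝ → ℝ → ℝ) : Prop :=
  ∀ t, 0 ≤ t →
    Tendsto (fun R => ∫ s in (0 : ℝ)..t, ∫ x, fluxWeight R x * f s x ∂ν₊) atTop (𝓝 0)

namespace IsMildSolution

variable {K F : ℝ → ℝ → ℝ} {α : ℝ} {f₀ ψ : ℝ → ℝ} {f : ℝ → ℝ → ℝ}

theorem intervalIntegrable_integral (h : IsMildSolution K F α f₀ f) {w : ℝ → ℝ} {C : ℝ}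
    (hw : Measurable w) (hwb : ∀ x, 0 < x → |w x| ≤ C * (1 + x) ^ α) {r t : ℝ} (hr : 0 ≤ r)
    (ht : r ≤ t) : IntervalIntegrable (fun s => ∫ x, w x * f s x ∂ν₊) volume r t :=
  ((h.continuousOn_integral hw hwb).mono
    (Icc_subset_Ici_self.trans (Ici_subset_Ici.2 hr))).intervalIntegrable_of_Icc ht

theorem tendsto_integral_weight (h : IsMildSolution K F α f₀ f) {w : ℝ → ℝ} {v : ℝ → ℝ → ℝ}
    {C : ℝ} (hC : 0 ≤ C) (hv : ∀ R, Measurable (v R))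
    (hvb : ∀ R x, 0 < x → |v R x| ≤ C * (1 + x) ^ α)
    (hvw : ∀ x, 0 < x → ∀ᶠ R in atTop, v R x = w x) {r t : ℝ} (hr : 0 ≤ r) (ht : r ≤ t) :
    Tendsto (fun R => ∫ s in r..t, ∫ x, v R x * f s x ∂ν₊) atTop
      (𝓝 (∫ s in r..t, ∫ x, w x * f s x ∂ν₊)) := by
  obtain ⟨N, hN0, hN⟩ := h.exists_bound t
  refine intervalIntegral.tendsto_integral_filter_of_dominated_convergence (fun _ => C * N)
    (Eventually.of_forall fun R => ?_) (Eventually.of_forall fun R => ?_)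
    intervalIntegrable_const ?_
  · rw [uIoc_of_le ht]
    exact (h.intervalIntegrable_integral (hv R) (hvb R) hr ht).1.aestronglyMeasurable
  · refine Eventually.of_forall fun s hs => ?_
    rw [uIoc_of_le ht] at hs
    have hs0 : 0 ≤ s := hr.trans hs.1.le
    refine (abs_integral_le_integral_abs.trans ((h.memL1 s hs0).integrable_mul
      (hv R) (hvb R)).2).trans ?_
    exact mul_le_mul_of_nonneg_left (hN s ⟨hs0, hs.2⟩) hC
  · refine Eventually.of_forall fun s hs => ?_
    rw [uIoc_of_le ht] at hs
    exact (h.memL1 s (hr.trans hs.1.le)).tendsto_integral_weight hv hvb hvw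

theorem tendsto_integral_tail (h : IsMildSolution K F α f₀ f) {w : ℝ → ℝ} {C : ℝ} (hC : 0 ≤ C)
    (hw : Measurable w) (hwb : ∀ x, 0 < x → |w x| ≤ C * (1 + x) ^ α) {t : ℝ} (ht : 0 ≤ t) :
    Tendsto (fun R => ∫ s in (0 : ℝ)..t, ∫ x, indicator (Ioi R) w x * f s x ∂ν₊) atTop
      (𝓝 0) := by
  have h1 := h.tendsto_integral_weight hC (fun R => hw.indicator (measurableSet_Ioi (a := R)))
    (abs_indicator_Ioi_le hwb) (fun x _ => eventually_indicator_Ioi_eq_zero w x) le_rfl ht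
  simpa only [zero_mul, integral_zero, intervalIntegral.integral_zero] using h1

end IsMildSolution

/-! ### The truncated mass and the absence of flux at infinity -/

/-- The mass weight truncated at `R`. -/
noncomputable def massWeight (R : ℝ) : ℝ → ℝ := indicator (Iic R) id

theorem isTest_massWeight {R : ℝ} (hR : 0 ≤ R) : IsTest (massWeight R) R R where
  measurable := measurable_id.indicator measurableSet_Iic
  B_nonneg := hR
  R_nonneg := hR
  bound x hx := by
    by_cases h : x ≤ R
    · rw [massWeight, indicator_of_mem (by exact h), id, abs_of_pos hx]; exact h
    · rw [massWeight, indicator_of_notMem (by exact h), abs_zero]; exact hR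
  support x hx := indicator_of_notMem (by simpa using hx) _

theorem massWeight_of_le {R x : ℝ} (h : x ≤ R) : massWeight R x = x :=
  indicator_of_mem (by exact h) _

theorem massWeight_of_lt {R x : ℝ} (h : R < x) : massWeight R x = 0 :=
  indicator_of_notMem (by simpa using h) _

theorem massWeight_defect_nonpos (R : ℝ) {x y : ℝ} (hx : 0 < x) (hy : 0 < y) :
    massWeight R (x + y) - massWeight R x - massWeight R y ≤ 0 := by
  rcases le_or_gt (x + y) R with h | h
  · rw [massWeight_of_le h, massWeight_of_le (by linarith), massWeight_of_le (by linarith)]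
    linarith
  · have h1 : ∀ z, 0 < z → 0 ≤ massWeight R z := fun z hz =>
      indicator_apply_nonneg fun _ => hz.le
    rw [massWeight_of_lt h]
    linarith [h1 x hx, h1 y hy]

/-- The defect is nonzero only if x + y > R. Then the larger of x and y exceeds R/2, and x + y is at
most twice it. -/
theorem massWeight_defect_ge (R : ℝ) {x y : ℝ} (hx : 0 < x) (hy : 0 < y) :
    -(2 * indicator (Ioi (R / 2)) (fun z => 1 + z) x +
      2 * indicator (Ioi (R / 2)) (fun z => 1 + z) y) ≤
      massWeight R (x + y) - massWeight R x - massWeight R y := by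
  have h0 : ∀ z : ℝ, 0 < z → 0 ≤ indicator (Ioi (R / 2)) (fun z => 1 + z) z := fun z hz =>
    indicator_apply_nonneg fun _ => by linarith
  have hm : ∀ z, 0 < z → massWeight R z ≤ z := by
    intro z hz
    rcases le_or_gt z R with h | h
    · rw [massWeight_of_le h]
    · rw [massWeight_of_lt h]; exact hz.le
  have h0x := h0 x hx
  have h0y := h0 y hy
  rcases le_or_gt (x + y) R with h | h
  · rw [massWeight_of_le h, massWeight_of_le (by linarith), massWeight_of_le (by linarith)]
    linarith
  · rw [massWeight_of_lt h]
    have h1 := hm x hx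
    have h2 := hm y hy
    rcases le_total x y with hxy | hxy
    · rw [indicator_of_mem (show y ∈ Ioi (R / 2) by simp only [mem_Ioi]; linarith)] at h0y ⊢
      linarith
    · rw [indicator_of_mem (show x ∈ Ioi (R / 2) by simp only [mem_Ioi]; linarith)] at h0x ⊢
      linarith

/-- The substitution y ↦ z − y shows that the mean fragment has size z/2, which is conservation of
mass in a single breakage. -/
theorem intervalIntegral_symm_id_mul {G : ℝ → ℝ → ℝ} {z : ℝ} (hz : 0 < z)
    (hi : IntervalIntegrable (fun y => G y (z - y)) volume 0 z)
    (hi' : IntervalIntegrable (fun y => y * G y (z - y)) volume 0 z)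
    (hs : ∀ x y, 0 < x → 0 < y → G x y = G y x) :
    ∫ y in (0 : ℝ)..z, y * G y (z - y) = (1 / 2) * (z * ∫ y in (0 : ℝ)..z, G y (z - y)) := by
  have h1 : ∫ y in (0 : ℝ)..z, (z - y) * G (z - y) (z - (z - y)) =
      ∫ y in (0 : ℝ)..z, y * G y (z - y) := by
    have := intervalIntegral.integral_comp_sub_left (a := 0) (b := z)
      (fun y => y * G y (z - y)) z
    simpa using this
  have h2 : ∫ y in (0 : ℝ)..z, (z - y) * G (z - y) (z - (z - y)) =
      ∫ y in (0 : ℝ)..z, (z * G y (z - y) - y * G y (z - y)) := by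
    rw [intervalIntegral.integral_of_le hz.le, intervalIntegral.integral_of_le hz.le,
      integral_Ioc_eq_integral_Ioo, integral_Ioc_eq_integral_Ioo]
    refine setIntegral_congr_fun measurableSet_Ioo fun y hy => ?_
    simp only [sub_sub_cancel]
    rw [hs (z - y) y (sub_pos.2 hy.2) hy.1]
    ring
  rw [intervalIntegral.integral_sub (hi.const_mul z) hi',
    intervalIntegral.integral_const_mul] at h2
  linarith

theorem IsTest.intervalIntegrable {ψ : ℝ → ℝ} {B R z : ℝ} (hψ : IsTest ψ B R) (hz : 0 < z) :
    IntervalIntegrable ψ volume 0 z :=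
  (integral_abs_le_of_bounded_support hψ.measurable hψ.R_nonneg hψ.bound hψ.support hz).1

/-- `∫₀^z ψ = ∫₀^R ψ` for a test function supported in `(0, R]`, `z ≥ R`. -/
theorem IsTest.integral_eq {ψ : ℝ → ℝ} {B R z : ℝ} (hψ : IsTest ψ B R) (hR : 0 < R)
    (hz : R ≤ z) : ∫ y in (0 : ℝ)..z, ψ y = ∫ y in (0 : ℝ)..R, ψ y := by
  have h1 := hψ.intervalIntegrable hR
  have h2 := hψ.intervalIntegrable (hR.trans_le hz)
  rw [← intervalIntegral.integral_add_adjacent_intervals h1 (h1.symm.trans h2),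
    intervalIntegral.integral_zero_ae (a := R), add_zero]
  refine Eventually.of_forall fun y hy => ?_
  rw [uIoc_of_le hz] at hy
  exact hψ.support y hy.1

/-- Bounds on `∫₀^z ψ(y) F(y, z - y) dy` for nonnegative test functions. -/
theorem IsKernelPair.fragSlice_bounds {K F : ℝ → ℝ → ℝ} (h : IsKernelPair K F) {ψ : ℝ → ℝ}
    {z : ℝ} (hz : 0 < z) (hψ : Measurable ψ) (hψi : IntervalIntegrable ψ volume 0 z)
    (h0 : ∀ x, 0 < x → 0 ≤ ψ x) :
    IntervalIntegrable (fun y => ψ y * F y (z - y)) volume 0 z ∧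
      2 * (∫ y in (0 : ℝ)..z, ψ y) ≤ ∫ y in (0 : ℝ)..z, ψ y * F y (z - y) ∧
      ∫ y in (0 : ℝ)..z, ψ y * F y (z - y) ≤ (2 + 1 / z) * ∫ y in (0 : ℝ)..z, ψ y := by
  obtain ⟨h1, -⟩ := integral_abs_fragSlice_le h.measurable_F h.abs_F_le hψ hz hψi
  refine ⟨h1, ?_, ?_⟩
  · rw [← intervalIntegral.integral_const_mul]
    refine intervalIntegral.integral_mono_on_of_le_Ioo hz.le (hψi.const_mul _) h1 fun y hy => ?_
    rw [mul_comm]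
    exact mul_le_mul_of_nonneg_left (h.bound_F y (z - y) hy.1 (sub_pos.2 hy.2)).1 (h0 y hy.1)
  · rw [← intervalIntegral.integral_const_mul]
    refine intervalIntegral.integral_mono_on_of_le_Ioo hz.le h1 (hψi.const_mul _) fun y hy => ?_
    rw [mul_comm]
    have := (h.bound_F y (z - y) hy.1 (sub_pos.2 hy.2)).2
    rw [add_sub_cancel] at this
    exact mul_le_mul_of_nonneg_right this (h0 y hy.1)

theorem massWeight_nonneg (R : ℝ) {x : ℝ} (hx : 0 < x) : 0 ≤ massWeight R x :=
  indicator_apply_nonneg fun _ => hx.le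

theorem integral_massWeight {R : ℝ} (hR : 0 < R) :
    ∫ y in (0 : ℝ)..R, massWeight R y = R ^ 2 / 2 := by
  have : ∫ y in (0 : ℝ)..R, massWeight R y = ∫ y in (0 : ℝ)..R, y := by
    refine intervalIntegral.integral_congr fun y hy => ?_
    rw [uIcc_of_le hR.le] at hy
    exact massWeight_of_le hy.2
  rw [this, integral_id]
  ring

/-- For z ≤ R gain and loss of mass balance exactly. For z > R only fragments below R are counted:
the constant 2 gives 2·R²/2 = R², and the remainder 1/z adds at most R/2 < z. -/
theorem IsKernelPair.massWeight_frag {K F : ℝ → ℝ → ℝ} (h : IsKernelPair K F) {R z : ℝ}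
    (hR : 0 < R) (hz : 0 < z) :
    indicator (Ioi R) (fun _ => R ^ 2) z ≤ (∫ y in (0 : ℝ)..z, massWeight R y * F y (z - y)) -
        (1 / 2) * (massWeight R z * ∫ y in (0 : ℝ)..z, F y (z - y)) ∧
      (∫ y in (0 : ℝ)..z, massWeight R y * F y (z - y)) -
        (1 / 2) * (massWeight R z * ∫ y in (0 : ℝ)..z, F y (z - y)) ≤ fluxWeight R z := by
  have ht := isTest_massWeight hR.le
  obtain ⟨b1, b2, b3⟩ := h.fragSlice_bounds hz ht.measurable (ht.intervalIntegrable hz)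
    fun x hx => massWeight_nonneg R hx
  rcases le_or_gt z R with hzR | hzR
  · have hcongr : ∫ y in (0 : ℝ)..z, massWeight R y * F y (z - y) =
        ∫ y in (0 : ℝ)..z, y * F y (z - y) := by
      refine intervalIntegral.integral_congr fun y hy => ?_
      rw [uIcc_of_le hz.le] at hy
      simp only [massWeight_of_le (hy.2.trans hzR)]
    have hi' : IntervalIntegrable (fun y => y * F y (z - y)) volume 0 z :=
      (h.fragSlice_bounds hz measurable_id (continuous_id.intervalIntegrable _ _)
        fun x hx => hx.le).1
    rw [hcongr, massWeight_of_le hzR, intervalIntegral_symm_id_mul hz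
      (integral_abs_fragKernel_le h.measurable_F h.abs_F_le hz).1 hi' h.symm_F, sub_self,
      fluxWeight, indicator_of_notMem (by simpa using hzR),
      indicator_of_notMem (by simpa using hzR)]
    simp
  · rw [ht.integral_eq hR hzR.le, integral_massWeight hR] at b2 b3
    rw [massWeight_of_lt hzR, zero_mul, mul_zero, sub_zero, fluxWeight,
      indicator_of_mem (by exact hzR), indicator_of_mem (by exact hzR)]
    refine ⟨by linarith, b3.trans ?_⟩
    have h1 : 1 / z ≤ 1 / R := one_div_le_one_div_of_le hR hzR.le
    have h2 : (2 + 1 / z) * (R ^ 2 / 2) ≤ (2 + 1 / R) * (R ^ 2 / 2) := by gcongr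
    have h3 : (2 + 1 / R) * (R ^ 2 / 2) = R ^ 2 + R / 2 := by field_simp
    linarith

theorem ae_prod_and_of_ae {p : ℝ → Prop} (h : ∀ᵐ x ∂ν₊, p x) :
    ∀ᵐ q ∂(ν₊.prod ν₊), (p q.1 ∧ 0 < q.1) ∧ p q.2 ∧ 0 < q.2 := by
  have h' : ∀ᵐ x ∂ν₊, p x ∧ 0 < x := h.and (ae_restrict_mem measurableSet_Ioi)
  exact (Measure.quasiMeasurePreserving_fst.ae h').and (Measure.quasiMeasurePreserving_snd.ae h')

theorem abs_one_add_le {α : ℝ} (hα : 1 ≤ α) (x : ℝ) (hx : 0 < x) :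
    |1 + x| ≤ 1 * (1 + x) ^ α := by
  rw [one_mul, abs_of_pos (by linarith)]
  exact one_le_weight hα hx

theorem abs_one_le {α : ℝ} (hα : 1 ≤ α) (x : ℝ) (hx : 0 < x) :
    |(1 : ℝ)| ≤ 1 * (1 + x) ^ α := by
  rw [one_mul, abs_one]
  linarith [one_le_weight hα hx]

theorem abs_id_le {α : ℝ} (hα : 1 ≤ α) (x : ℝ) (hx : 0 < x) : |id x| ≤ 1 * (1 + x) ^ α := by
  rw [one_mul, id, abs_of_pos hx]
  linarith [one_le_weight hα hx]

/-- The rate of change of the truncated mass. -/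
theorem IsKernelPair.massWeight_rhs_bounds {K F : ℝ → ℝ → ℝ} (h : IsKernelPair K F) {α : ℝ}
    (hα : 1 ≤ α) {f : ℝ → ℝ} (hf : Measurable f) (hfi : MemL1 α f) (hf0 : ∀ᵐ x ∂ν₊, 0 ≤ f x)
    {R : ℝ} (hR : 0 < R) :
    (∫ x, indicator (Ioi R) (fun _ => R ^ 2) x * f x ∂ν₊) -
        6 * (∫ x, f x ∂ν₊) * (∫ x, indicator (Ioi (R / 2)) (fun z => 1 + z) x * f x ∂ν₊) ≤
        ∫ x, massWeight R x * (coag K f f x + frag F f x) ∂ν₊ ∧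
      ∫ x, massWeight R x * (coag K f f x + frag F f x) ∂ν₊ ≤
        ∫ x, fluxWeight R x * f x ∂ν₊ := by
  have ht := isTest_massWeight hR.le
  obtain ⟨-, -, i1, i2, he⟩ := h.weak_form hf hfi.1 ht.measurable ht.B_nonneg ht.R_nonneg
    ht.bound ht.support
  have hp := ae_prod_and_of_ae hf0
  rw [he]
  constructor
  · have hIw : Integrable (fun x => indicator (Ioi (R / 2)) (fun z => 1 + z) x * f x) ν₊ :=
      (hfi.integrable_mul ((measurable_const.add measurable_id).indicator measurableSet_Ioi)
        (abs_indicator_Ioi_le (abs_one_add_le hα) (R / 2))).1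
    have hI2 : Integrable (fun x => indicator (Ioi R) (fun _ => R ^ 2) x * f x) ν₊ :=
      (hfi.integrable_mul (C := R ^ 2) (measurable_const.indicator measurableSet_Ioi)
        (abs_indicator_Ioi_le (fun x hx => by
          rw [abs_of_nonneg (by positivity)]
          have := one_le_weight hα hx
          nlinarith [sq_nonneg R]) R)).1
    have j1 : Integrable (fun p : ℝ × ℝ =>
        (indicator (Ioi (R / 2)) (fun z => 1 + z) p.1 * f p.1) * f p.2) (ν₊.prod ν₊) :=
      hIw.mul_prod hfi.1
    have j2 : Integrable (fun p : ℝ × ℝ =>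
        f p.1 * (indicator (Ioi (R / 2)) (fun z => 1 + z) p.2 * f p.2)) (ν₊.prod ν₊) :=
      Integrable.mul_prod hfi.1 hIw
    obtain ⟨k1, k2⟩ := integral_lincomb_four (-6) (-6) 0 0 j1 j2 j1 j1
    have hc := integral_mono_ae k1 i1 (by
      filter_upwards [hp] with p hp
      obtain ⟨⟨a1, a2⟩, a3, a4⟩ := hp
      have b1 := massWeight_defect_nonpos R a2 a4
      have b2 := massWeight_defect_ge R a2 a4
      have b3 := (h.bound_K _ _ a2 a4).2
      have b4 := mul_nonneg a1 a3
      have b5 := mul_le_mul_of_nonneg_right (mul_le_mul_of_nonpos_left b3 b1) b4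
      have b6 := mul_le_mul_of_nonneg_right b2 b4
      linarith)
    rw [k2, integral_prod_mul (fun x => indicator (Ioi (R / 2)) (fun z => 1 + z) x * f x) f,
      integral_prod_mul f (fun x => indicator (Ioi (R / 2)) (fun z => 1 + z) x * f x)] at hc
    have hd := integral_mono_ae hI2 i2 (by
      filter_upwards [hf0, ae_restrict_mem measurableSet_Ioi] with z hz hz0
      rw [mul_comm]
      exact mul_le_mul_of_nonneg_left (h.massWeight_frag hR hz0).1 hz)
    linarith
  · have hc : ∫ p : ℝ × ℝ, (massWeight R (p.1 + p.2) - massWeight R p.1 - massWeight R p.2) *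
        (K p.1 p.2 * f p.1 * f p.2) ∂(ν₊.prod ν₊) ≤ 0 := by
      refine integral_nonpos_of_ae ?_
      filter_upwards [hp] with p hp
      obtain ⟨⟨a1, a2⟩, a3, a4⟩ := hp
      have b3 := (h.bound_K _ _ a2 a4).1
      exact mul_nonpos_of_nonpos_of_nonneg (massWeight_defect_nonpos R a2 a4) (by positivity)
    have hd := integral_mono_ae i2
      (hfi.integrable_mul (measurable_fluxWeight R) (fluxWeight_bound hα R)).1 (by
      filter_upwards [hf0, ae_restrict_mem measurableSet_Ioi] with z hz hz0
      rw [mul_comm]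
      exact mul_le_mul_of_nonneg_right (h.massWeight_frag hR hz0).2 hz)
    linarith

namespace IsMildSolution

variable {K F : ℝ → ℝ → ℝ} {α : ℝ} {f₀ ψ : ℝ → ℝ} {f : ℝ → ℝ → ℝ}

theorem integral_nonneg_of_weight (h : IsMildSolution K F α f₀ f) {w : ℝ → ℝ}
    (hw : ∀ x, 0 < x → 0 ≤ w x) {s : ℝ} (hs : 0 ≤ s) : 0 ≤ ∫ x, w x * f s x ∂ν₊ := by
  refine integral_nonneg_of_ae ?_
  filter_upwards [h.nonneg s hs, ae_restrict_mem measurableSet_Ioi] with x hx hx0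
  exact mul_nonneg (hw x hx0) hx

theorem integral_mono_weight (h : IsMildSolution K F α f₀ f) {w v : ℝ → ℝ} {C D : ℝ}
    (hw : Measurable w) (hwb : ∀ x, 0 < x → |w x| ≤ C * (1 + x) ^ α)
    (hv : Measurable v) (hvb : ∀ x, 0 < x → |v x| ≤ D * (1 + x) ^ α)
    (hwv : ∀ x, 0 < x → w x ≤ v x) {s : ℝ} (hs : 0 ≤ s) :
    ∫ x, w x * f s x ∂ν₊ ≤ ∫ x, v x * f s x ∂ν₊ := by
  refine integral_mono_ae ((h.memL1 s hs).integrable_mul hw hwb).1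
    ((h.memL1 s hs).integrable_mul hv hvb).1 ?_
  filter_upwards [h.nonneg s hs, ae_restrict_mem measurableSet_Ioi] with x hx hx0
  exact mul_le_mul_of_nonneg_right (hwv x hx0) hx

theorem integral_integral_flux_nonneg (h : IsMildSolution K F α f₀ f) (R : ℝ) {r t : ℝ}
    (hr : 0 ≤ r) (ht : r ≤ t) : 0 ≤ ∫ s in r..t, ∫ x, fluxWeight R x * f s x ∂ν₊ :=
  intervalIntegral.integral_nonneg ht fun _ hs =>
    h.integral_nonneg_of_weight (fun _ hx => fluxWeight_nonneg hx) (hr.trans hs.1)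

/-- For x > R > 0 one has 1 + x + R² ≤ (1+x)² ≤ (1+x)^α, so the flux is dominated by a tail of the
norm. -/
theorem noFlux_of_two_le (h : IsMildSolution K F α f₀ f) (hα : 2 ≤ α) : NoFlux f := by
  intro t ht
  have hα1 : 1 ≤ α := by linarith
  have hwb : ∀ x : ℝ, 0 < x → |(1 + x) ^ α| ≤ 1 * (1 + x) ^ α := fun x hx => by
    rw [one_mul, abs_of_nonneg (by positivity)]
  refine squeeze_zero' (Eventually.of_forall fun R =>
    h.integral_integral_flux_nonneg R le_rfl ht) ?_
    (h.tendsto_integral_tail zero_le_one (measurable_weight α) hwb ht)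
  filter_upwards [eventually_ge_atTop 0] with R hR
  have hm := (measurable_weight α).indicator (measurableSet_Ioi (a := R))
  refine intervalIntegral.integral_mono_on ht
    (h.intervalIntegrable_integral (measurable_fluxWeight R) (fluxWeight_bound hα1 R) le_rfl ht)
    (h.intervalIntegrable_integral hm (abs_indicator_Ioi_le hwb R) le_rfl ht) fun s hs => ?_
  refine h.integral_mono_weight (measurable_fluxWeight R) (fluxWeight_bound hα1 R) hm
    (abs_indicator_Ioi_le hwb R) (fun x hx => ?_) hs.1
  by_cases hxR : x ∈ Ioi R
  · rw [fluxWeight, indicator_of_mem hxR, indicator_of_mem hxR]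
    have h1 : (1 + x) ^ (2 : ℝ) ≤ (1 + x) ^ α :=
      Real.rpow_le_rpow_of_exponent_le (by linarith) hα
    rw [Real.rpow_two] at h1
    have h2 : R < x := hxR
    nlinarith
  · rw [fluxWeight, indicator_of_notMem hxR, indicator_of_notMem hxR]

theorem tendsto_integral_massWeight (h : IsMildSolution K F α f₀ f) (hα : 1 ≤ α) {s : ℝ}
    (hs : 0 ≤ s) : Tendsto (fun R => ∫ x, massWeight R x * f s x ∂ν₊) atTop
      (𝓝 (∫ x, id x * f s x ∂ν₊)) := by
  refine (h.memL1 s hs).tendsto_integral_weight (C := 1)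
    (fun R => measurable_id.indicator measurableSet_Iic) (fun R x hx => ?_) fun x hx => ?_
  · refine le_trans ?_ (abs_id_le hα x hx)
    rw [abs_of_nonneg (massWeight_nonneg R hx), abs_of_pos (show 0 < id x from hx)]
    exact indicator_apply_le' (fun _ => le_rfl) fun _ => hx.le
  · filter_upwards [eventually_ge_atTop x] with R hR using massWeight_of_le hR

/-- Fragmentation feeds mass from above R into (0,R] at rate at least R²∫_{x>R} f, and coagulation
removes at most a multiple of the tail ∫_{x>R/2} (1+x) f. The net change of truncated mass tends to
0 because the total mass is the same at both times; hence so does the feeding. -/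
theorem noFlux_of_conservesMass (h : IsMildSolution K F α f₀ f) (hk : IsKernelPair K F)
    (hα : 1 ≤ α) (hM : ConservesMass f₀ f) : NoFlux f := by
  intro t ht
  obtain ⟨N, hN0, hN⟩ := h.exists_bound t
  have hmass : ∫ x, id x * f t x ∂ν₊ = ∫ x, id x * f 0 x ∂ν₊ := by
    have h1 := (hM t ht).trans (hM 0 le_rfl).symm
    simp only [moment, Real.rpow_one] at h1
    exact h1
  have hm1 : Measurable fun z : ℝ => 1 + z := by fun_prop
  have T1 := h.tendsto_integral_tail zero_le_one hm1 (abs_one_add_le hα) ht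
  -- The tail beyond R/2 bounds the mass that coagulation carries across R.
  have T2 := T1.comp (tendsto_id.atTop_div_const (zero_lt_two' ℝ))
  have T3 := (h.tendsto_integral_massWeight hα ht).sub (h.tendsto_integral_massWeight hα le_rfl)
  rw [hmass, sub_self] at T3
  have T := (T1.add T3).add (T2.const_mul (6 * N))
  simp only [add_zero, mul_zero] at T
  refine squeeze_zero' (Eventually.of_forall fun R =>
    h.integral_integral_flux_nonneg R le_rfl ht) ?_ T
  filter_upwards [eventually_gt_atTop 0] with R hR
  have hRb : ∀ x : ℝ, 0 < x → |R ^ 2| ≤ R ^ 2 * (1 + x) ^ α := fun x hx => by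
    rw [abs_of_nonneg (by positivity)]
    have := one_le_weight hα hx
    nlinarith [sq_nonneg R]
  have htest := isTest_massWeight hR.le
  have I1 := h.intervalIntegrable_integral (hm1.indicator measurableSet_Ioi)
    (abs_indicator_Ioi_le (abs_one_add_le hα) R) le_rfl ht
  have I2 := h.intervalIntegrable_integral (hm1.indicator measurableSet_Ioi)
    (abs_indicator_Ioi_le (abs_one_add_le hα) (R / 2)) le_rfl ht
  have I3 := h.intervalIntegrable_test hk hα htest le_rfl ht
  rw [h.integral_test_eq hk hα htest le_rfl ht, add_sub_cancel_left]
  simp only [Function.comp, id]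
  rw [← intervalIntegral.integral_const_mul, ← intervalIntegral.integral_add I1 I3,
    ← intervalIntegral.integral_add (I1.add I3) (I2.const_mul _)]
  refine intervalIntegral.integral_mono_on ht
    (h.intervalIntegrable_integral (measurable_fluxWeight R) (fluxWeight_bound hα R) le_rfl ht)
    ((I1.add I3).add (I2.const_mul _)) fun s hs => ?_
  have hs0 : 0 ≤ s := hs.1
  have e1 : ∫ x, fluxWeight R x * f s x ∂ν₊ =
      (∫ x, indicator (Ioi R) (fun z => 1 + z) x * f s x ∂ν₊) +
      ∫ x, indicator (Ioi R) (fun _ => R ^ 2) x * f s x ∂ν₊ := by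
    rw [← integral_add ((h.memL1 s hs0).integrable_mul (hm1.indicator measurableSet_Ioi)
        (abs_indicator_Ioi_le (abs_one_add_le hα) R)).1
      ((h.memL1 s hs0).integrable_mul (measurable_const.indicator measurableSet_Ioi)
        (abs_indicator_Ioi_le hRb R)).1]
    congr 1
    funext x
    rw [← add_mul, fluxWeight]
    congr 1
    by_cases hx : x ∈ Ioi R
    · simp only [indicator_of_mem hx]
    · simp only [indicator_of_notMem hx, add_zero]
  have b1 := (hk.massWeight_rhs_bounds hα (h.measurable_slice s) (h.memL1 s hs0)
    (h.nonneg s hs0) hR).1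
  have b2 : ∫ x, f s x ∂ν₊ ≤ N :=
    ((le_abs_self _).trans abs_integral_le_integral_abs).trans
      ((h.integral_abs_le_normL1 hα hs0).trans (hN s hs))
  have b3 : 0 ≤ ∫ x, indicator (Ioi (R / 2)) (fun z => 1 + z) x * f s x ∂ν₊ :=
    h.integral_nonneg_of_weight (fun x hx => indicator_apply_nonneg fun _ => by linarith) hs0
  have b4 := mul_le_mul_of_nonneg_right b2 b3
  rw [e1]
  linarith

/-- Coagulation only decreases the truncated mass, and the influx by fragmentation is bounded by the
flux weight, which vanishes in the limit. -/
theorem integral_id_le (h : IsMildSolution K F α f₀ f) (hk : IsKernelPair K F)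
    (hα : 1 ≤ α) (hN : NoFlux f) {t : ℝ} (ht : 0 ≤ t) :
    ∫ x, id x * f t x ∂ν₊ ≤ ∫ x, id x * f 0 x ∂ν₊ := by
  have T := (h.tendsto_integral_massWeight hα le_rfl).add (hN t ht)
  rw [add_zero] at T
  refine le_of_tendsto_of_tendsto (h.tendsto_integral_massWeight hα ht) T ?_
  filter_upwards [eventually_gt_atTop 0] with R hR
  have htest := isTest_massWeight hR.le
  rw [h.integral_test_eq hk hα htest le_rfl ht]
  refine add_le_add_right (intervalIntegral.integral_mono_on ht
    (h.intervalIntegrable_test hk hα htest le_rfl ht)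
    (h.intervalIntegrable_integral (measurable_fluxWeight R) (fluxWeight_bound hα R) le_rfl ht)
    fun s hs => ?_) _
  exact (hk.massWeight_rhs_bounds hα (h.measurable_slice s) (h.memL1 s hs.1)
    (h.nonneg s hs.1) hR).2

end IsMildSolution

/-! ### Moment inequalities for weights of linear growth -/

/-- Nondecreasing weights of at most linear growth. -/
structure IsWeight (φ : ℝ → ℝ) (B : ℝ) : Prop where
  measurable : Measurable φ
  B_nonneg : 0 ≤ B
  nonneg : ∀ x, 0 < x → 0 ≤ φ x
  mono : ∀ x y, 0 < x → x ≤ y → φ x ≤ φ y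
  le : ∀ x, 0 < x → φ x ≤ B * (1 + x)

namespace IsWeight

variable {φ : ℝ → ℝ} {B : ℝ} (h : IsWeight φ B)
include h

theorem abs_le {α : ℝ} (hα : 1 ≤ α) (x : ℝ) (hx : 0 < x) : |φ x| ≤ B * (1 + x) ^ α := by
  rw [abs_of_nonneg (h.nonneg x hx)]
  exact (h.le x hx).trans (mul_le_mul_of_nonneg_left (one_le_weight hα hx) h.B_nonneg)

theorem isTest_indicator {R : ℝ} (hR : 0 ≤ R) :
    IsTest (indicator (Iic R) φ) (B * (1 + R)) R where
  measurable := h.measurable.indicator measurableSet_Iic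
  B_nonneg := mul_nonneg h.B_nonneg (by linarith)
  R_nonneg := hR
  bound x hx := by
    rw [abs_of_nonneg (indicator_apply_nonneg fun _ => h.nonneg x hx)]
    have hB := h.B_nonneg
    refine indicator_apply_le' (fun hxR => (h.le x hx).trans ?_) fun _ => by positivity
    have : x ≤ R := hxR
    gcongr
  support x hx := indicator_of_notMem (by simpa using hx) _

theorem intervalIntegrable {z : ℝ} (hz : 0 < z) : IntervalIntegrable φ volume 0 z := by
  have h1 := (h.isTest_indicator hz.le).intervalIntegrable hz
  refine h1.congr ?_
  intro y hy
  rw [uIoc_of_le hz.le] at hy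
  exact indicator_of_mem (by exact hy.2) _

theorem integral_le {z : ℝ} (hz : 0 < z) : ∫ y in (0 : ℝ)..z, φ y ≤ z * φ z := by
  have := intervalIntegral.integral_mono_on_of_le_Ioo hz.le (h.intervalIntegrable hz)
    (intervalIntegrable_const (c := φ z)) fun y hy => h.mono y z hy.1 hy.2.le
  simpa using this

theorem abs_indicator_Iic_le {α : ℝ} (hα : 1 ≤ α) (R x : ℝ) (hx : 0 < x) :
    |indicator (Iic R) φ x| ≤ B * (1 + x) ^ α := by
  refine le_trans ?_ (h.abs_le hα x hx)
  rw [abs_of_nonneg (indicator_apply_nonneg fun _ => h.nonneg x hx)]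
  exact indicator_apply_le' (fun _ => le_abs_self _) fun _ => abs_nonneg _

theorem tendsto_integral_indicator {α : ℝ} (hα : 1 ≤ α) {g : ℝ → ℝ} (hg : MemL1 α g) :
    Tendsto (fun R => ∫ x, indicator (Iic R) φ x * g x ∂ν₊) atTop
      (𝓝 (∫ x, φ x * g x ∂ν₊)) :=
  hg.tendsto_integral_weight (fun R => h.measurable.indicator (measurableSet_Iic (a := R)))
    (h.abs_indicator_Iic_le hα) (fun x _ => by
      filter_upwards [eventually_ge_atTop x] with R hR
      exact indicator_of_mem (show x ∈ Iic R from hR) _)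

end IsWeight

/-- For z ≤ R the loss is bounded with F ≥ 2, and monotonicity gives (1/z)∫₀^z φ ≤ φ(z), the extra
φ(z) in the hypothesis on Φ. For z > R the loss is cut off and the gain is at most B(1+R)(2R+1) ≤
3B(1+z+R²); the term |Φ| compensates a negative Φ. -/
theorem IsKernelPair.weight_frag_le {K F : ℝ → ℝ → ℝ} (h : IsKernelPair K F) {φ Φ : ℝ → ℝ}
    {B R z : ℝ} (hφ : IsWeight φ B)
    (hΦ : ∀ z, 0 < z → 2 * (∫ y in (0 : ℝ)..z, φ y) - z * φ z + φ z ≤ Φ z)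
    (hR : 0 < R) (hz : 0 < z) :
    (∫ y in (0 : ℝ)..z, indicator (Iic R) φ y * F y (z - y)) -
        (1 / 2) * (indicator (Iic R) φ z * ∫ y in (0 : ℝ)..z, F y (z - y)) ≤
      Φ z + 3 * B * fluxWeight R z + indicator (Ioi R) (fun x => |Φ x|) z := by
  have ht := hφ.isTest_indicator hR.le
  obtain ⟨-, -, b3⟩ := h.fragSlice_bounds hz ht.measurable (ht.intervalIntegrable hz)
    fun x hx => indicator_apply_nonneg fun _ => hφ.nonneg x hx
  obtain ⟨-, c2, -⟩ := h.fragSlice_bounds (ψ := fun _ => 1) hz measurable_const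
    intervalIntegrable_const fun _ _ => zero_le_one
  simp only [one_mul, intervalIntegral.integral_const, smul_eq_mul, mul_one, sub_zero] at c2
  have hB := hφ.B_nonneg
  rcases le_or_gt z R with hzR | hzR
  · have e1 : ∫ y in (0 : ℝ)..z, indicator (Iic R) φ y = ∫ y in (0 : ℝ)..z, φ y := by
      refine intervalIntegral.integral_congr fun y hy => ?_
      rw [uIcc_of_le hz.le] at hy
      exact indicator_of_mem (show y ∈ Iic R from hy.2.trans hzR) _
    rw [e1] at b3
    rw [indicator_of_mem (show z ∈ Iic R from hzR),
      indicator_of_notMem (show z ∉ Ioi R by simpa using hzR), fluxWeight,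
      indicator_of_notMem (show z ∉ Ioi R by simpa using hzR)]
    have b4 : (2 + 1 / z) * ∫ y in (0 : ℝ)..z, φ y ≤ 2 * (∫ y in (0 : ℝ)..z, φ y) + φ z := by
      have h1 : 1 / z * ∫ y in (0 : ℝ)..z, φ y ≤ 1 / z * (z * φ z) :=
        mul_le_mul_of_nonneg_left (hφ.integral_le hz) (by positivity)
      have h2 : 1 / z * (z * φ z) = φ z := by field_simp
      rw [add_mul]
      linarith
    have b5 := mul_le_mul_of_nonneg_left c2 (hφ.nonneg z hz)
    have b6 := hΦ z hz
    linarith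
  · rw [indicator_of_notMem (show z ∉ Iic R by simpa using hzR), zero_mul, mul_zero, sub_zero,
      fluxWeight, indicator_of_mem (show z ∈ Ioi R from hzR),
      indicator_of_mem (show z ∈ Ioi R from hzR)]
    have d1 : ∫ y in (0 : ℝ)..z, indicator (Iic R) φ y ≤ B * (1 + R) * R := by
      have := (integral_abs_le_of_bounded_support ht.measurable hR.le ht.bound ht.support hz).2
      rw [min_eq_right hzR.le] at this
      exact ((le_abs_self _).trans
        (intervalIntegral.abs_integral_le_integral_abs hz.le)).trans this
    have d2 : (2 + 1 / z) * ∫ y in (0 : ℝ)..z, indicator (Iic R) φ y ≤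
        (2 + 1 / R) * (B * (1 + R) * R) := by
      have h1 : 1 / z ≤ 1 / R := one_div_le_one_div_of_le hR hzR.le
      refine (mul_le_mul_of_nonneg_left d1 (by positivity)).trans ?_
      gcongr
    have d3 : (2 + 1 / R) * (B * (1 + R) * R) = B * ((1 + R) * (2 * R + 1)) := by
      field_simp
    have d4 : B * ((1 + R) * (2 * R + 1)) ≤ B * (3 * (1 + z + R ^ 2)) := by
      refine mul_le_mul_of_nonneg_left ?_ hB
      nlinarith
    have d5 := neg_abs_le (Φ z)
    linarith

/-- Upper bound on the rate of change of a truncated moment. -/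
theorem IsKernelPair.weight_rhs_le {K F : ℝ → ℝ → ℝ} (h : IsKernelPair K F) {α : ℝ}
    (hα : 1 ≤ α) {f φ Φ a b : ℝ → ℝ} {B D σ : ℝ} (hf : Measurable f) (hfi : MemL1 α f)
    (hf0 : ∀ᵐ x ∂ν₊, 0 ≤ f x) (hφ : IsWeight φ B)
    (hΦm : Measurable Φ) (hΦb : ∀ x, 0 < x → |Φ x| ≤ D * (1 + x) ^ α)
    (hΦ : ∀ z, 0 < z → 2 * (∫ y in (0 : ℝ)..z, φ y) - z * φ z + φ z ≤ Φ z)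
    (ha : Measurable a) (hab : ∀ x, 0 < x → |a x| ≤ 1 * (1 + x) ^ α)
    (hb : Measurable b) (hbb : ∀ x, 0 < x → |b x| ≤ 1 * (1 + x) ^ α)
    (hdef : ∀ x y k, 0 < x → 0 < y → 2 ≤ k → k ≤ 3 →
      (1 / 2) * (φ (x + y) - φ x - φ y) * k ≤ σ * (a x * b y + b x * a y))
    {R : ℝ} (hR : 0 < R) :
    ∫ x, indicator (Iic R) φ x * (coag K f f x + frag F f x) ∂ν₊ ≤
      2 * σ * (∫ x, a x * f x ∂ν₊) * (∫ x, b x * f x ∂ν₊) + (∫ x, Φ x * f x ∂ν₊) +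
      (3 * (∫ x, f x ∂ν₊) * (∫ x, indicator (Ioi R) φ x * f x ∂ν₊) +
        3 * B * (∫ x, fluxWeight R x * f x ∂ν₊) +
        ∫ x, indicator (Ioi R) (fun x => |Φ x|) x * f x ∂ν₊) := by
  have ht := hφ.isTest_indicator hR.le
  obtain ⟨-, -, i1, i2, he⟩ := h.weak_form hf hfi.1 ht.measurable ht.B_nonneg ht.R_nonneg
    ht.bound ht.support
  have hp := ae_prod_and_of_ae hf0
  rw [he]
  have Ia := (hfi.integrable_mul ha hab).1
  have Ib := (hfi.integrable_mul hb hbb).1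
  have Iφ := (hfi.integrable_mul (hφ.measurable.indicator measurableSet_Ioi)
    (abs_indicator_Ioi_le (hφ.abs_le hα) R)).1
  have IΦ := (hfi.integrable_mul hΦm hΦb).1
  have IF := (hfi.integrable_mul (measurable_fluxWeight R) (fluxWeight_bound hα R)).1
  have IΦ' := (hfi.integrable_mul (w := indicator (Ioi R) (fun x => |Φ x|))
    (hΦm.abs.indicator measurableSet_Ioi)
    (abs_indicator_Ioi_le (fun x hx => (abs_abs (Φ x)).le.trans (hΦb x hx)) R)).1
  have j1 := Ia.mul_prod Ib
  have j2 := Ib.mul_prod Ia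
  have j3 := Iφ.mul_prod hfi.1
  have j4 := Integrable.mul_prod hfi.1 Iφ
  obtain ⟨k1, k2⟩ := integral_lincomb_four σ σ (3 / 2) (3 / 2) j1 j2 j3 j4
  have hc := integral_mono_ae (i1.const_mul (1 / 2)) k1 (by
    filter_upwards [hp] with p hp
    obtain ⟨⟨a1, a2⟩, a3, a4⟩ := hp
    have b0 := h.bound_K _ _ a2 a4
    have b1 := hdef p.1 p.2 (K p.1 p.2) a2 a4 b0.1 b0.2
    -- The removed tail at x + y has a favourable sign and is dropped; those at x and y cost at most
    -- K/2 ≤ 3/2 each.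
    have hsplit : ∀ x, indicator (Iic R) φ x = φ x - indicator (Ioi R) φ x := by
      intro x
      rcases le_or_gt x R with hx | hx
      · rw [indicator_of_mem (show x ∈ Iic R from hx),
          indicator_of_notMem (show x ∉ Ioi R by simpa using hx), sub_zero]
      · rw [indicator_of_notMem (show x ∉ Iic R by simpa using hx),
          indicator_of_mem (show x ∈ Ioi R from hx), sub_self]
    have h0 : ∀ x, 0 < x → 0 ≤ indicator (Ioi R) φ x := fun x hx =>
      indicator_apply_nonneg fun _ => hφ.nonneg x hx
    have c0 := h0 _ (add_pos a2 a4)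
    have c1 := h0 _ a2
    have c2 := h0 _ a4
    have b4 := mul_nonneg a1 a3
    have d1 : (1 / 2) * ((indicator (Iic R) φ (p.1 + p.2) - indicator (Iic R) φ p.1 -
        indicator (Iic R) φ p.2) * K p.1 p.2) ≤ σ * (a p.1 * b p.2 + b p.1 * a p.2) +
        (3 / 2) * (indicator (Ioi R) φ p.1 + indicator (Ioi R) φ p.2) := by
      rw [hsplit, hsplit p.1, hsplit p.2]
      have c3 : 0 ≤ indicator (Ioi R) φ (p.1 + p.2) * K p.1 p.2 :=
        mul_nonneg c0 (by linarith [b0.1])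
      have c4 := mul_le_mul_of_nonneg_left b0.2 (add_nonneg c1 c2)
      nlinarith
    have d2 := mul_le_mul_of_nonneg_right d1 b4
    refine le_trans (le_of_eq ?_) (d2.trans (le_of_eq ?_)) <;> ring)
  rw [integral_const_mul, k2, integral_prod_mul (fun x => a x * f x) (fun x => b x * f x),
    integral_prod_mul (fun x => b x * f x) (fun x => a x * f x),
    integral_prod_mul (fun x => indicator (Ioi R) φ x * f x) f,
    integral_prod_mul f (fun x => indicator (Ioi R) φ x * f x)] at hc
  obtain ⟨l1, l2⟩ := integral_lincomb_four 1 (3 * B) 1 0 IΦ IF IΦ' IΦ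
  have hd := integral_mono_ae i2 l1 (by
    filter_upwards [hf0, ae_restrict_mem measurableSet_Ioi] with z hz hz0
    have := mul_le_mul_of_nonneg_left (h.weight_frag_le hφ hΦ hR hz0) hz
    linarith)
  rw [l2] at hd
  linarith

namespace IsMildSolution

variable {K F : ℝ → ℝ → ℝ} {α : ℝ} {f₀ φ Φ a b : ℝ → ℝ} {f : ℝ → ℝ → ℝ} {B D σ : ℝ}

/-- The moment inequality for weights of linear growth. -/
theorem moment_le (h : IsMildSolution K F α f₀ f) (hk : IsKernelPair K F) (hα : 1 ≤ α)
    (hN : NoFlux f) (hφ : IsWeight φ B)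
    (hΦm : Measurable Φ) (hD : 0 ≤ D) (hΦb : ∀ x, 0 < x → |Φ x| ≤ D * (1 + x) ^ α)
    (hΦ : ∀ z, 0 < z → 2 * (∫ y in (0 : ℝ)..z, φ y) - z * φ z + φ z ≤ Φ z)
    (ha : Measurable a) (hab : ∀ x, 0 < x → |a x| ≤ 1 * (1 + x) ^ α)
    (hb : Measurable b) (hbb : ∀ x, 0 < x → |b x| ≤ 1 * (1 + x) ^ α)
    (hdef : ∀ x y k, 0 < x → 0 < y → 2 ≤ k → k ≤ 3 →
      (1 / 2) * (φ (x + y) - φ x - φ y) * k ≤ σ * (a x * b y + b x * a y))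
    {r t : ℝ} (hr : 0 ≤ r) (ht : r ≤ t) :
    ∫ x, φ x * f t x ∂ν₊ ≤ (∫ x, φ x * f r x ∂ν₊) + ∫ s in r..t,
      (2 * σ * (∫ x, a x * f s x ∂ν₊) * (∫ x, b x * f s x ∂ν₊) + ∫ x, Φ x * f s x ∂ν₊) := by
  obtain ⟨N, hN0, hNb⟩ := h.exists_bound t
  have ht0 := hr.trans ht
  have hΦb' : ∀ x, 0 < x → |(fun x => |Φ x|) x| ≤ D * (1 + x) ^ α := fun x hx =>
    (abs_abs (Φ x)).le.trans (hΦb x hx)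
  have T1 := h.tendsto_integral_tail hφ.B_nonneg hφ.measurable (hφ.abs_le hα) ht0
  have T2 := hN t ht0
  have T3 := h.tendsto_integral_tail hD hΦm.abs hΦb' ht0
  have T := ((T1.const_mul (3 * N)).add (T2.const_mul (3 * B))).add T3
  simp only [mul_zero, add_zero] at T
  have T4 := (tendsto_const_nhds (x := (∫ x, φ x * f r x ∂ν₊) + ∫ s in r..t,
    (2 * σ * (∫ x, a x * f s x ∂ν₊) * (∫ x, b x * f s x ∂ν₊) +
      ∫ x, Φ x * f s x ∂ν₊))).add T
  rw [add_zero] at T4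
  have T5 := hφ.tendsto_integral_indicator hα (h.memL1 t ht0)
  refine le_of_tendsto_of_tendsto T5 T4 ?_
  filter_upwards [eventually_gt_atTop 0] with R hR
  have htest := hφ.isTest_indicator hR.le
  have C1 := h.continuousOn_integral ha hab
  have C2 := h.continuousOn_integral hb hbb
  have C3 := h.continuousOn_integral hΦm hΦb
  have I0 : IntervalIntegrable (fun s => 2 * σ * (∫ x, a x * f s x ∂ν₊) *
      (∫ x, b x * f s x ∂ν₊) + ∫ x, Φ x * f s x ∂ν₊) volume r t :=
    ((((continuousOn_const.mul C1).mul C2).add C3).mono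
      (Icc_subset_Ici_self.trans (Ici_subset_Ici.2 hr))).intervalIntegrable_of_Icc ht
  have J1 := fun r' (hr' : 0 ≤ r') (ht' : r' ≤ t) => h.intervalIntegrable_integral
    (hφ.measurable.indicator (measurableSet_Ioi (a := R)))
    (abs_indicator_Ioi_le (hφ.abs_le hα) R) hr' ht'
  have J2 := fun r' (hr' : 0 ≤ r') (ht' : r' ≤ t) => h.intervalIntegrable_integral
    (measurable_fluxWeight R) (fluxWeight_bound hα R) hr' ht'
  have J3 := fun r' (hr' : 0 ≤ r') (ht' : r' ≤ t) => h.intervalIntegrable_integral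
    (w := indicator (Ioi R) (fun x => |Φ x|)) (hΦm.abs.indicator measurableSet_Ioi)
    (abs_indicator_Ioi_le hΦb' R) hr' ht'
  set E : ℝ → ℝ := fun s => 3 * N * (∫ x, indicator (Ioi R) φ x * f s x ∂ν₊) +
    3 * B * (∫ x, fluxWeight R x * f s x ∂ν₊) +
    ∫ x, indicator (Ioi R) (fun x => |Φ x|) x * f s x ∂ν₊ with hE
  have JE := fun r' (hr' : 0 ≤ r') (ht' : r' ≤ t) =>
    (((J1 r' hr' ht').const_mul (3 * N)).add ((J2 r' hr' ht').const_mul (3 * B))).add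
      (J3 r' hr' ht')
  have hB := hφ.B_nonneg
  have hφtail : ∀ s, 0 ≤ s → 0 ≤ ∫ x, indicator (Ioi R) φ x * f s x ∂ν₊ := fun s hs =>
    h.integral_nonneg_of_weight (fun x hx => indicator_apply_nonneg fun _ => hφ.nonneg x hx) hs
  have hE0 : ∀ s, 0 ≤ s → 0 ≤ E s := by
    intro s hs
    have e1 := hφtail s hs
    have e2 := h.integral_nonneg_of_weight (fun x hx => fluxWeight_nonneg (R := R) hx) hs
    have e3 := h.integral_nonneg_of_weight (w := indicator (Ioi R) (fun x => |Φ x|))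
      (fun x hx => indicator_apply_nonneg fun _ => abs_nonneg _) hs
    positivity
  -- `NoFlux` concerns integrals starting at time 0; since the error E is nonnegative, the interval
  -- may be enlarged.
  have hEint : ∫ s in r..t, E s ≤ ∫ s in (0 : ℝ)..t, E s := by
    have hsplit := intervalIntegral.integral_add_adjacent_intervals
      ((JE 0 le_rfl ht0).mono_set (by
        rw [uIcc_of_le hr, uIcc_of_le ht0]; exact Icc_subset_Icc_right ht)) (JE r hr ht)
    have := intervalIntegral.integral_nonneg (μ := volume) hr (f := E) fun s hs => hE0 s hs.1
    change (∫ s in (0 : ℝ)..r, E s) + ∫ s in r..t, E s = ∫ s in (0 : ℝ)..t, E s at hsplit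
    linarith
  have hEval : ∫ s in (0 : ℝ)..t, E s =
      3 * N * (∫ s in (0 : ℝ)..t, ∫ x, indicator (Ioi R) φ x * f s x ∂ν₊) +
      3 * B * (∫ s in (0 : ℝ)..t, ∫ x, fluxWeight R x * f s x ∂ν₊) +
      ∫ s in (0 : ℝ)..t, ∫ x, indicator (Ioi R) (fun x => |Φ x|) x * f s x ∂ν₊ := by
    rw [← intervalIntegral.integral_const_mul, ← intervalIntegral.integral_const_mul,
      ← intervalIntegral.integral_add ((J1 0 le_rfl ht0).const_mul _)
        ((J2 0 le_rfl ht0).const_mul _),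
      ← intervalIntegral.integral_add (((J1 0 le_rfl ht0).const_mul _).add
        ((J2 0 le_rfl ht0).const_mul _)) (J3 0 le_rfl ht0)]
  rw [← hEval, h.integral_test_eq hk hα htest hr ht]
  have m1 : ∫ x, indicator (Iic R) φ x * f r x ∂ν₊ ≤ ∫ x, φ x * f r x ∂ν₊ :=
    h.integral_mono_weight htest.measurable (hφ.abs_indicator_Iic_le hα R) hφ.measurable (hφ.abs_le hα)
      (fun x hx => indicator_apply_le' (fun _ => le_rfl) fun _ => hφ.nonneg x hx) hr
  have m2 : ∫ s in r..t, ∫ x, indicator (Iic R) φ x *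
      (coag K (f s) (f s) x + frag F (f s) x) ∂ν₊ ≤
      ∫ s in r..t, ((2 * σ * (∫ x, a x * f s x ∂ν₊) * (∫ x, b x * f s x ∂ν₊) +
      ∫ x, Φ x * f s x ∂ν₊) + E s) := by
    refine intervalIntegral.integral_mono_on ht (h.intervalIntegrable_test hk hα htest hr ht)
      (I0.add (JE r hr ht)) fun s hs => ?_
    have hs0 : 0 ≤ s := hr.trans hs.1
    refine (hk.weight_rhs_le hα (h.measurable_slice s) (h.memL1 s hs0) (h.nonneg s hs0) hφ hΦm
      hΦb hΦ ha hab hb hbb hdef hR).trans ?_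
    have b2 : ∫ x, f s x ∂ν₊ ≤ N :=
      ((le_abs_self _).trans abs_integral_le_integral_abs).trans
        ((h.integral_abs_le_normL1 hα hs0).trans (hNb s ⟨hs0, hs.2⟩))
    have b4 := mul_le_mul_of_nonneg_right b2 (hφtail s hs0)
    simp only [hE]
    linarith
  rw [intervalIntegral.integral_add I0 (JE r hr ht)] at m2
  change _ ≤ _ + ∫ s in r..t, E s at m2
  linarith

end IsMildSolution

/-! ### Truncated power weights -/

/-- The weight `(1 + x)^α`, continued linearly beyond `1 + x = n`. -/
noncomputable def truncWeight (α n x : ℝ) : ℝ := (1 + x) * (min (1 + x) n) ^ (α - 1)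

theorem mul_rpow_sub_one' {x : ℝ} (hx : 0 < x) (α : ℝ) : x * x ^ (α - 1) = x ^ α := by
  nth_rewrite 1 [← Real.rpow_one x]
  rw [← Real.rpow_add hx]
  congr 1
  ring

theorem measurable_truncWeight (α n : ℝ) : Measurable (truncWeight α n) := by
  unfold truncWeight
  fun_prop

theorem truncWeight_of_le {α n x : ℝ} (hx : 0 < 1 + x) (h : 1 + x ≤ n) :
    truncWeight α n x = (1 + x) ^ α := by
  rw [truncWeight, min_eq_left h, mul_rpow_sub_one' hx]

theorem truncWeight_le {α n x : ℝ} (hα : 1 ≤ α) (hn : 1 ≤ n) (hx : 0 < x) :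
    truncWeight α n x ≤ (1 + x) ^ α := by
  rw [← mul_rpow_sub_one' (by linarith : 0 < 1 + x), truncWeight]
  have h1 : 0 ≤ min (1 + x) n := le_min (by linarith) (by linarith)
  refine mul_le_mul_of_nonneg_left ?_ (by linarith)
  exact Real.rpow_le_rpow h1 (min_le_left _ _) (by linarith)

theorem isWeight_truncWeight {α n : ℝ} (hα : 1 ≤ α) (hn : 1 ≤ n) :
    IsWeight (truncWeight α n) (n ^ (α - 1)) where
  measurable := measurable_truncWeight α n
  B_nonneg := by positivity
  nonneg x hx := by
    have h1 : 0 ≤ min (1 + x) n := le_min (by linarith) (by linarith)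
    unfold truncWeight
    positivity
  mono x y hx hxy := by
    have h1 : 0 ≤ min (1 + x) n := le_min (by linarith) (by linarith)
    have h2 : 0 ≤ α - 1 := by linarith
    unfold truncWeight
    gcongr
    linarith
  le x hx := by
    have h1 : 0 ≤ min (1 + x) n := le_min (by linarith) (by linarith)
    rw [mul_comm, truncWeight]
    refine mul_le_mul_of_nonneg_left ?_ (by linarith)
    exact Real.rpow_le_rpow h1 (min_le_right _ _) (by linarith)

theorem integral_one_add_rpow {α m : ℝ} (hα : 1 ≤ α) :
    ∫ y in (0 : ℝ)..m, (1 + y) ^ α = ((1 + m) ^ (α + 1) - 1) / (α + 1) := by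
  have := intervalIntegral.integral_comp_add_left (a := 0) (b := m) (fun y : ℝ => y ^ α) 1
  rw [this, integral_rpow (Or.inl (by linarith))]
  simp

/-- Here the unbounded fragmentation terms cancel. On the power part 2/(α+1) = 1 − (α−1)/(α+1),
which leaves a dissipative term of order α+1. On the linear part 2∫φ increases exactly like
(1+z)φ(z), so the dissipation stays frozen at its value for 1 + z = n. -/
theorem two_mul_integral_truncWeight_le {α n z : ℝ} (hα : 1 ≤ α) (hn : 1 ≤ n) (hz : 0 < z) :
    2 * ∫ y in (0 : ℝ)..z, truncWeight α n y ≤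
      (1 + z) * truncWeight α n z - (α - 1) / (α + 1) * (min (1 + z) n) ^ (α + 1) := by
  have key : ∀ m, 0 ≤ m → 1 + m ≤ n →
      2 * ∫ y in (0 : ℝ)..m, truncWeight α n y ≤
        (1 - (α - 1) / (α + 1)) * (1 + m) ^ (α + 1) := by
    intro m hm hmn
    have e1 : ∫ y in (0 : ℝ)..m, truncWeight α n y = ∫ y in (0 : ℝ)..m, (1 + y) ^ α := by
      refine intervalIntegral.integral_congr fun y hy => ?_
      rw [uIcc_of_le hm] at hy
      exact truncWeight_of_le (by linarith [hy.1]) (by linarith [hy.2])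
    rw [e1, integral_one_add_rpow hα]
    have h2 : 1 - (α - 1) / (α + 1) = 2 / (α + 1) := by
      field_simp
      ring
    rw [h2, ← mul_div_assoc, div_mul_eq_mul_div]
    gcongr
    linarith
  rcases le_or_gt (1 + z) n with h | h
  · have h1 := key z hz.le h
    have h2 : (1 + z) * (1 + z) ^ α = (1 + z) ^ (α + 1) := by
      rw [Real.rpow_add_one (by linarith), mul_comm]
    rw [truncWeight_of_le (by linarith) h, h2, min_eq_left h]
    linarith
  · have hw := isWeight_truncWeight hα hn
    have i1 : ∀ m, 0 ≤ m → IntervalIntegrable (truncWeight α n) volume 0 m := by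
      intro m hm
      rcases hm.eq_or_lt with h0 | h0
      · rw [← h0]
      · exact hw.intervalIntegrable h0
    have h1 := key (n - 1) (by linarith) (by linarith)
    rw [← intervalIntegral.integral_add_adjacent_intervals (i1 (n - 1) (by linarith))
      ((i1 (n - 1) (by linarith)).symm.trans (i1 z hz.le))]
    have e1 : ∫ y in (n - 1)..z, truncWeight α n y =
        ∫ y in (n - 1)..z, n ^ (α - 1) * (1 + y) := by
      refine intervalIntegral.integral_congr fun y hy => ?_
      rw [uIcc_of_le (by linarith)] at hy
      simp only [truncWeight]
      rw [min_eq_right (by linarith [hy.1]), mul_comm]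
    have e2 : ∫ y in (n - 1)..z, (1 + y) = ((1 + z) ^ 2 - n ^ 2) / 2 := by
      rw [intervalIntegral.integral_add intervalIntegrable_const
        (continuous_id'.intervalIntegrable _ _), integral_id, intervalIntegral.integral_const,
        smul_eq_mul]
      ring
    have e3 : n ^ (α - 1) * n ^ 2 = n ^ (α + 1) := by
      rw [← Real.rpow_natCast, ← Real.rpow_add (by linarith)]
      congr 1
      push_cast
      ring
    rw [e1, intervalIntegral.integral_const_mul, e2, truncWeight, min_eq_right h.le]
    rw [add_sub_cancel] at h1
    nlinarith

/-- Bernoulli's inequality for (1 − y/(a+y))^α, multiplied by (a+y)^α. -/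
theorem rpow_sub_rpow_le {α a y : ℝ} (hα : 1 ≤ α) (ha : 0 < a) (hy : 0 ≤ y) :
    (a + y) ^ α - a ^ α ≤ α * y * (a + y) ^ (α - 1) := by
  have hs : 0 < a + y := by linarith
  have h1 := one_add_mul_self_le_rpow_one_add (s := -(y / (a + y))) (p := α)
    (by rw [neg_le_neg_iff, div_le_one hs]; linarith) hα
  have h2 : 1 + -(y / (a + y)) = a / (a + y) := by field_simp; ring
  rw [h2, Real.div_rpow ha.le hs.le, le_div_iff₀ (by positivity),
    ← mul_rpow_sub_one' hs α] at h1
  have h3 : (1 + α * -(y / (a + y))) * ((a + y) * (a + y) ^ (α - 1)) =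
      (a + y) * (a + y) ^ (α - 1) - α * y * (a + y) ^ (α - 1) := by
    field_simp
    ring
  rw [h3, mul_rpow_sub_one' hs α] at h1
  linarith

/-- If y ≤ x, adding y to x raises the weight by at most y times a slope of order (1+x)^(α−1), since
1+x+y ≤ 2(1+x). The bound is uniform in n and involves the high moment only linearly, next to a
first moment. -/
theorem truncWeight_defect_le {α n : ℝ} (hα : 1 ≤ α) (hn : 1 ≤ n) {x y : ℝ} (hx : 0 < x)
    (hy : 0 < y) :
    truncWeight α n (x + y) - truncWeight α n x - truncWeight α n y ≤
      α * 2 ^ (α - 1) * ((1 + x) * (1 + y) ^ (α - 1) + (1 + x) ^ (α - 1) * (1 + y)) := by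
  wlog hyx : y ≤ x generalizing x y with H
  · have := H hy hx (le_of_not_ge hyx)
    rw [add_comm y x] at this
    linarith
  have hα0 : 0 ≤ α - 1 := by linarith
  have hC : 1 ≤ α * (2 : ℝ) ^ (α - 1) :=
    one_le_mul_of_one_le_of_one_le hα (Real.one_le_rpow (by norm_num) hα0)
  have hφy := (isWeight_truncWeight hα hn).nonneg y hy
  have h1 : truncWeight α n (x + y) - truncWeight α n x ≤
      α * 2 ^ (α - 1) * ((1 + x) ^ (α - 1) * (1 + y)) := by
    rcases le_or_gt n (1 + x) with h | h
    · rw [truncWeight, truncWeight, min_eq_right h, min_eq_right (by linarith)]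
      have h2 : n ^ (α - 1) ≤ (1 + x) ^ (α - 1) := by gcongr
      have h3 : y * n ^ (α - 1) ≤ (1 + y) * (1 + x) ^ (α - 1) := by
        gcongr
        linarith
      have h4 : (1 + x) ^ (α - 1) * (1 + y) ≤
          α * 2 ^ (α - 1) * ((1 + x) ^ (α - 1) * (1 + y)) :=
        le_mul_of_one_le_left (by positivity) hC
      linarith
    · rw [truncWeight_of_le (by linarith) h.le]
      have h2 := truncWeight_le hα hn (add_pos hx hy)
      have h3 := rpow_sub_rpow_le hα (a := 1 + x) (by linarith) hy.le
      rw [add_assoc] at h3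
      have h4 : (1 + (x + y)) ^ (α - 1) ≤ 2 ^ (α - 1) * (1 + x) ^ (α - 1) := by
        rw [← Real.mul_rpow (by norm_num) (by linarith)]
        gcongr
        linarith
      have h5 : α * y * (1 + (x + y)) ^ (α - 1) ≤
          α * (1 + y) * (2 ^ (α - 1) * (1 + x) ^ (α - 1)) := by
        gcongr
        linarith
      linarith
  have h6 : 0 ≤ α * 2 ^ (α - 1) * ((1 + x) * (1 + y) ^ (α - 1)) := by positivity
  linarith

/-- For u ≥ L/c the left side is not positive; below that, u^(α−1) ≤ (L/c)^(α−1). Thus the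
dissipation yields an arbitrarily strong damping −L u^α at the price of a linear moment. -/
theorem rpow_dissipation {α c L u : ℝ} (hα : 1 ≤ α) (hc : 0 < c) (hL : 0 ≤ L) (hu : 0 < u) :
    L * u ^ α - c * u ^ (α + 1) ≤ L * (L / c) ^ (α - 1) * u := by
  have e1 : u ^ (α + 1) = u ^ α * u := Real.rpow_add_one hu.ne' α
  rcases le_or_gt (L / c) u with h | h
  · rw [div_le_iff₀ hc] at h
    have h1 : L * u ^ α ≤ u * c * u ^ α := by gcongr
    have h2 : 0 ≤ L * (L / c) ^ (α - 1) * u := by positivity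
    rw [e1]
    linarith
  · have h1 : u ^ (α - 1) ≤ (L / c) ^ (α - 1) :=
      Real.rpow_le_rpow hu.le h.le (by linarith)
    have h2 : L * (u * u ^ (α - 1)) ≤ L * (u * (L / c) ^ (α - 1)) := by gcongr
    rw [mul_rpow_sub_one' hu] at h2
    have h3 : 0 ≤ c * u ^ (α + 1) := by positivity
    linarith

/-! ### Moment bounds uniform in time and in the kernels -/

theorem continuousOn_le_max_of_le_integral {Y G : ℝ → ℝ} {C : ℝ} (hY : ContinuousOn Y (Ici 0))
    (hG : ContinuousOn G (Ici 0))
    (h : ∀ r t, 0 ≤ r → r ≤ t → Y t ≤ Y r + ∫ s in r..t, G s)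
    (hGY : ∀ s, 0 ≤ s → G s + Y s ≤ C) {t : ℝ} (ht : 0 ≤ t) : Y t ≤ max (Y 0) C := by
  refine le_max_of_add_integral_le hY (fun r t hr hrt => ?_) ht
  have hsub : Icc r t ⊆ Ici 0 := Icc_subset_Ici_self.trans (Ici_subset_Ici.2 hr)
  have i1 := (hY.mono hsub).intervalIntegrable_of_Icc (μ := volume) hrt
  have i2 := (hG.mono hsub).intervalIntegrable_of_Icc (μ := volume) hrt
  have h1 := h r t hr hrt
  have h2 := intervalIntegral.integral_mono_on hrt (i2.add i1) (intervalIntegrable_const (c := C))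
    fun s hs => hGY s (hr.trans hs.1)
  rw [intervalIntegral.integral_add i2 i1, intervalIntegral.integral_const, smul_eq_mul,
    mul_comm] at h2
  linarith

namespace IsMildSolution

variable {K F : ℝ → ℝ → ℝ} {α : ℝ} {f₀ : ℝ → ℝ} {f : ℝ → ℝ → ℝ}

theorem normL1_eq (h : IsMildSolution K F α f₀ f) {s : ℝ} (hs : 0 ≤ s) :
    normL1 α (f s) = ∫ x, (1 + x) ^ α * f s x ∂ν₊ := by
  refine integral_congr_ae ?_
  filter_upwards [h.nonneg s hs] with x hx
  rw [abs_of_nonneg hx]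

theorem integral_le_normL1 (h : IsMildSolution K F α f₀ f) {w : ℝ → ℝ}
    (hw : Measurable w) (hwb : ∀ x, 0 < x → |w x| ≤ 1 * (1 + x) ^ α) {s : ℝ} (hs : 0 ≤ s) :
    ∫ x, w x * f s x ∂ν₊ ≤ normL1 α (f s) := by
  have := ((h.memL1 s hs).integrable_mul hw hwb).2
  rw [one_mul] at this
  exact ((le_abs_self _).trans abs_integral_le_integral_abs).trans this

/-- The weight 1 + x has coagulation defect −1, so K ≥ 2 gives the damping −M₀². Fragmentation
creates clusters at rate at most M₀ + 2M₁, and M₁ does not increase. -/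
theorem integral_one_add_le (h : IsMildSolution K F α f₀ f) (hk : IsKernelPair K F) (hα : 1 ≤ α)
    (hN : NoFlux f) {t : ℝ} (ht : 0 ≤ t) :
    ∫ x, (1 + x) * f t x ∂ν₊ ≤ 1 + 3 * normL1 α f₀ := by
  have hm1 : Measurable fun x : ℝ => 1 + x := by fun_prop
  have hm2 : Measurable fun x : ℝ => 1 + 2 * x := by fun_prop
  have hb2 : ∀ x : ℝ, 0 < x → |1 + 2 * x| ≤ 2 * (1 + x) ^ α := fun x hx => by
    rw [abs_of_pos (by linarith)]
    linarith [one_le_weight hα hx]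
  have hφ : IsWeight (fun x : ℝ => 1 + x) 1 :=
    ⟨hm1, zero_le_one, fun x hx => by linarith, fun x y _ hxy => by linarith,
      fun x _ => (one_mul _).symm.le⟩
  have hΦ : ∀ z : ℝ, 0 < z → 2 * (∫ y in (0 : ℝ)..z, (1 + y)) - z * (1 + z) + (1 + z) ≤
      1 + 2 * z := by
    intro z hz
    rw [intervalIntegral.integral_add intervalIntegrable_const
        (continuous_id'.intervalIntegrable _ _), integral_id]
    simp
    nlinarith
  have hmom := fun r t hr hrt => h.moment_le hk hα hN hφ hm2 (zero_le_two) hb2 hΦ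
    (measurable_const (a := (1 : ℝ))) (abs_one_le hα) (measurable_const (a := (1 : ℝ)))
    (abs_one_le hα) (σ := -(1 / 2)) (fun x y k _ _ h2 _ => by linarith) (r := r) (t := t) hr hrt
  have c0 := h.continuousOn_integral hm1 (abs_one_add_le hα)
  have c1 := h.continuousOn_integral (measurable_const (a := (1 : ℝ))) (abs_one_le hα)
  have c2 := h.continuousOn_integral hm2 hb2
  have hn0 := h.normL1_zero
  have hM1 : ∫ x, id x * f 0 x ∂ν₊ ≤ normL1 α f₀ :=
    hn0 ▸ h.integral_le_normL1 measurable_id (abs_id_le hα) le_rfl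
  have hY0 : ∫ x, (1 + x) * f 0 x ∂ν₊ ≤ normL1 α f₀ :=
    hn0 ▸ h.integral_le_normL1 hm1 (abs_one_add_le hα) le_rfl
  have hnn := normL1_nonneg α f₀
  refine (continuousOn_le_max_of_le_integral (Y := fun t => ∫ x, (1 + x) * f t x ∂ν₊)
    (G := fun s => 2 * -(1 / 2) * (∫ x, 1 * f s x ∂ν₊) * (∫ x, 1 * f s x ∂ν₊) +
      ∫ x, (1 + 2 * x) * f s x ∂ν₊) (C := 1 + 3 * normL1 α f₀) c0 (((continuousOn_const.mul c1).mul c1).add c2) hmom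
    (fun s hs => ?_) ht).trans (max_le (by linarith) le_rfl)
  have I1 := ((h.memL1 s hs).integrable_mul (measurable_const (a := (1 : ℝ))) (abs_one_le hα)).1
  have I2 := ((h.memL1 s hs).integrable_mul measurable_id (abs_id_le hα)).1
  have e1 : ∫ x, (1 + x) * f s x ∂ν₊ = (∫ x, 1 * f s x ∂ν₊) + ∫ x, id x * f s x ∂ν₊ := by
    rw [← integral_add I1 I2]
    congr 1
    funext x
    simp only [id]
    ring
  have e2 : ∫ x, (1 + 2 * x) * f s x ∂ν₊ =
      (∫ x, 1 * f s x ∂ν₊) + 2 * ∫ x, id x * f s x ∂ν₊ := by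
    rw [← integral_const_mul, ← integral_add I1 (I2.const_mul 2)]
    congr 1
    funext x
    simp only [id]
    ring
  have hid := (h.integral_id_le hk hα hN hs).trans hM1
  rw [e1, e2]
  -- The rate plus M₀ + M₁ equals −M₀² + 2M₀ + 3M₁, which is at most 1 + 3M₁.
  nlinarith [sq_nonneg ((∫ x, 1 * f s x ∂ν₊) - 1)]

end IsMildSolution

theorem measurable_truncMin_rpow (α n : ℝ) : Measurable fun x : ℝ => (min (1 + x) n) ^ α := by
  fun_prop

theorem truncMin_rpow_le {α n x : ℝ} (hα : 1 ≤ α) (hn : 1 ≤ n) (hx : 0 < x) :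
    0 ≤ (min (1 + x) n) ^ α ∧ (min (1 + x) n) ^ α ≤ (1 + x) ^ α := by
  have h1 : 0 ≤ min (1 + x) n := le_min (by linarith) (by linarith)
  exact ⟨by positivity, Real.rpow_le_rpow h1 (min_le_left _ _) (by linarith)⟩

theorem abs_weight_le (α x : ℝ) (hx : 0 < x) : |(1 + x) ^ α| ≤ 1 * (1 + x) ^ α := by
  rw [one_mul, abs_of_nonneg (by positivity)]

namespace IsMildSolution

variable {K F : ℝ → ℝ → ℝ} {α : ℝ} {f₀ : ℝ → ℝ} {f : ℝ → ℝ → ℝ}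

/-- The moment inequality is applied to the truncated weights with n = max R 1, whose bounds do not
depend on n, and then R tends to infinity. Here α > 1 makes the dissipation coefficient (α−1)/(α+1)
positive. -/
theorem moment_le_of_one_lt (h : IsMildSolution K F α f₀ f) (hk : IsKernelPair K F) (hα : 1 < α)
    (hN : NoFlux f) {L M r t : ℝ} (hL : 0 ≤ L) (hr : 0 ≤ r) (ht : r ≤ t)
    (hM : M = L * (L / ((α - 1) / (α + 1))) ^ (α - 1)) :
    normL1 α (f t) ≤ normL1 α (f r) + ∫ s in r..t,
      (3 * (α * 2 ^ (α - 1)) * (∫ x, (1 + x) * f s x ∂ν₊) *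
        (∫ x, (1 + x) ^ (α - 1) * f s x ∂ν₊) +
      ∫ x, (2 * (1 + x) ^ α - L * (1 + x) ^ α + M * (1 + x)) * f s x ∂ν₊) := by
  have hα1 := hα.le
  have ht0 := hr.trans ht
  have hc : 0 < (α - 1) / (α + 1) := div_pos (by linarith) (by linarith)
  have hM0 : 0 ≤ M := by rw [hM]; positivity
  have hn : ∀ R : ℝ, 1 ≤ max R 1 := fun R => le_max_right _ _
  set C := α * (2 : ℝ) ^ (α - 1) with hC
  have hC0 : 0 ≤ C := by positivity
  have ha : Measurable fun x : ℝ => 1 + x := by fun_prop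
  have hb : Measurable fun x : ℝ => (1 + x) ^ (α - 1) := measurable_weight _
  have hbb : ∀ x : ℝ, 0 < x → |(1 + x) ^ (α - 1)| ≤ 1 * (1 + x) ^ α := fun x hx => by
    rw [one_mul, abs_of_nonneg (by positivity)]
    exact Real.rpow_le_rpow_of_exponent_le (by linarith) (by linarith)
  set Φ : ℝ → ℝ → ℝ := fun R x =>
    2 * (1 + x) ^ α - L * (min (1 + x) (max R 1)) ^ α + M * (1 + x) with hΦd
  have hΦm : ∀ R, Measurable (Φ R) := fun R =>
    (((measurable_weight α).const_mul 2).sub ((measurable_truncMin_rpow α _).const_mul L)).add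
      (ha.const_mul M)
  have hΦb : ∀ R x, 0 < x → |Φ R x| ≤ (2 + L + M) * (1 + x) ^ α := by
    intro R x hx
    obtain ⟨h1, h2⟩ := truncMin_rpow_le hα1 (hn R) hx
    have h3 := one_le_weight hα1 hx
    have h4 := mul_le_mul_of_nonneg_left h2 hL
    have h5 := mul_le_mul_of_nonneg_left h3 hM0
    have h6 := mul_nonneg hL h1
    have h7 : 0 ≤ M * (1 + x) := by positivity
    have h8 : 0 ≤ (1 + x) ^ α := by positivity
    rw [abs_le]
    constructor <;> simp only [hΦd] <;> linarith
  have hΦ : ∀ R z, 0 < z → 2 * (∫ y in (0 : ℝ)..z, truncWeight α (max R 1) y) -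
      z * truncWeight α (max R 1) z + truncWeight α (max R 1) z ≤ Φ R z := by
    intro R z hz
    have h1 := two_mul_integral_truncWeight_le hα1 (hn R) hz
    have h2 := truncWeight_le hα1 (hn R) hz
    have hu : 0 < min (1 + z) (max R 1) := lt_min (by linarith) (by linarith [hn R])
    have h3 := rpow_dissipation hα1 hc hL hu
    rw [← hM] at h3
    have h4 : M * min (1 + z) (max R 1) ≤ M * (1 + z) :=
      mul_le_mul_of_nonneg_left (min_le_left _ _) hM0
    simp only [hΦd]
    linarith
  have hdef : ∀ R x y k, 0 < x → 0 < y → 2 ≤ k → k ≤ 3 →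
      (1 / 2) * (truncWeight α (max R 1) (x + y) - truncWeight α (max R 1) x -
        truncWeight α (max R 1) y) * k ≤
        3 / 2 * C * ((1 + x) * (1 + y) ^ (α - 1) + (1 + x) ^ (α - 1) * (1 + y)) := by
    intro R x y k hx hy hk2 hk3
    have h1 := truncWeight_defect_le hα1 (hn R) hx hy
    rw [← hC] at h1
    have h2 : 0 ≤ C * ((1 + x) * (1 + y) ^ (α - 1) + (1 + x) ^ (α - 1) * (1 + y)) := by
      positivity
    have h3 := mul_le_mul_of_nonneg_right h1 (by linarith : 0 ≤ k)
    have h4 := mul_le_mul_of_nonneg_left hk3 h2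
    linarith
  have hmom := fun R => h.moment_le hk hα1 hN (isWeight_truncWeight hα1 (hn R)) (hΦm R)
    (by positivity) (hΦb R) (hΦ R) ha (abs_one_add_le hα1) hb hbb (hdef R) hr ht
  have hev : ∀ x : ℝ, ∀ᶠ R in atTop, min (1 + x) (max R 1) = 1 + x := fun x => by
    filter_upwards [eventually_ge_atTop (1 + x)] with R hR
    exact min_eq_left (hR.trans (le_max_left _ _))
  have hwb : ∀ R x, 0 < x → |truncWeight α (max R 1) x| ≤ 1 * (1 + x) ^ α := fun R x hx => by
    rw [one_mul, abs_of_nonneg ((isWeight_truncWeight hα1 (hn R)).nonneg x hx)]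
    exact truncWeight_le hα1 (hn R) hx
  have hwlim : ∀ x : ℝ, 0 < x → ∀ᶠ R in atTop, truncWeight α (max R 1) x = (1 + x) ^ α :=
    fun x hx => by
      filter_upwards [hev x] with R hR
      rw [truncWeight, hR, mul_rpow_sub_one' (by linarith)]
  have T1 := (h.memL1 t ht0).tendsto_integral_weight (fun R => measurable_truncWeight α (max R 1))
    hwb hwlim
  have T2 := (h.memL1 r hr).tendsto_integral_weight (fun R => measurable_truncWeight α (max R 1))
    hwb hwlim
  have T3 := h.tendsto_integral_weight (by positivity) hΦm hΦb
    (w := fun x => 2 * (1 + x) ^ α - L * (1 + x) ^ α + M * (1 + x)) (fun x _ => by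
      filter_upwards [hev x] with R hR
      simp only [hΦd, hR]) hr ht
  have hsub : Icc r t ⊆ Ici 0 := Icc_subset_Ici_self.trans (Ici_subset_Ici.2 hr)
  have I0 : IntervalIntegrable (fun s => 2 * (3 / 2 * C) * (∫ x, (1 + x) * f s x ∂ν₊) *
      (∫ x, (1 + x) ^ (α - 1) * f s x ∂ν₊)) volume r t :=
    (((continuousOn_const.mul (h.continuousOn_integral ha (abs_one_add_le hα1))).mul
      (h.continuousOn_integral hb hbb)).mono hsub).intervalIntegrable_of_Icc ht
  have hΦ' : ∀ x : ℝ, 0 < x →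
      |2 * (1 + x) ^ α - L * (1 + x) ^ α + M * (1 + x)| ≤ (2 + L + M) * (1 + x) ^ α := by
    intro x hx
    obtain ⟨R, hR⟩ := (hev x).exists
    have := hΦb R x hx
    simpa only [hΦd, hR] using this
  have I1 := h.intervalIntegrable_integral
    (w := fun x => 2 * (1 + x) ^ α - L * (1 + x) ^ α + M * (1 + x))
    ((((measurable_weight α).const_mul 2).sub ((measurable_weight α).const_mul L)).add
      (ha.const_mul M)) hΦ' hr ht
  rw [h.normL1_eq ht0, h.normL1_eq hr]
  have e1 : 2 * (3 / 2 * C) = 3 * C := by ring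
  rw [← e1, intervalIntegral.integral_add I0 I1]
  refine le_of_tendsto_of_tendsto' T1 (T2.add (tendsto_const_nhds.add T3)) fun R => ?_
  have h1 := hmom R
  rwa [intervalIntegral.integral_add I0
    (h.intervalIntegrable_integral (hΦm R) (hΦb R) hr ht)] at h1

end IsMildSolution

/-- Moments of solutions are bounded uniformly in time and in the kernels. -/
theorem exists_normL1_bound {α : ℝ} (hα : 1 ≤ α) (f₀ : ℝ → ℝ) :
    ∃ Λ : ℝ, 0 ≤ Λ ∧ ∀ (K F : ℝ → ℝ → ℝ) (f : ℝ → ℝ → ℝ), IsKernelPair K F →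
      IsMildSolution K F α f₀ f → NoFlux f → ∀ t, 0 ≤ t → normL1 α (f t) ≤ Λ := by
  have hnn := normL1_nonneg α f₀
  set N := 1 + 3 * normL1 α f₀ with hNdef
  have hN0 : 0 ≤ N := by positivity
  rcases hα.eq_or_lt with rfl | hα'
  -- For α = 1 the dissipation coefficient vanishes, but the norm is M₀ + M₁ itself.
  · refine ⟨N, hN0, fun K F f hk h hN t ht => ?_⟩
    rw [h.normL1_eq ht]
    simp only [Real.rpow_one]
    exact h.integral_one_add_le hk hα hN ht
  set C := α * (2 : ℝ) ^ (α - 1) with hC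
  have hC0 : 0 ≤ C := by positivity
  -- L absorbs the coagulation term 3CN, the 2 from fragmentation, and 1 for the summand Y in the
  -- barrier argument.
  set L := 3 * C * N + 3 with hL
  have hL0 : 0 ≤ L := by positivity
  obtain ⟨M, hM⟩ : ∃ M, M = L * (L / ((α - 1) / (α + 1))) ^ (α - 1) := ⟨_, rfl⟩
  have hc : 0 < (α - 1) / (α + 1) := div_pos (by linarith) (by linarith)
  have hM0 : 0 ≤ M := by rw [hM]; positivity
  refine ⟨max (normL1 α f₀) (M * N), le_max_of_le_left hnn, fun K F f hk h hNF t ht => ?_⟩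
  have ha : Measurable fun x : ℝ => 1 + x := by fun_prop
  have hb : Measurable fun x : ℝ => (1 + x) ^ (α - 1) := measurable_weight _
  have hbb : ∀ x : ℝ, 0 < x → |(1 + x) ^ (α - 1)| ≤ 1 * (1 + x) ^ α := fun x hx => by
    rw [one_mul, abs_of_nonneg (by positivity)]
    exact Real.rpow_le_rpow_of_exponent_le (by linarith) (by linarith)
  have hsplit : ∀ s, 0 ≤ s →
      ∫ x, (2 * (1 + x) ^ α - L * (1 + x) ^ α + M * (1 + x)) * f s x ∂ν₊ =
      (2 - L) * normL1 α (f s) + M * ∫ x, (1 + x) * f s x ∂ν₊ := by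
    intro s hs
    have I1 := ((h.memL1 s hs).integrable_mul (measurable_weight α) (abs_weight_le α)).1
    have I2 := ((h.memL1 s hs).integrable_mul ha (abs_one_add_le hα)).1
    rw [h.normL1_eq hs, ← integral_const_mul, ← integral_const_mul,
      ← integral_add (I1.const_mul _) (I2.const_mul _)]
    congr 1
    funext x
    ring
  have c1 := h.continuousOn_integral ha (abs_one_add_le hα)
  have c2 := h.continuousOn_integral hb hbb
  have c3 := h.continuousOn_normL1
  have key := continuousOn_le_max_of_le_integral (C := M * N)
    (G := fun s => 3 * C * (∫ x, (1 + x) * f s x ∂ν₊) *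
        (∫ x, (1 + x) ^ (α - 1) * f s x ∂ν₊) +
      ((2 - L) * normL1 α (f s) + M * ∫ x, (1 + x) * f s x ∂ν₊)) c3
    (((continuousOn_const.mul c1).mul c2).add
      ((continuousOn_const.mul c3).add (continuousOn_const.mul c1)))
    (fun r t hr hrt => by
      have h1 := h.moment_le_of_one_lt hk hα' hNF hL0 hr hrt hM
      refine h1.trans_eq ?_
      congr 1
      refine intervalIntegral.integral_congr fun s hs => ?_
      rw [uIcc_of_le hrt] at hs
      simp only [hsplit s (hr.trans hs.1)]
      rfl)
    (fun s hs => by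
      have h1 := h.integral_one_add_le hk hα hNF hs
      rw [← hNdef] at h1
      have h2 := h.integral_le_normL1 hb hbb hs
      have h3 := h.integral_nonneg_of_weight (w := fun x => (1 + x) ^ (α - 1))
        (fun x hx => by positivity) hs
      have h4 : 3 * C * (∫ x, (1 + x) * f s x ∂ν₊) * (∫ x, (1 + x) ^ (α - 1) * f s x ∂ν₊) ≤
          3 * C * N * normL1 α (f s) := by gcongr
      have h5 := mul_le_mul_of_nonneg_left h1 hM0
      rw [hL]
      linarith) ht
  rwa [h.normL1_zero] at key

/-! ### Pointwise comparison of the two right-hand sides -/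

theorem ae_intervalIntegrable_coagGain {K : ℝ → ℝ → ℝ} {κ : ℝ} {f g : ℝ → ℝ}
    (hK : Measurable (Function.uncurry K)) (hKb : ∀ x y, 0 < x → 0 < y → |K x y| ≤ κ)
    (hf : Measurable f) (hg : Measurable g) (hfi : Integrable f ν₊) (hgi : Integrable g ν₊) :
    ∀ᵐ x ∂ν₊, IntervalIntegrable (fun y => K (x - y) y * f (x - y) * g y) volume 0 x := by
  have h1 := (integrable_prod_weight (φ := fun _ => 1) (w := fun _ => 1) hK hKb hf hg
    measurable_const zero_le_one (fun x y _ _ => by simp) (by simpa using hfi)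
    (by simpa using hgi)).1
  simp only [one_mul] at h1
  exact ae_intervalIntegrable_conv (H := fun x y => K x y * f x * g y)
    ((hK.mul (hf.comp measurable_fst)).mul (hg.comp measurable_snd)) h1

/-- The difference of two products of a kernel close to `2` and of densities. -/
theorem abs_kernel_mul_sub_le {ε κ a b a' b' : ℝ} (hκ : |κ - 2| ≤ ε) :
    |κ * a * b - 2 * a' * b'| ≤
      2 * (1 * |a - a'| * |b|) + 2 * (1 * |a'| * |b - b'|) + ε * (1 * |a| * |b|) := by
  have e : κ * a * b - 2 * a' * b' =
      2 * ((a - a') * b) + 2 * (a' * (b - b')) + (κ - 2) * (a * b) := by ring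
  rw [e]
  refine (abs_add_le _ _).trans (add_le_add ((abs_add_le _ _).trans (add_le_add ?_ ?_)) ?_)
  · rw [abs_mul, abs_mul, abs_two, one_mul]
  · rw [abs_mul, abs_mul, abs_two, one_mul]
  · rw [abs_mul, abs_mul, one_mul]
    exact mul_le_mul_of_nonneg_right hκ (by positivity)

theorem ae_abs_coagGain_sub_le {K : ℝ → ℝ → ℝ} {κ ε : ℝ} {f k : ℝ → ℝ}
    (hK : Measurable (Function.uncurry K)) (hKb : ∀ x y, 0 < x → 0 < y → |K x y| ≤ κ)
    (hKε : ∀ x y, 0 < x → 0 < y → |K x y - 2| ≤ ε)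
    (hf : Measurable f) (hk : Measurable k) (hfi : Integrable f ν₊) (hki : Integrable k ν₊) :
    ∀ᵐ x ∂ν₊, |coagGain K f f x - coagGain (fun _ _ => 2) k k x| ≤
      2 * coagGain (fun _ _ => 1) (fun x => |f x - k x|) (fun x => |f x|) x +
      2 * coagGain (fun _ _ => 1) (fun x => |k x|) (fun x => |f x - k x|) x +
      ε * coagGain (fun _ _ => 1) (fun x => |f x|) (fun x => |f x|) x := by
  have hg : Measurable fun x => |f x - k x| := (hf.sub hk).abs
  have hgi : Integrable (fun x => |f x - k x|) ν₊ := (hfi.sub hki).abs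
  have m1 : Measurable (Function.uncurry fun _ _ : ℝ => (1 : ℝ)) := measurable_const
  have b1 : ∀ x y : ℝ, 0 < x → 0 < y → |(1 : ℝ)| ≤ 1 := fun _ _ _ _ => abs_one.le
  filter_upwards [ae_intervalIntegrable_coagGain hK hKb hf hf hfi hfi,
    ae_intervalIntegrable_coagGain (K := fun _ _ => 2) (κ := 2) measurable_const
      (fun _ _ _ _ => abs_two.le) hk hk hki hki,
    ae_intervalIntegrable_coagGain m1 b1 hg hf.abs hgi hfi.abs,
    ae_intervalIntegrable_coagGain m1 b1 hk.abs hg hki.abs hgi,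
    ae_intervalIntegrable_coagGain m1 b1 hf.abs hf.abs hfi.abs hfi.abs,
    ae_restrict_mem measurableSet_Ioi] with x i1 i2 i3 i4 i5 hx
  have hx0 : (0 : ℝ) ≤ x := le_of_lt hx
  simp only [coagGain]
  rw [← intervalIntegral.integral_sub i1 i2, ← intervalIntegral.integral_const_mul,
    ← intervalIntegral.integral_const_mul, ← intervalIntegral.integral_const_mul,
    ← intervalIntegral.integral_add (i3.const_mul 2) (i4.const_mul 2),
    ← intervalIntegral.integral_add ((i3.const_mul 2).add (i4.const_mul 2)) (i5.const_mul ε)]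
  refine (intervalIntegral.abs_integral_le_integral_abs hx0).trans ?_
  refine intervalIntegral.integral_mono_on_of_le_Ioo hx0 (i1.sub i2).abs
    (((i3.const_mul 2).add (i4.const_mul 2)).add (i5.const_mul ε)) fun y hy => ?_
  exact abs_kernel_mul_sub_le (hKε _ _ (sub_pos.2 hy.2) hy.1)

theorem ae_abs_coagLoss_sub_le {K : ℝ → ℝ → ℝ} {κ ε : ℝ} {f k : ℝ → ℝ}
    (hK : Measurable (Function.uncurry K)) (hKb : ∀ x y, 0 < x → 0 < y → |K x y| ≤ κ)
    (hKε : ∀ x y, 0 < x → 0 < y → |K x y - 2| ≤ ε)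
    (hfi : Integrable f ν₊) (hki : Integrable k ν₊) :
    ∀ᵐ x ∂ν₊, |f x * (∫ y in Ioi (0 : ℝ), K x y * f y) -
        k x * (∫ y in Ioi (0 : ℝ), (2 : ℝ) * k y)| ≤
      2 * (|f x - k x| * ∫ y, |f y| ∂ν₊) + 2 * (|k x| * ∫ y, |f y - k y| ∂ν₊) +
        ε * (|f x| * ∫ y, |f y| ∂ν₊) := by
  filter_upwards [ae_restrict_mem measurableSet_Ioi] with x hx
  have hgi : Integrable (fun x => |f x - k x|) ν₊ := (hfi.sub hki).abs
  have i1 : Integrable (fun y => K x y * f y) ν₊ := by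
    refine hfi.bdd_mul (c := κ) (hK.comp measurable_prodMk_left).aestronglyMeasurable ?_
    filter_upwards [ae_restrict_mem measurableSet_Ioi] with y hy using hKb x y hx hy
  have i1' := i1.const_mul (f x)
  have i2' := (hki.const_mul 2).const_mul (k x)
  have j1 := hfi.abs.const_mul (2 * |f x - k x|)
  have j2 := hgi.const_mul (2 * |k x|)
  have j3 := hfi.abs.const_mul (ε * |f x|)
  have e1 : 2 * (|f x - k x| * ∫ y, |f y| ∂ν₊) + 2 * (|k x| * ∫ y, |f y - k y| ∂ν₊) +
        ε * (|f x| * ∫ y, |f y| ∂ν₊) = ∫ y, (2 * |f x - k x| * |f y| +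
          2 * |k x| * |f y - k y| + ε * |f x| * |f y|) ∂ν₊ := by
    obtain ⟨-, e⟩ := integral_lincomb_four (2 * |f x - k x|) (2 * |k x|) (ε * |f x|) 0
      hfi.abs hgi hfi.abs hfi.abs
    simp only [zero_mul, add_zero] at e
    rw [e]
    ring
  rw [e1, ← integral_const_mul, ← integral_const_mul, ← integral_sub i1' i2']
  refine abs_integral_le_integral_abs.trans
    (integral_mono_ae (i1'.sub i2').abs ((j1.add j2).add j3) ?_)
  filter_upwards [ae_restrict_mem measurableSet_Ioi] with y hy
  have := abs_kernel_mul_sub_le (a := f x) (b := f y) (a' := k x) (b' := k y) (hKε x y hx hy)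
  refine le_trans (le_of_eq ?_) (this.trans (le_of_eq ?_))
  · congr 1; ring
  · ring

theorem MemL1.ae_integrable_frag {α : ℝ} (hα : 1 ≤ α) {F : ℝ → ℝ → ℝ} {a b : ℝ} {f : ℝ → ℝ}
    (hF : Measurable (Function.uncurry F)) (ha : 0 ≤ a) (hb : 0 ≤ b)
    (hFb : ∀ x y, 0 < x → 0 < y → |F x y| ≤ a + b / (x + y)) (hf : Measurable f)
    (hfi : MemL1 α f) : ∀ᵐ x ∂ν₊, Integrable (fun y => F x y * f (x + y)) ν₊ := by
  have hm : Measurable fun z : ℝ => a * z + b := by fun_prop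
  have h1 := (hfi.integrable_mul (C := a + b) hm fun x hx => by
    rw [abs_of_nonneg (by positivity)]
    have := one_le_weight hα hx
    nlinarith).1.abs
  have h2 : Integrable (fun z => (a * z + b) * |f z|) ν₊ := by
    refine h1.congr ?_
    filter_upwards [ae_restrict_mem measurableSet_Ioi] with x hx
    have : (0 : ℝ) < x := hx
    rw [abs_mul, abs_of_nonneg (by positivity)]
  have h3 := (integrable_mul_fragGain (w := fun _ => 1) hF hf measurable_const
    (fun z hz => by simpa using (integral_abs_fragKernel_le hF hFb hz).1)
    (fun z hz => by simpa using (integral_abs_fragKernel_le hF hFb hz).2) h2).2.2.2.2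
  filter_upwards [h3] with x hx
  simpa only [one_mul, add_comm x] using hx

theorem MemL1.ae_abs_fragGain_sub_le {α : ℝ} (hα : 1 ≤ α) {V : ℝ → ℝ → ℝ} {ε : ℝ} (hε : 0 ≤ ε)
    (hV : Measurable (Function.uncurry V))
    (hVb : ∀ x y, 0 < x → 0 < y → 0 ≤ V x y ∧ V x y ≤ 1 / (x + y)) {f k : ℝ → ℝ}
    (hf : Measurable f) (hk : Measurable k) (hfi : MemL1 α f) (hki : MemL1 α k) :
    ∀ᵐ x ∂ν₊, |fragGain (pertKernel ε V) f x - fragGain (fun _ _ => 2) k x| ≤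
      fragGain (fun _ _ => 2) (fun x => |f x - k x|) x + ε * fragGain V (fun x => |f x|) x := by
  have h2b : ∀ x y : ℝ, 0 < x → 0 < y → |(2 : ℝ)| ≤ 2 + 0 / (x + y) := by simp
  have hVb' : ∀ x y, 0 < x → 0 < y → |V x y| ≤ 0 + 1 / (x + y) := fun x y hx hy => by
    rw [abs_of_nonneg (hVb x y hx hy).1, zero_add]
    exact (hVb x y hx hy).2
  filter_upwards [hfi.ae_integrable_frag hα (F := fun _ _ => 2) measurable_const zero_le_two
      le_rfl h2b hf,
    hki.ae_integrable_frag hα (F := fun _ _ => 2) measurable_const zero_le_two le_rfl h2b hk,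
    hfi.ae_integrable_frag hα hV le_rfl zero_le_one hVb' hf,
    ae_restrict_mem measurableSet_Ioi] with x i1 i2 i3 hx
  have hx0 : (0 : ℝ) < x := hx
  have e1 : Integrable (fun y => pertKernel ε V x y * f (x + y)) ν₊ := by
    refine (i1.add (i3.const_mul ε)).congr (Eventually.of_forall fun y => ?_)
    simp only [Pi.add_apply, pertKernel]
    ring
  have e2 : Integrable (fun y => 2 * |f (x + y) - k (x + y)|) ν₊ := by
    refine (i1.sub i2).abs.congr (Eventually.of_forall fun y => ?_)
    simp only [Pi.sub_apply, ← mul_sub, abs_mul, abs_two]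
  have e3 : Integrable (fun y => V x y * |f (x + y)|) ν₊ := by
    refine i3.abs.congr ?_
    filter_upwards [ae_restrict_mem measurableSet_Ioi] with y hy
    rw [abs_mul, abs_of_nonneg (hVb x y hx0 hy).1]
  simp only [fragGain]
  rw [← integral_sub e1 i2, ← integral_const_mul, ← integral_add e2 (e3.const_mul ε)]
  refine abs_integral_le_integral_abs.trans
    (integral_mono_ae (e1.sub i2).abs (e2.add (e3.const_mul ε)) ?_)
  filter_upwards [ae_restrict_mem measurableSet_Ioi] with y hy
  simp only [pertKernel]
  have e : (2 + ε * V x y) * f (x + y) - 2 * k (x + y) =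
      2 * (f (x + y) - k (x + y)) + ε * (V x y * f (x + y)) := by ring
  rw [e]
  refine (abs_add_le _ _).trans (add_le_add ?_ ?_)
  · rw [abs_mul, abs_two]
  · rw [abs_mul, abs_mul, abs_of_nonneg hε, abs_of_nonneg (hVb x y hx0 hy).1]

theorem isKernelPair_two : IsKernelPair (fun _ _ => 2) (fun _ _ => 2) where
  measurable_K := measurable_const
  measurable_F := measurable_const
  symm_K _ _ _ _ := rfl
  symm_F _ _ _ _ := rfl
  bound_K _ _ _ _ := by norm_num
  bound_F x y hx hy := ⟨le_rfl, by
    have : 0 ≤ 1 / (x + y) := by positivity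
    linarith⟩

theorem MemL1.abs {α : ℝ} {g : ℝ → ℝ} (hg : MemL1 α g) : MemL1 α (fun x => |g x|) := by
  refine ⟨hg.1.abs, ?_⟩
  simp only [abs_abs]
  exact hg.2

theorem normL1_abs (α : ℝ) (g : ℝ → ℝ) : normL1 α (fun x => |g x|) = normL1 α g := by
  simp only [normL1, abs_abs]

theorem sign_mul_self_eq_abs (r : ℝ) : Real.sign r * r = |r| := by
  rcases lt_trichotomy r 0 with h | h | h
  · rw [Real.sign_of_neg h, abs_of_neg h, neg_one_mul]
  · rw [h, mul_zero, abs_zero]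
  · rw [Real.sign_of_pos h, abs_of_pos h, one_mul]

/-- Every term is estimated by its absolute value except the loss by the constant fragmentation
kernel, which multiplication by the sign turns into exactly −x|f − k|. The result is grouped as
constant-kernel fragmentation of |f − k|, remaining gain terms, and remaining loss terms. -/
theorem ae_sign_mul_rhs_sub_le {W V : ℝ → ℝ → ℝ} (hWV : IsAdmissible W V) {ε : ℝ} (h0 : 0 ≤ ε)
    (h1 : ε ≤ 1) {α : ℝ} (hα : 1 ≤ α) {f k : ℝ → ℝ} (hf : Measurable f) (hk : Measurable k)
    (hfi : MemL1 α f) (hki : MemL1 α k) :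
    ∀ᵐ x ∂ν₊, Real.sign (f x - k x) *
      ((coag (pertKernel ε W) f f x + frag (pertKernel ε V) f x) -
        (coag (fun _ _ => 2) k k x + frag (fun _ _ => 2) k x)) ≤
      (fragGain (fun _ _ => 2) (fun x => |f x - k x|) x - x * |f x - k x|) +
      (ε * fragGain V (fun x => |f x|) x +
        1 * coagGain (fun _ _ => 1) (fun x => |f x - k x|) (fun x => |f x|) x +
        1 * coagGain (fun _ _ => 1) (fun x => |k x|) (fun x => |f x - k x|) x +
        ε / 2 * coagGain (fun _ _ => 1) (fun x => |f x|) (fun x => |f x|) x) +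
      (2 * (∫ y, |f y| ∂ν₊) * |f x - k x| + 2 * (∫ y, |f y - k y| ∂ν₊) * |k x| +
        (ε * (∫ y, |f y| ∂ν₊) + ε / 2) * |f x| + 0 * |f x|) := by
  have hp := hWV.isKernelPair h0 h1
  have hKε : ∀ x y, 0 < x → 0 < y → |pertKernel ε W x y - 2| ≤ ε := by
    intro x y hx hy
    obtain ⟨w0, w1⟩ := hWV.bound_W x y hx hy
    simp only [pertKernel, add_sub_cancel_left]
    rw [abs_of_nonneg (mul_nonneg h0 w0)]
    exact mul_le_of_le_one_right h0 w1
  have hVb' : ∀ x y, 0 < x → 0 < y → |V x y| ≤ 0 + 1 / (x + y) := fun x y hx hy => by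
    rw [abs_of_nonneg (hWV.bound_V x y hx hy).1, zero_add]
    exact (hWV.bound_V x y hx hy).2
  filter_upwards [ae_abs_coagGain_sub_le hp.measurable_K hp.abs_K_le hKε hf hk hfi.1 hki.1,
    ae_abs_coagLoss_sub_le hp.measurable_K hp.abs_K_le hKε hfi.1 hki.1,
    hfi.ae_abs_fragGain_sub_le hα h0 hWV.measurable_V hWV.bound_V hf hk hki,
    ae_restrict_mem measurableSet_Ioi] with x c1 c2 c3 hx
  have hx0 : (0 : ℝ) < x := hx
  obtain ⟨v1, v2⟩ := integral_abs_fragKernel_le hWV.measurable_V hVb' hx0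
  rw [zero_mul, zero_add] at v2
  have v3 := (intervalIntegral.abs_integral_le_integral_abs hx0.le).trans v2
  have e1 : ∫ y in (0 : ℝ)..x, pertKernel ε V y (x - y) =
      2 * x + ε * ∫ y in (0 : ℝ)..x, V y (x - y) := by
    simp only [pertKernel]
    rw [intervalIntegral.integral_add intervalIntegrable_const (v1.const_mul ε),
      intervalIntegral.integral_const_mul, intervalIntegral.integral_const, smul_eq_mul]
    ring
  rw [coag_add_frag_eq, coag_add_frag_eq, e1, intervalIntegral.integral_const, smul_eq_mul]
  set v := ∫ y in (0 : ℝ)..x, V y (x - y) with hv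
  set σ := Real.sign (f x - k x) with hσ
  have hσ1 : |σ| ≤ 1 := abs_sign_le_one _
  have hσ2 : σ * (f x - k x) = |f x - k x| := sign_mul_self_eq_abs _
  have hle : ∀ A C : ℝ, |A| ≤ C → σ * A ≤ C := fun A C hA =>
    (le_abs_self _).trans (by
      rw [abs_mul]
      exact (mul_le_of_le_one_left (abs_nonneg _) hσ1).trans hA)
  have d1 := hle _ _ c1
  have d2 := hle _ _ ((abs_neg _).le.trans c2)
  have d3 := hle _ _ c3
  have d4 : σ * -(ε / 2 * (v * f x)) ≤ ε / 2 * |f x| := by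
    refine hle _ _ ?_
    rw [abs_neg, abs_mul, abs_mul, abs_of_nonneg (by linarith : 0 ≤ ε / 2)]
    refine mul_le_mul_of_nonneg_left ?_ (by linarith)
    exact mul_le_of_le_one_left (abs_nonneg _) v3
  have d5 : σ * (x * (f x - k x)) = x * |f x - k x| := by rw [← hσ2]; ring
  linarith

/-! ### Integrated estimates for the difference -/

/-- Gain and loss are recombined under a single integral in z before estimating, so that their
cancellation is used. Only g ≥ 0 matters; g need not solve any equation. -/
theorem integral_mul_fragGain_two_sub_le {α : ℝ} (hα : 1 ≤ α) {g φ : ℝ → ℝ} {B R : ℝ}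
    (hg : Measurable g) (hgi : MemL1 α g) (hg0 : ∀ x, 0 ≤ g x) (hφ : IsWeight φ B)
    (hΦ : ∀ z, 0 < z → 2 * (∫ y in (0 : ℝ)..z, φ y) - z * φ z + φ z ≤ 2 * (1 + z) ^ α)
    (hR : 0 < R) :
    Integrable (fun x => indicator (Iic R) φ x *
      (fragGain (fun _ _ => 2) g x - x * g x)) ν₊ ∧
    ∫ x, indicator (Iic R) φ x * (fragGain (fun _ _ => 2) g x - x * g x) ∂ν₊ ≤
      2 * normL1 α g + (3 * B * (∫ x, fluxWeight R x * g x ∂ν₊) +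
        ∫ x, indicator (Ioi R) (fun x => |2 * (1 + x) ^ α|) x * g x ∂ν₊) := by
  have ht := hφ.isTest_indicator hR.le
  set ψ := indicator (Iic R) φ with hψ
  have hslice := fun z (hz : 0 < z) =>
    integral_abs_le_of_bounded_support ht.measurable ht.R_nonneg ht.bound ht.support hz
  obtain ⟨q1, q2, -, q4, -⟩ := integrable_mul_fragGain (F := fun _ _ => (2 : ℝ)) (w := ψ)
    (f := g) (m := fun _ => 2 * (B * (1 + R) * R)) measurable_const hg
    ht.measurable (fun z hz => (hslice z hz).1.mul_const 2) (fun z hz => by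
      simp only [abs_mul, abs_two, intervalIntegral.integral_mul_const]
      rw [mul_comm]
      refine mul_le_mul_of_nonneg_left ((hslice z hz).2.trans ?_) zero_le_two
      exact mul_le_mul_of_nonneg_left (min_le_right _ _) ht.B_nonneg) (hgi.1.abs.const_mul _)
  have hxm : Measurable fun x => ψ x * x := ht.measurable.mul measurable_id
  have hxb : ∀ x, 0 < x → |ψ x * x| ≤ (B * (1 + R) * R) * (1 + x) ^ α := by
    intro x hx
    have h2 := one_le_weight hα hx
    rcases le_or_gt x R with hxR | hxR
    · rw [abs_mul, abs_of_pos hx]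
      calc |ψ x| * x ≤ B * (1 + R) * R :=
            mul_le_mul (ht.bound x hx) hxR hx.le ht.B_nonneg
        _ ≤ _ := le_mul_of_one_le_right (mul_nonneg ht.B_nonneg hR.le) (by linarith)
    · rw [ht.support x hxR, zero_mul, abs_zero]
      exact mul_nonneg (mul_nonneg ht.B_nonneg hR.le) (by linarith)
  have q5 := (hgi.integrable_mul hxm hxb).1
  have iΦ := hgi.integrable_mul (w := fun x => 2 * (1 + x) ^ α) (C := 2)
    ((measurable_weight α).const_mul 2) (fun x hx => by
      rw [abs_of_nonneg (by positivity)])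
  have iF := (hgi.integrable_mul (measurable_fluxWeight R) (fluxWeight_bound hα R)).1
  have iΦ' := (hgi.integrable_mul (w := indicator (Ioi R) (fun x => |2 * (1 + x) ^ α|)) (C := 2)
    (((measurable_weight α).const_mul 2).abs.indicator measurableSet_Ioi)
    (abs_indicator_Ioi_le (fun x hx => by rw [abs_abs, abs_of_nonneg (by positivity)]) R)).1
  obtain ⟨l1, l2⟩ := integral_lincomb_four 1 (3 * B) 1 0 iΦ.1 iF iΦ' iF
  have heq : ∀ x, ψ x * (fragGain (fun _ _ => 2) g x - x * g x) =
      ψ x * fragGain (fun _ _ => 2) g x - ψ x * x * g x := fun x => by ring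
  simp only [heq]
  refine ⟨q1.sub q5, ?_⟩
  rw [integral_sub q1 q5, q2, ← integral_sub q4 q5]
  have e2 : ∫ x, 2 * (1 + x) ^ α * g x ∂ν₊ ≤ 2 * normL1 α g :=
    ((le_abs_self _).trans abs_integral_le_integral_abs).trans iΦ.2
  refine (integral_mono_ae (q4.sub q5) l1 ?_).trans ?_
  · filter_upwards [ae_restrict_mem measurableSet_Ioi] with z hz
    have hz0 : (0 : ℝ) < z := hz
    have m1 := mul_le_mul_of_nonneg_left
      (isKernelPair_two.weight_frag_le hφ hΦ hR hz0) (hg0 z)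
    simp only [intervalIntegral.integral_const, smul_eq_mul, sub_zero] at m1
    simp only [Pi.sub_apply]
    linarith
  · rw [l2]
    linarith

theorem integral_mul_coagGain_one_le {α : ℝ} (hα : 1 ≤ α) {ψ u v : ℝ → ℝ} (hψ : Measurable ψ)
    (hψα : ∀ x, 0 < x → |ψ x| ≤ 1 * (1 + x) ^ α)
    (hu : Measurable u) (hv : Measurable v) (hui : MemL1 α u) (hvi : MemL1 α v) :
    Integrable (fun x => ψ x * coagGain (fun _ _ => 1) (fun x => |u x|) (fun x => |v x|) x) ν₊ ∧
      ∫ x, ψ x * coagGain (fun _ _ => 1) (fun x => |u x|) (fun x => |v x|) x ∂ν₊ ≤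
        normL1 α u * normL1 α v := by
  have hw : ∀ x y, 0 < x → 0 < y → |ψ (x + y)| ≤ 1 * ((1 + x) ^ α * (1 + y) ^ α) := by
    intro x y hx hy
    refine (hψα _ (add_pos hx hy)).trans ?_
    rw [← Real.mul_rpow (by linarith) (by linarith)]
    refine mul_le_mul_of_nonneg_left (Real.rpow_le_rpow (by linarith) ?_ (by linarith))
      zero_le_one
    nlinarith [mul_pos hx hy]
  obtain ⟨g1, -, g3⟩ := integrable_mul_coagGain (K := fun _ _ => 1) (κ := 1)
    (φ := fun x => (1 + x) ^ α) measurable_const (fun _ _ _ _ => abs_one.le) hu.abs hv.abs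
    hψ zero_le_one hw hui.2 hvi.2
  refine ⟨g1, ((le_abs_self _).trans abs_integral_le_integral_abs).trans (g3.trans_eq ?_)⟩
  have habs : ∀ u : ℝ → ℝ, ∫ x, |(1 + x) ^ α * (|u x|)| ∂ν₊ = normL1 α u := by
    intro u
    refine setIntegral_congr_fun measurableSet_Ioi fun x hx => ?_
    have : (0 : ℝ) < x := hx
    exact abs_of_nonneg (by positivity)
  rw [habs u, habs v]
  ring

/-- The factor 1/z from V cancels the length of (0, z), over which ψ is at most (1+z)^α; hence the
gain by V is bounded on L¹_α. -/
theorem integral_mul_fragGain_pert_le {α : ℝ} (hα : 1 ≤ α) {V : ℝ → ℝ → ℝ}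
    (hV : Measurable (Function.uncurry V))
    (hVb : ∀ x y, 0 < x → 0 < y → |V x y| ≤ 0 + 1 / (x + y)) {ψ f : ℝ → ℝ} {B R : ℝ}
    (ht : IsTest ψ B R) (hψα : ∀ x, 0 < x → |ψ x| ≤ 1 * (1 + x) ^ α)
    (hf : Measurable f) (hfi : MemL1 α f) :
    Integrable (fun x => ψ x * fragGain V (fun x => |f x|) x) ν₊ ∧
      ∫ x, ψ x * fragGain V (fun x => |f x|) x ∂ν₊ ≤ normL1 α f := by
  obtain ⟨p1, -, p3, -⟩ := integrable_mul_fragGain (F := V) (w := ψ)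
    (f := fun x => |f x|) (m := fun z => (1 + z) ^ α) hV hf.abs ht.measurable
    (fun z hz => (integral_abs_fragSlice_le hV hVb ht.measurable hz
      (ht.intervalIntegrable hz)).1)
    (fun z hz => by
      refine (integral_abs_fragSlice_le hV hVb ht.measurable hz
        (ht.intervalIntegrable hz)).2.trans ?_
      have m1 : ∫ y in (0 : ℝ)..z, |ψ y| ≤ ∫ y in (0 : ℝ)..z, (1 + z) ^ α := by
        refine intervalIntegral.integral_mono_on_of_le_Ioo hz.le (ht.intervalIntegrable hz).abs
          intervalIntegrable_const fun y hy => ?_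
        refine (hψα y hy.1).trans ?_
        rw [one_mul]
        exact Real.rpow_le_rpow (by linarith [hy.1]) (by linarith [hy.2]) (by linarith)
      rw [intervalIntegral.integral_const, smul_eq_mul, sub_zero] at m1
      calc (0 + 1 / z) * ∫ y in (0 : ℝ)..z, |ψ y| ≤ (0 + 1 / z) * (z * (1 + z) ^ α) :=
            mul_le_mul_of_nonneg_left m1 (by positivity)
        _ = (1 + z) ^ α := by field_simp; ring) hfi.abs.2
  refine ⟨p1, ((le_abs_self _).trans abs_integral_le_integral_abs).trans (p3.trans_eq ?_)⟩
  simp only [abs_abs]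
  rfl

-- In the rate 2 + 6Λ, the 2 comes from constant-kernel fragmentation, 2Λ from the coagulation gain
-- and 4Λ from its loss. The terms with ε add up to at most ε(3/2)(Λ + Λ²).
set_option maxHeartbeats 1000000 in
theorem integral_sign_mul_rhs_sub_le {W V : ℝ → ℝ → ℝ} (hWV : IsAdmissible W V) {ε : ℝ}
    (h0 : 0 ≤ ε) (h1 : ε ≤ 1) {α : ℝ} (hα : 1 ≤ α) {f k φ : ℝ → ℝ} {B Λ R : ℝ}
    (hf : Measurable f) (hk : Measurable k) (hfi : MemL1 α f) (hki : MemL1 α k)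
    (hfΛ : normL1 α f ≤ Λ) (hkΛ : normL1 α k ≤ Λ) (hφ : IsWeight φ B)
    (hφα : ∀ x, 0 < x → φ x ≤ (1 + x) ^ α)
    (hΦ : ∀ z, 0 < z → 2 * (∫ y in (0 : ℝ)..z, φ y) - z * φ z + φ z ≤ 2 * (1 + z) ^ α)
    (hR : 0 < R) :
    ∫ x, indicator (Iic R) φ x * (Real.sign (f x - k x) *
      ((coag (pertKernel ε W) f f x + frag (pertKernel ε V) f x) -
        (coag (fun _ _ => 2) k k x + frag (fun _ _ => 2) k x))) ∂ν₊ ≤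
      (2 + 6 * Λ) * normL1 α (fun x => f x - k x) + ε * (2 * Λ + 2 * Λ ^ 2) +
      (3 * B * (∫ x, fluxWeight R x * |f x - k x| ∂ν₊) +
        ∫ x, indicator (Ioi R) (fun x => |2 * (1 + x) ^ α|) x * |f x - k x| ∂ν₊) := by
  have hp := hWV.isKernelPair h0 h1
  have ht := hφ.isTest_indicator hR.le
  set ψ := indicator (Iic R) φ with hψ
  have hψ0 : ∀ x, 0 < x → 0 ≤ ψ x := fun x hx => indicator_apply_nonneg fun _ => hφ.nonneg x hx
  have hψα : ∀ x, 0 < x → ψ x ≤ (1 + x) ^ α := fun x hx =>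
    indicator_apply_le' (fun _ => hφα x hx) fun _ => by positivity
  have hψabs : ∀ x, 0 < x → |ψ x| ≤ 1 * (1 + x) ^ α := fun x hx => by
    rw [abs_of_nonneg (hψ0 x hx), one_mul]
    exact hψα x hx
  have hg : Measurable fun x => |f x - k x| := (hf.sub hk).abs
  have hgi : MemL1 α (fun x => |f x - k x|) := (hfi.sub hki).abs
  have hgN : normL1 α (fun x => |f x - k x|) = normL1 α (fun x => f x - k x) := normL1_abs _ _
  set Ng := normL1 α (fun x => f x - k x) with hNg
  have hNg0 : 0 ≤ Ng := normL1_nonneg _ _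
  have hNf0 : 0 ≤ normL1 α f := normL1_nonneg _ _
  have hNk0 : 0 ≤ normL1 α k := normL1_nonneg _ _
  have hΛ0 : 0 ≤ Λ := hNf0.trans hfΛ
  have hI : Integrable (fun x => ψ x * (Real.sign (f x - k x) *
      ((coag (pertKernel ε W) f f x + frag (pertKernel ε V) f x) -
        (coag (fun _ _ => 2) k k x + frag (fun _ _ => 2) k x)))) ν₊ := by
    have i1 := (hp.weak_form hf hfi.1 ht.measurable ht.B_nonneg ht.R_nonneg ht.bound ht.support).1
    have i2 := (isKernelPair_two.weak_form hk hki.1 ht.measurable ht.B_nonneg ht.R_nonneg ht.bound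
      ht.support).1
    refine ((i1.sub i2).bdd_mul (c := 1)
      (measurable_sign_real.comp (hf.sub hk)).aestronglyMeasurable
      (Eventually.of_forall fun x => abs_sign_le_one _)).congr (Eventually.of_forall fun x => ?_)
    simp only [Function.comp, Pi.sub_apply]
    ring
  obtain ⟨iA, hA⟩ := integral_mul_fragGain_two_sub_le hα hg hgi (fun x => abs_nonneg _) hφ hΦ hR
  rw [hgN] at hA
  have hVb' : ∀ x y, 0 < x → 0 < y → |V x y| ≤ 0 + 1 / (x + y) := fun x y hx hy => by
    rw [abs_of_nonneg (hWV.bound_V x y hx hy).1, zero_add]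
    exact (hWV.bound_V x y hx hy).2
  obtain ⟨p1, p3⟩ := integral_mul_fragGain_pert_le hα hWV.measurable_V hVb' ht hψabs hf hfi
  have hcg := fun u v hu hv hui hvi => integral_mul_coagGain_one_le hα ht.measurable hψabs
    (u := u) (v := v) hu hv hui hvi
  obtain ⟨g1, g1'⟩ := hcg (fun x => f x - k x) f (hf.sub hk) hf (hfi.sub hki) hfi
  obtain ⟨g2, g2'⟩ := hcg k (fun x => f x - k x) hk (hf.sub hk) hki (hfi.sub hki)
  obtain ⟨g3, g3'⟩ := hcg f f hf hf hfi hfi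
  obtain ⟨r1, r1'⟩ := hgi.integrable_mul ht.measurable hψabs
  obtain ⟨r2, r2'⟩ := hki.abs.integrable_mul ht.measurable hψabs
  obtain ⟨r3, r3'⟩ := hfi.abs.integrable_mul ht.measurable hψabs
  obtain ⟨s1, s2⟩ := integral_lincomb_four ε 1 1 (ε / 2) p1 g1 g2 g3
  obtain ⟨t1, t2⟩ := integral_lincomb_four (2 * ∫ y, |f y| ∂ν₊) (2 * ∫ y, |f y - k y| ∂ν₊)
    (ε * (∫ y, |f y| ∂ν₊) + ε / 2) 0 r1 r2 r3 r3
  obtain ⟨z1, z2⟩ := integral_lincomb_four 1 1 1 0 iA s1 t1 t1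
  have hfin := integral_mono_ae hI z1 (by
    filter_upwards [ae_sign_mul_rhs_sub_le hWV h0 h1 hα hf hk hfi hki,
      ae_restrict_mem measurableSet_Ioi] with x hx hx0
    refine (mul_le_mul_of_nonneg_left hx (hψ0 x hx0)).trans (le_of_eq ?_)
    ring)
  rw [z2, s2, t2] at hfin
  have hL1 : ∀ u : ℝ → ℝ, MemL1 α u → ∫ y, |u y| ∂ν₊ ≤ normL1 α u := by
    intro u hu
    simpa using (hu.integrable_mul (w := fun _ => 1) measurable_const (abs_one_le hα)).2
  have n1 := hL1 f hfi
  have n2 := hL1 _ (hfi.sub hki)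
  have n3 : 0 ≤ ∫ y, |f y| ∂ν₊ := integral_nonneg fun _ => abs_nonneg _
  have n4 : 0 ≤ ∫ y, |f y - k y| ∂ν₊ := integral_nonneg fun _ => abs_nonneg _
  rw [one_mul, hgN] at r1'
  rw [one_mul, normL1_abs] at r2' r3'
  have r1'' := ((le_abs_self _).trans abs_integral_le_integral_abs).trans r1'
  have r2'' := ((le_abs_self _).trans abs_integral_le_integral_abs).trans (r2'.trans hkΛ)
  have r3'' := ((le_abs_self _).trans abs_integral_le_integral_abs).trans (r3'.trans hfΛ)
  have p3' := p3.trans hfΛ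
  have u1 : normL1 α (fun x => f x - k x) * normL1 α f ≤ Ng * Λ :=
    mul_le_mul_of_nonneg_left hfΛ hNg0
  have u2 : normL1 α k * normL1 α (fun x => f x - k x) ≤ Λ * Ng :=
    mul_le_mul_of_nonneg_right hkΛ hNg0
  have u3 : normL1 α f * normL1 α f ≤ Λ * Λ := mul_le_mul hfΛ hfΛ hNf0 hΛ0
  have w1 := mul_le_mul_of_nonneg_left p3' h0
  have w2 := mul_le_mul_of_nonneg_left (g3'.trans u3) (by linarith : 0 ≤ ε / 2)
  have w3 : 2 * (∫ y, |f y| ∂ν₊) * ∫ x, ψ x * |f x - k x| ∂ν₊ ≤ 2 * Λ * Ng :=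
    (mul_le_mul_of_nonneg_left r1'' (by positivity)).trans
      (mul_le_mul_of_nonneg_right (by linarith) hNg0)
  have w4 : 2 * (∫ y, |f y - k y| ∂ν₊) * ∫ x, ψ x * |k x| ∂ν₊ ≤ 2 * Ng * Λ :=
    (mul_le_mul_of_nonneg_left r2'' (by positivity)).trans
      (mul_le_mul_of_nonneg_right (by linarith) hΛ0)
  have w5 : (ε * (∫ y, |f y| ∂ν₊) + ε / 2) * ∫ x, ψ x * |f x| ∂ν₊ ≤ (ε * Λ + ε / 2) * Λ := by
    refine (mul_le_mul_of_nonneg_left r3'' (by positivity)).trans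
      (mul_le_mul_of_nonneg_right ?_ hΛ0)
    have := mul_le_mul_of_nonneg_left (n1.trans hfΛ) h0
    linarith
  have w6 : 0 ≤ ε * Λ := mul_nonneg h0 hΛ0
  have w7 : 0 ≤ ε * Λ * Λ := mul_nonneg w6 hΛ0
  nlinarith

theorem IsMildSolution.noFlux {K F : ℝ → ℝ → ℝ} {α : ℝ} {f₀ : ℝ → ℝ} {f : ℝ → ℝ → ℝ}
    (h : IsMildSolution K F α f₀ f) (hk : IsKernelPair K F) (hα : 1 ≤ α)
    (hM : α < 2 → ConservesMass f₀ f) : NoFlux f := by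
  rcases lt_or_ge α 2 with h2 | h2
  · exact h.noFlux_of_conservesMass hk hα (hM h2)
  · exact h.noFlux_of_two_le h2

/-- Transfers smallness of tails and fluxes from the two nonnegative solutions to their difference.
-/
theorem integral_mul_abs_sub_le_add {α C : ℝ} {f k w : ℝ → ℝ} (hfi : MemL1 α f)
    (hki : MemL1 α k) (hf0 : ∀ᵐ x ∂ν₊, 0 ≤ f x) (hk0 : ∀ᵐ x ∂ν₊, 0 ≤ k x) (hw : Measurable w)
    (hwb : ∀ x, 0 < x → |w x| ≤ C * (1 + x) ^ α) (hw0 : ∀ x, 0 < x → 0 ≤ w x) :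
    ∫ x, w x * |f x - k x| ∂ν₊ ≤ (∫ x, w x * f x ∂ν₊) + ∫ x, w x * k x ∂ν₊ := by
  have i1 := (hfi.integrable_mul hw hwb).1
  have i2 := (hki.integrable_mul hw hwb).1
  rw [← integral_add i1 i2]
  refine integral_mono_ae ((hfi.sub hki).abs.integrable_mul hw hwb).1 (i1.add i2) ?_
  filter_upwards [hf0, hk0, ae_restrict_mem measurableSet_Ioi] with x h1 h2 hx
  rw [← mul_add]
  refine mul_le_mul_of_nonneg_left ?_ (hw0 x hx)
  rw [abs_le]
  constructor <;> linarith

/-! ### Gronwall's inequality for the difference and the conclusion -/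

section

variable {W V : ℝ → ℝ → ℝ} {ε α Λ : ℝ} {f₀ : ℝ → ℝ} {f k : ℝ → ℝ → ℝ}

/-- The initial term is absent because both solutions start from the same datum. The cut-off at R is
removed with φ fixed, as B multiplies the flux error and may grow with the truncation level of φ. -/
theorem integral_weight_mul_abs_sub_le (hWV : IsAdmissible W V) (h0 : 0 ≤ ε) (h1 : ε ≤ 1)
    (hα : 1 ≤ α) (hf : IsMildSolution (pertKernel ε W) (pertKernel ε V) α f₀ f)
    (hk : IsMildSolution (fun _ _ => 2) (fun _ _ => 2) α f₀ k)
    (hfF : NoFlux f) (hkF : NoFlux k) (hfΛ : ∀ t, 0 ≤ t → normL1 α (f t) ≤ Λ)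
    (hkΛ : ∀ t, 0 ≤ t → normL1 α (k t) ≤ Λ)
    (hgc : ContinuousOn (fun t => normL1 α (fun x => f t x - k t x)) (Ici 0))
    {φ : ℝ → ℝ} {B : ℝ} (hφ : IsWeight φ B) (hφα : ∀ x, 0 < x → φ x ≤ (1 + x) ^ α)
    (hΦ : ∀ z, 0 < z → 2 * (∫ y in (0 : ℝ)..z, φ y) - z * φ z + φ z ≤ 2 * (1 + z) ^ α)
    {t : ℝ} (ht : 0 ≤ t) :
    ∫ x, φ x * |f t x - k t x| ∂ν₊ ≤ ∫ s in (0 : ℝ)..t,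
      ((2 + 6 * Λ) * normL1 α (fun x => f s x - k s x) + ε * (2 * Λ + 2 * Λ ^ 2)) := by
  have hp := hWV.isKernelPair h0 h1
  have hp2 := isKernelPair_two
  have hwm : Measurable fun x : ℝ => |2 * (1 + x) ^ α| := ((measurable_weight α).const_mul 2).abs
  have hwb : ∀ x : ℝ, 0 < x → |(fun x : ℝ => |2 * (1 + x) ^ α|) x| ≤ 2 * (1 + x) ^ α :=
    fun x hx => by
      simp only [abs_abs]
      rw [abs_of_nonneg (by positivity)]
  have T1 := (hfF t ht).add (hkF t ht)
  have T2 := (hf.tendsto_integral_tail zero_le_two hwm hwb ht).add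
    (hk.tendsto_integral_tail zero_le_two hwm hwb ht)
  have T3 := (T1.const_mul (3 * B)).add T2
  have T4 := (tendsto_const_nhds (x := ∫ s in (0 : ℝ)..t,
    ((2 + 6 * Λ) * normL1 α (fun x => f s x - k s x) + ε * (2 * Λ + 2 * Λ ^ 2)))).add T3
  simp only [mul_zero, add_zero] at T4
  have T5 := hφ.tendsto_integral_indicator hα ((hf.memL1 t ht).sub (hk.memL1 t ht)).abs
  refine le_of_tendsto_of_tendsto T5 T4 ?_
  filter_upwards [eventually_gt_atTop 0] with R hR
  have htest := hφ.isTest_indicator hR.le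
  obtain ⟨J, he⟩ := integral_mul_abs_eq_of_mild (μ := ν₊) (ψ := indicator (Iic R) φ)
    (g := fun s x => f s x - k s x)
    (h := fun s x => (coag (pertKernel ε W) (f s) (f s) x + frag (pertKernel ε V) (f s) x) -
      (coag (fun _ _ => 2) (k s) (k s) x + frag (fun _ _ => 2) (k s) x)) ht
    (hf.measurable.sub hk.measurable)
    ((measurable_coag_add_frag hp.measurable_K hp.measurable_F hf.measurable).sub
      (measurable_coag_add_frag hp2.measurable_K hp2.measurable_F hk.measurable))
    (fun s hs _ => by
      filter_upwards [hf.mild s hs, hk.mild s hs] with x a1 a2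
      refine ⟨a1.1.sub a2.1, ?_⟩
      rw [intervalIntegral.integral_sub a1.1 a2.1, a1.2, a2.2]
      ring)
    (by
      refine ((hf.integrable_test_mul hp hα htest t).sub
        (hk.integrable_test_mul hp2 hα htest t)).congr (Eventually.of_forall fun p => ?_)
      simp only [Pi.sub_apply]
      ring)
  have F1 := hf.intervalIntegrable_integral (measurable_fluxWeight R) (fluxWeight_bound hα R)
    le_rfl ht
  have F2 := hk.intervalIntegrable_integral (measurable_fluxWeight R) (fluxWeight_bound hα R)
    le_rfl ht
  have him := hwm.indicator (measurableSet_Ioi (a := R))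
  have F3 := hf.intervalIntegrable_integral him (abs_indicator_Ioi_le hwb R) le_rfl ht
  have F4 := hk.intervalIntegrable_integral him (abs_indicator_Ioi_le hwb R) le_rfl ht
  have F5 : IntervalIntegrable (fun s => (2 + 6 * Λ) * normL1 α (fun x => f s x - k s x) +
      ε * (2 * Λ + 2 * Λ ^ 2)) volume 0 t :=
    (((continuousOn_const.mul hgc).add continuousOn_const).mono
      Icc_subset_Ici_self).intervalIntegrable_of_Icc ht
  rw [he, ← intervalIntegral.integral_add F1 F2, ← intervalIntegral.integral_add F3 F4,
    ← intervalIntegral.integral_const_mul,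
    ← intervalIntegral.integral_add ((F1.add F2).const_mul _) (F3.add F4),
    ← intervalIntegral.integral_add F5 (((F1.add F2).const_mul _).add (F3.add F4))]
  refine intervalIntegral.integral_mono_on ht J
    (F5.add (((F1.add F2).const_mul _).add (F3.add F4))) fun s hs => ?_
  have hs0 : 0 ≤ s := hs.1
  have b1 := integral_sign_mul_rhs_sub_le hWV h0 h1 hα (hf.measurable_slice s)
    (hk.measurable_slice s) (hf.memL1 s hs0) (hk.memL1 s hs0) (hfΛ s hs0) (hkΛ s hs0) hφ hφα
    hΦ hR
  have b2 := integral_mul_abs_sub_le_add (hf.memL1 s hs0) (hk.memL1 s hs0) (hf.nonneg s hs0)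
    (hk.nonneg s hs0) (measurable_fluxWeight R) (fluxWeight_bound hα R)
    fun x hx => fluxWeight_nonneg hx
  have b3 := integral_mul_abs_sub_le_add (hf.memL1 s hs0) (hk.memL1 s hs0) (hf.nonneg s hs0)
    (hk.nonneg s hs0) him (abs_indicator_Ioi_le hwb R)
    fun x _ => indicator_apply_nonneg fun _ => abs_nonneg _
  have b4 := mul_le_mul_of_nonneg_left b2 (mul_nonneg zero_le_three hφ.B_nonneg)
  linarith

theorem normL1_sub_le_exp (hWV : IsAdmissible W V) (h0 : 0 ≤ ε) (h1 : ε ≤ 1)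
    (hα : 1 ≤ α) (hf : IsMildSolution (pertKernel ε W) (pertKernel ε V) α f₀ f)
    (hk : IsMildSolution (fun _ _ => 2) (fun _ _ => 2) α f₀ k)
    (hfF : NoFlux f) (hkF : NoFlux k) (hΛ0 : 0 ≤ Λ) (hfΛ : ∀ t, 0 ≤ t → normL1 α (f t) ≤ Λ)
    (hkΛ : ∀ t, 0 ≤ t → normL1 α (k t) ≤ Λ) {t : ℝ} (ht : 0 ≤ t) :
    normL1 α (fun x => f t x - k t x) ≤
      ε * (2 * Λ + 2 * Λ ^ 2) / (2 + 6 * Λ) * (Real.exp ((2 + 6 * Λ) * t) - 1) := by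
  have hgc : ContinuousOn (fun t => normL1 α (fun x => f t x - k t x)) (Ici 0) := by
    refine continuousOn_of_tendsto_dist (d := fun s t =>
      normL1 α (fun x => f s x - f t x) + normL1 α (fun x => k s x - k t x))
      (fun t ht => by simpa using (hf.continuous t ht).add (hk.continuous t ht))
      fun s t hs ht => ?_
    have m1 := (hf.memL1 s hs).sub (hk.memL1 s hs)
    have m2 := (hf.memL1 t ht).sub (hk.memL1 t ht)
    refine (m1.abs_normL1_sub_le m2).trans (le_trans (le_of_eq ?_)
      (((hf.memL1 s hs).sub (hf.memL1 t ht)).normL1_sub_le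
        ((hk.memL1 s hs).sub (hk.memL1 t ht))))
    congr 1
    funext x
    ring
  refine le_exp_of_le_integral (by positivity) hgc (fun t ht => ?_) ht
  have hn : ∀ R : ℝ, 1 ≤ max R 1 := fun R => le_max_right _ _
  have hgt := ((hf.memL1 t ht).sub (hk.memL1 t ht)).abs
  have T := hgt.tendsto_integral_weight (C := 1) (w := fun x => (1 + x) ^ α)
    (fun R => measurable_truncWeight α (max R 1))
    (fun R x hx => by
      rw [one_mul, abs_of_nonneg ((isWeight_truncWeight hα (hn R)).nonneg x hx)]
      exact truncWeight_le hα (hn R) hx)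
    (fun x hx => by
      filter_upwards [eventually_ge_atTop (1 + x)] with R hR
      exact truncWeight_of_le (by linarith) (hR.trans (le_max_left _ _)))
  -- The right-hand side does not depend on the truncation level, so the weights may increase to
  -- (1+x)^α.
  refine (le_of_tendsto' T fun R => integral_weight_mul_abs_sub_le hWV h0 h1 hα hf hk hfF hkF
    hfΛ hkΛ hgc (isWeight_truncWeight hα (hn R)) (fun x hx => truncWeight_le hα (hn R) hx)
    (fun z hz => ?_) ht).trans_eq ?_
  · have a1 := two_mul_integral_truncWeight_le hα (hn R) hz
    have a2 := truncWeight_le hα (hn R) hz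
    have a3 : 0 ≤ (α - 1) / (α + 1) * (min (1 + z) (max R 1)) ^ (α + 1) :=
      mul_nonneg (div_nonneg (by linarith) (by linarith))
        (Real.rpow_nonneg (le_min (by linarith) (by linarith [hn R])) _)
    linarith
  · have F1 : IntervalIntegrable (fun s => normL1 α (fun x => f s x - k s x)) volume 0 t :=
      (hgc.mono Icc_subset_Ici_self).intervalIntegrable_of_Icc ht
    rw [intervalIntegral.integral_add (F1.const_mul _) intervalIntegrable_const,
      intervalIntegral.integral_const_mul, intervalIntegral.integral_const, smul_eq_mul]
    ring

end

theorem mainTheorem7 (α : ℝ) (hα : 1 ≤ α) (f₀ : ℝ → ℝ) (hf₀ : MemL1 α f₀)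
    (hf₀_nonneg : ∀ᵐ x ∂(volume.restrict (Ioi (0 : ℝ))), 0 ≤ f₀ x) :
    ∃ C A : ℝ, 0 < C ∧ 0 < A ∧
      ∀ W V : ℝ → ℝ → ℝ, IsAdmissible W V →
      ∀ ε : ℝ, 0 ≤ ε → ε ≤ 1 →
      ∀ fε fz : ℝ → ℝ → ℝ,
        IsMildSolution (pertKernel ε W) (pertKernel ε V) α f₀ fε →
        IsMildSolution (pertKernel 0 W) (pertKernel 0 V) α f₀ fz →
        (α < 2 → ConservesMass f₀ fε ∧ ConservesMass f₀ fz) →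
        ∀ t : ℝ, 0 ≤ t →
          normL1 α (fun x => fε t x - fz t x) ≤ ε * C * (Real.exp (A * t) - 1) := by
  obtain ⟨Λ, hΛ0, hΛ⟩ := exists_normL1_bound hα f₀
  -- The summand 1 keeps the constant positive when Λ = 0.
  refine ⟨(2 * Λ + 2 * Λ ^ 2) / (2 + 6 * Λ) + 1, 2 + 6 * Λ, by positivity, by positivity, ?_⟩
  intro W V hWV ε h0 h1 fε fz hfε hfz hM t ht
  have hp := hWV.isKernelPair h0 h1
  have hpz : ∀ W : ℝ → ℝ → ℝ, pertKernel 0 W = fun _ _ => 2 := fun W => by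
    funext x y
    simp [pertKernel]
  rw [hpz, hpz] at hfz
  have hF := hfε.noFlux hp hα fun h => (hM h).1
  have hFz := hfz.noFlux isKernelPair_two hα fun h => (hM h).2
  refine (normL1_sub_le_exp hWV h0 h1 hα hfε hfz hF hFz hΛ0 (hΛ _ _ _ hp hfε hF)
    (hΛ _ _ _ isKernelPair_two hfz hFz) ht).trans ?_
  have hexp : 0 ≤ Real.exp ((2 + 6 * Λ) * t) - 1 :=
    sub_nonneg.2 (Real.one_le_exp (by positivity))
  refine mul_le_mul_of_nonneg_right ?_ hexp
  rw [mul_div_assoc]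
  exact mul_le_mul_of_nonneg_left (by linarith) h0
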